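/- Let $d\in\mathbb N$, let $\Omega\subset\mathbb R^d$ be a bounded Lipschitz domain, and let $T>0$, $\gamma>1$, $\mu>0$, $\eta\ge 0$. Consider the isentropic compressible Navier–Stokes equations $$\partial_t(\rho u)+\operatorname{div}(\rho u\otimes u)+\nabla\rho^\gamma=\operatorname{div}\mathbb S(\nabla u),\qquad \partial_t\rho+\operatorname{div}(\rho u)=0 \tag{NS}$$ with the Newtonian stress $\mathbb S(\nabla u)=\mu\big(\nabla u+\nabla^t u-\tfrac23(\operatorname{div}u)I\big)+\eta(\operatorname{div}u)I$. A pair $(\rho,u)$ with $\rho\ge 0$ is a *weak solution* of (NS) with initial datum $(\rho^0,u^0)$ if $\rho\in L^\gamma(\Omega\times(0,T))$, $\rho|u|^2\in L^1(\Omega\times(0,T))$, $u\in L^2(0,T;H^1_0(\Omega;\mathbb R^d))$, and $$\int_0^\tau\!\!\int_\Omega \partial_t\psi\,\rho+\nabla\psi\cdot\rho u\,dx\,dt+\int_\Omega\psi(x,0)\rho^0-\psi(x,\tau)\rho(x,\tau)\,dx=0,$$ $$\int_0^\tau\!\!\int_\Omega \partial_t\phi\cdot\rho u+\nabla\phi:(\rho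 u\otimes u)+\operatorname{div}\phi\,\rho^\gamma-\mathbb S(\nabla u):\nabla\phi\,dx\,dt+\int_\Omega\phi(x,0)\cdot\rho^0u^0-\phi(x,\tau)\cdot\rho u(x,\tau)\,dx=0$$ for all $\psi\in C^1(\overline\Omega\times[0,T])$, all $\phi\in C^1_c(\Omega\times[0,T];\mathbb R^d)$ and almost every $\tau\in(0,T)$. It is *globally admissible* if for almost every $\tau\in(0,T)$ $$\int_\Omega\tfrac12\rho|u|^2(x,\tau)+\tfrac1{\gamma-1}\rho(x,\tau)^\gamma\,dx+\int_0^\tau\!\!\int_\Omega\mathbb S(\nabla u):\nabla u\,dx\,dt\le\int_\Omega\tfrac12\rho^0|u^0|^2+\tfrac1{\gamma-1}(\rho^0)^\gamma\,dx.$$ Let $(\rho,u)$ be a globally admissible weak solution of (NS), and let $(R,U)$ be a strong solution, i.e. (NS) holds pointwise in $\Omega\times(0,T)$, with $$R\in C^1(\overline\Omega\times[0,T]),\quad R>0\ \text{on}\ \overline\Omega\times[0,T],\quad U\in C^1([0,T];C^2(\overline\Omega;\mathbb R^d)),\quad U=0\ \text{on}\ \partial\Omega\times[0,T].$$ If both solutions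 have the same initial data, i.e. $R(\cdot,0)=\rho^0$ and $U(\cdot,0)=u^0$ almost everywhere in $\Omega$, then $\rho=R$ and $u=U$ almost everywhere in $\Omega\times(0,T)$. -/

import Mathlib

open MeasureTheory Set Filter Topology
open scoped ContDiff

namespace CompressibleNS

/-- Physical space `ℝ^d` with its Euclidean norm. -/
abbrev Space (d : ℕ) : Type := EuclideanSpace ℝ (Fin d)

/-! ### Domains -/

/-- A bounded Lipschitz domain: a nonempty, bounded, connected open set which near each of its
boundary points is, in a direction `e`, the strict epigraph of a Lipschitz function of the component
orthogonal to `e`. -/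
structure IsBoundedLipschitzDomain {d : ℕ} (Ω : Set (Space d)) : Prop where
  isOpen : IsOpen Ω
  isConnected : IsConnected Ω
  isBounded : Bornology.IsBounded Ω
  lipschitz_boundary : ∀ x₀ ∈ frontier Ω, ∃ r > 0, ∃ e : Space d, ‖e‖ = 1 ∧
    ∃ (K : NNReal) (h : Space d → ℝ), LipschitzWith K h ∧
      ∀ x ∈ Metric.ball x₀ r, x ∈ Ω ↔ h (x - inner ℝ x e • e) < inner ℝ x e

/-- The open space-time cylinder; its points are written `(t, x)`. -/
def stCylinder {d : ℕ} (T : ℝ) (Ω : Set (Space d)) : Set (ℝ × Space d) :=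
  Ioo 0 T ×ˢ Ω

/-! ### Differential operators -/

/-- The partial derivative `∂_j f (x)`. -/
noncomputable def pd {d : ℕ} (j : Fin d) (f : Space d → ℝ) (x : Space d) : ℝ :=
  fderiv ℝ f x (EuclideanSpace.single j 1)

/-- The gradient matrix `(∇w)_{ij} = ∂_j w_i`. -/
noncomputable def grad {d : ℕ} (w : Space d → Space d) (x : Space d) : Matrix (Fin d) (Fin d) ℝ :=
  Matrix.of fun i j => pd j (fun y => w y i) x

/-- The contraction `A : B`. -/
def contract {d : ℕ} (A B : Matrix (Fin d) (Fin d) ℝ) : ℝ :=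
  ∑ i, ∑ j, A i j * B i j

/-- The Newtonian viscous stress
`𝕊(A) = μ (A + Aᵗ - (2/3) (tr A) I) + η (tr A) I`, to be evaluated at `A = ∇u`. -/
noncomputable def stress {d : ℕ} (μ η : ℝ) (A : Matrix (Fin d) (Fin d) ℝ) :
    Matrix (Fin d) (Fin d) ℝ :=
  μ • (A + A.transpose - ((2 / 3 : ℝ) * A.trace) • (1 : Matrix (Fin d) (Fin d) ℝ))
    + (η * A.trace) • (1 : Matrix (Fin d) (Fin d) ℝ)

/-! ### Function spaces -/

/-- `f ∈ C^n(closure G)` for an open set `G`: `f` is continuous on `closure G`, of class `C^n` in `G`,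
and all its derivatives up to order `n` extend continuously from `G` to `closure G`. -/
def ContDiffUpTo {E F : Type*} [NormedAddCommGroup E] [NormedSpace ℝ E]
    [NormedAddCommGroup F] [NormedSpace ℝ F] (n : ℕ) (f : E → F) (G : Set E) : Prop :=
  ContinuousOn f (closure G) ∧ ContDiffOn ℝ n f G ∧
    ∀ k ≤ n, ∃ g : E → ContinuousMultilinearMap ℝ (fun _ : Fin k => E) F,
      ContinuousOn g (closure G) ∧ EqOn g (iteratedFDeriv ℝ k f) G

/-- Convergence in the norm of `C^n(closure G)`: uniform convergence of all derivatives up to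
order `n`. -/
def TendstoCk {ι E F : Type*} [NormedAddCommGroup E] [NormedSpace ℝ E]
    [NormedAddCommGroup F] [NormedSpace ℝ F] (n : ℕ) (f : ι → E → F) (g : E → F)
    (l : Filter ι) (G : Set E) : Prop :=
  ∀ k ≤ n, TendstoUniformlyOn (fun s => iteratedFDeriv ℝ k (f s)) (iteratedFDeriv ℝ k g) l G

/-- `U ∈ C^1([0,T]; C^2(closure Ω))`: there is a map `V` (the time derivative), continuous from
`[0,T]` to `C^2(closure Ω)`, to which the difference quotients of `U` converge in
`C^2(closure Ω)`. -/
def IsC1C2 {d : ℕ} (Ω : Set (Space d)) (T : ℝ) (U : ℝ × Space d → Space d) : Prop :=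
  (∀ t ∈ Icc 0 T, ContDiffUpTo 2 (fun x => U (t, x)) Ω) ∧
    ∃ V : ℝ × Space d → Space d, ∀ t ∈ Icc 0 T,
      ContDiffUpTo 2 (fun x => V (t, x)) Ω ∧
      TendstoCk 2 (fun s x => (s - t)⁻¹ • (U (s, x) - U (t, x))) (fun x => V (t, x))
        (𝓝[Icc 0 T \ {t}] t) Ω ∧
      TendstoCk 2 (fun s x => V (s, x)) (fun x => V (t, x)) (𝓝[Icc 0 T] t) Ω

/-- `w ∈ H^1_0(Ω; ℝ^d)` with weak gradient `A`: there are `C_c^∞(Ω)` fields converging to `w` in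
`L^2(Ω)` whose gradients converge to `A` in `L^2(Ω)`. -/
def IsH10 {d : ℕ} (Ω : Set (Space d)) (w : Space d → Space d)
    (A : Space d → Matrix (Fin d) (Fin d) ℝ) : Prop :=
  MemLp w 2 (volume.restrict Ω) ∧ (∀ i j, MemLp (fun x => A x i j) 2 (volume.restrict Ω)) ∧
    ∃ φ : ℕ → Space d → Space d,
      (∀ n, ContDiff ℝ ∞ (φ n) ∧ HasCompactSupport (φ n) ∧ tsupport (φ n) ⊆ Ω) ∧
      Tendsto (fun n => eLpNorm (fun x => φ n x - w x) 2 (volume.restrict Ω)) atTop (𝓝 0) ∧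
      ∀ i j, Tendsto (fun n => eLpNorm (fun x => grad (φ n) x i j - A x i j) 2
        (volume.restrict Ω)) atTop (𝓝 0)

/-- `u ∈ L^2(0,T; H^1_0(Ω; ℝ^d))` with spatial weak gradient `G`. -/
structure IsL2H10 {d : ℕ} (Ω : Set (Space d)) (T : ℝ) (u : ℝ × Space d → Space d)
    (G : ℝ × Space d → Matrix (Fin d) (Fin d) ℝ) : Prop where
  memLp : MemLp u 2 (volume.restrict (stCylinder T Ω))
  memLp_grad : ∀ i j, MemLp (fun z => G z i j) 2 (volume.restrict (stCylinder T Ω))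
  slice : ∀ᵐ t ∂(volume.restrict (Ioo 0 T)),
    IsH10 Ω (fun x => u (t, x)) (fun x => G (t, x))

/-! ### Solutions -/

/-- The energy `∫_Ω ½ ρ|u|² + ρ^γ / (γ-1) dx` of a state. -/
noncomputable def energy {d : ℕ} (Ω : Set (Space d)) (γ : ℝ) (ρ : Space d → ℝ)
    (u : Space d → Space d) : ℝ :=
  ∫ x in Ω, (1 / 2 * (ρ x * ‖u x‖ ^ 2) + 1 / (γ - 1) * ρ x ^ γ)

/-- The weak continuity equation, tested with `ψ ∈ C^1(closure Ω × [0,T])`. -/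
def WeakMass {d : ℕ} (Ω : Set (Space d)) (T : ℝ) (ρ₀ : Space d → ℝ)
    (ρ : ℝ × Space d → ℝ) (u : ℝ × Space d → Space d) : Prop :=
  ∀ ψ : ℝ × Space d → ℝ, ContDiffUpTo 1 ψ (stCylinder T Ω) →
    ∀ᵐ τ ∂(volume.restrict (Ioo 0 T)),
      (∫ z in stCylinder τ Ω,
        (deriv (fun s => ψ (s, z.2)) z.1 * ρ z
          + (∑ j, pd j (fun y => ψ (z.1, y)) z.2 * (ρ z * u z j))))
      + (∫ x in Ω, (ψ (0, x) * ρ₀ x - ψ (τ, x) * ρ (τ, x))) = 0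

/-- The weak momentum equation, tested with `φ ∈ C_c^1(Ω × [0,T]; ℝ^d)`; here `G` is the
spatial gradient of `u`. -/
def WeakMomentum {d : ℕ} (Ω : Set (Space d)) (T γ μ η : ℝ) (ρ₀ : Space d → ℝ)
    (u₀ : Space d → Space d) (ρ : ℝ × Space d → ℝ) (u : ℝ × Space d → Space d)
    (G : ℝ × Space d → Matrix (Fin d) (Fin d) ℝ) : Prop :=
  ∀ φ : ℝ × Space d → Space d, ContDiffUpTo 1 φ (stCylinder T Ω) →
    (∃ K : Set (Space d), IsCompact K ∧ K ⊆ Ω ∧ ∀ t ∈ Icc 0 T, ∀ x ∉ K, φ (t, x) = 0) →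
    ∀ᵐ τ ∂(volume.restrict (Ioo 0 T)),
      (∫ z in stCylinder τ Ω,
        ((∑ i, deriv (fun s => φ (s, z.2) i) z.1 * (ρ z * u z i))
          + contract (grad (fun y => φ (z.1, y)) z.2) (Matrix.of fun i j => ρ z * u z i * u z j)
          + (grad (fun y => φ (z.1, y)) z.2).trace * ρ z ^ γ
          - contract (stress μ η (G z)) (grad (fun y => φ (z.1, y)) z.2)))
      + (∫ x in Ω, ((∑ i, φ (0, x) i * (ρ₀ x * u₀ x i))
          - (∑ i, φ (τ, x) i * (ρ (τ, x) * u (τ, x) i)))) = 0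

/-- `(ρ, u)` is a globally admissible weak solution on `Ω × (0,T)` with initial datum
`(ρ₀, u₀)`. -/
def IsAdmissibleWeakSolution {d : ℕ} (Ω : Set (Space d)) (T γ μ η : ℝ) (ρ₀ : Space d → ℝ)
    (u₀ : Space d → Space d) (ρ : ℝ × Space d → ℝ) (u : ℝ × Space d → Space d) : Prop :=
  (∀ᵐ z ∂(volume.restrict (stCylinder T Ω)), 0 ≤ ρ z) ∧
  MemLp ρ (ENNReal.ofReal γ) (volume.restrict (stCylinder T Ω)) ∧
  Integrable (fun z => ρ z * ‖u z‖ ^ 2) (volume.restrict (stCylinder T Ω)) ∧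
  ∃ G : ℝ × Space d → Matrix (Fin d) (Fin d) ℝ,
    IsL2H10 Ω T u G ∧
    WeakMass Ω T ρ₀ ρ u ∧
    WeakMomentum Ω T γ μ η ρ₀ u₀ ρ u G ∧
    ∀ᵐ τ ∂(volume.restrict (Ioo 0 T)),
      energy Ω γ (fun x => ρ (τ, x)) (fun x => u (τ, x))
        + (∫ z in stCylinder τ Ω, contract (stress μ η (G z)) (G z)) ≤ energy Ω γ ρ₀ u₀

/-- `(R, U)` is a strong solution on `Ω × [0,T]` with initial datum `(ρ₀, u₀)`:
`R ∈ C^1(closure Ω × [0,T])`, `R > 0`, `U ∈ C^1([0,T]; C^2(closure Ω))`, `U = 0` on `∂Ω`, and the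
equations hold pointwise. -/
structure IsStrongSolution {d : ℕ} (Ω : Set (Space d)) (T γ μ η : ℝ) (ρ₀ : Space d → ℝ)
    (u₀ : Space d → Space d) (R : ℝ × Space d → ℝ) (U : ℝ × Space d → Space d) : Prop where
  density_C1 : ContDiffUpTo 1 R (stCylinder T Ω)
  density_pos : ∀ t ∈ Icc 0 T, ∀ x ∈ closure Ω, 0 < R (t, x)
  velocity_C1C2 : IsC1C2 Ω T U
  no_slip : ∀ t ∈ Icc 0 T, ∀ x ∈ frontier Ω, U (t, x) = 0
  mass : ∀ t ∈ Ioo 0 T, ∀ x ∈ Ω,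
    deriv (fun s => R (s, x)) t + (∑ j, pd j (fun y => R (t, y) * U (t, y) j) x) = 0
  momentum : ∀ t ∈ Ioo 0 T, ∀ x ∈ Ω, ∀ i,
    deriv (fun s => R (s, x) * U (s, x) i) t
      + (∑ j, pd j (fun y => R (t, y) * U (t, y) i * U (t, y) j) x)
      + pd i (fun y => R (t, y) ^ γ) x
      = ∑ j, pd j (fun y => stress μ η (grad (fun y' => U (t, y')) y) i j) x
  initial : ∀ᵐ x ∂(volume.restrict Ω), R (0, x) = ρ₀ x ∧ U (0, x) = u₀ x

end CompressibleNS

/-!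
Weak-strong uniqueness for the isentropic compressible Navier-Stokes equations, by the relative energy
method. The relative energy

  `E(τ) = ∫ ½ ρ |u - U|² + H(ρ) - H(R) - H'(R) (ρ - R) dx`,  `H(s) = s ^ γ / (γ - 1)`,

is nonnegative and vanishes only if the two solutions agree. Expanding it shows that it combines the
energy of the weak solution, the momentum balance tested with `U`, the mass balance tested with
`½ |U|² - H'(R)`, and `∫ R ^ γ`. Hence `E(τ)` is at most the integral up to time `τ` of an explicit
density (`relEnergy_inequality`, `production`). The strong equations rewrite this density
(`relEnergy_production_eq`) as minus the dissipation of `w = u - U`, plus errors that are quadratic in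
the difference of the solutions, plus a bracket whose integral over each time slice vanishes by parts.

The only error that the relative energy does not control directly is `(ρ - R) / R * w · div 𝕊(∇U)`.
Since `(√ρ - √R)²` is bounded by the relative pressure potential
(`rpow_mul_sq_sqrt_sub_le_relPot`), the factorization `ρ - R = (√ρ - √R) (√ρ + √R)` bounds it by
`C E + ε ∫ |w|²`, without distinguishing small and large densities. The inequalities of Poincaré and
Korn in `H¹₀` (`IsH10C2.integral_sq_le`, `IsH10C2.le_integral_stress`) let the dissipation absorb
`ε ∫ |w|²`. This gives `integral_production_le`, and Grönwall's inequality yields `E = 0`.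

Two points need care. The velocity `U` vanishes on the boundary but is not compactly supported in `Ω`,
so it is not an admissible test field. Its components are truncated near their zero sets, where their
derivatives vanish almost everywhere (`ae_fderiv_eq_zero_of_eq_zero`); this gives both
`WeakMomentum.test_of_eq_zero_frontier` and, on time slices, `isH10C2_of_eq_zero_frontier`, and uses no
regularity of the boundary. Also, in dimension `d ≥ 4` the stress is not pointwise coercive, since the
factor `2/3` is that of dimension three; coercivity holds after integration, because
`∫ ∇w : ∇ᵗw = ∫ (div w)²` in `H¹₀`.
-/

namespace CompressibleNS

/-! ### The relative pressure potential -/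

/-- The relative pressure potential `H(r) - H(R) - H'(R)(r - R)` of `H(s) = s^γ / (γ - 1)`. -/
noncomputable def relPot (γ r R : ℝ) : ℝ :=
  1 / (γ - 1) * r ^ γ - 1 / (γ - 1) * R ^ γ - γ / (γ - 1) * R ^ (γ - 1) * (r - R)

/-- Quantitative convexity of the pressure potential. -/
lemma rpow_mul_sq_sqrt_sub_le_relPot {γ r R : ℝ} (hγ : 1 < γ) (hr : 0 ≤ r) (hR : 0 < R) :
    R ^ (γ - 1) * (√r - √R) ^ 2 ≤ relPot γ r R := by
  have hg : 0 < γ - 1 := by linarith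
  have hRp : 0 < R ^ (γ - 1) := Real.rpow_pos_of_pos hR _
  have hRγ : R ^ γ = R ^ (γ - 1) * R := by
    rw [← Real.rpow_add_one hR.ne']; congr 1; ring
  have hRs : √R ^ 2 = R := Real.sq_sqrt hR.le
  have hrs : √r ^ 2 = r := Real.sq_sqrt hr
  -- `s ^ γ ≥ s + 2 (γ - 1) (s - √s)` for `s = r / R`, in homogeneous form
  have key : R ^ (γ - 1) * (r + 2 * (γ - 1) * (r - √r * √R)) ≤ r ^ γ := by
    rcases hr.eq_or_lt with rfl | hr
    · simp [Real.zero_rpow (by linarith : γ ≠ 0)]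
    have h1 : r ^ γ = R ^ (γ - 1) * r * (r / R) ^ (γ - 1) := by
      rw [Real.div_rpow hr.le hR.le]
      have : r ^ γ = r ^ (γ - 1) * r := by
        rw [← Real.rpow_add_one hr.ne']; congr 1; ring
      rw [this]; field_simp
    have hsr : 0 < √r := Real.sqrt_pos.2 hr
    have hsR : 0 < √R := Real.sqrt_pos.2 hR
    have h2 : 2 * (1 - √R / √r) ≤ Real.log (r / R) := by
      have : Real.log (r / R) = -(2 * Real.log (√R / √r)) := by
        rw [Real.log_div hr.ne' hR.ne', Real.log_div hsR.ne' hsr.ne', Real.log_sqrt hr.le,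
          Real.log_sqrt hR.le]
        ring
      rw [this]
      have := Real.log_le_sub_one_of_pos (div_pos hsR hsr)
      linarith
    have h3 : 1 + (γ - 1) * (2 * (1 - √R / √r)) ≤ (r / R) ^ (γ - 1) := by
      rw [Real.rpow_def_of_pos (div_pos hr hR)]
      have := Real.add_one_le_exp (Real.log (r / R) * (γ - 1))
      nlinarith
    rw [h1, mul_assoc (R ^ (γ - 1)) r]
    refine mul_le_mul_of_nonneg_left ?_ hRp.le
    have h4 : r * (√R / √r) = √r * √R := by
      calc r * (√R / √r) = √r ^ 2 * (√R / √r) := by rw [hrs]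
        _ = √r * √R := by field_simp
    have := mul_le_mul_of_nonneg_left h3 hr.le
    calc r + 2 * (γ - 1) * (r - √r * √R)
        = r * (1 + (γ - 1) * (2 * (1 - √R / √r))) := by rw [← h4]; ring
      _ ≤ _ := this
  have e : (√r - √R) ^ 2 = r - 2 * (√r * √R) + R := by
    rw [sub_sq, hrs, hRs]; ring
  have e2 : relPot γ r R = (r ^ γ - R ^ (γ - 1) * R - γ * R ^ (γ - 1) * (r - R)) / (γ - 1) := by
    rw [relPot, hRγ]; field_simp
  rw [e, e2, le_div_iff₀ hg]
  nlinarith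

lemma relPot_nonneg {γ r R : ℝ} (hγ : 1 < γ) (hr : 0 ≤ r) (hR : 0 < R) : 0 ≤ relPot γ r R :=
  le_trans (mul_nonneg (Real.rpow_nonneg hR.le _) (sq_nonneg _))
    (rpow_mul_sq_sqrt_sub_le_relPot hγ hr hR)

lemma eq_of_relPot_eq_zero {γ r R : ℝ} (hγ : 1 < γ) (hr : 0 ≤ r) (hR : 0 < R)
    (h : relPot γ r R = 0) : r = R := by
  have h1 := rpow_mul_sq_sqrt_sub_le_relPot hγ hr hR
  rw [h] at h1
  have h2 : (√r - √R) ^ 2 = 0 := by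
    have hp := Real.rpow_pos_of_pos hR (γ - 1)
    have := sq_nonneg (√r - √R)
    by_contra hne
    have : 0 < (√r - √R) ^ 2 := lt_of_le_of_ne this (Ne.symm hne)
    nlinarith [mul_pos hp this]
  have h3 : √r = √R := by nlinarith
  exact (Real.sqrt_inj hr hR.le).1 h3

/-- The density difference against the velocity difference is controlled by the relative energy and
an arbitrarily small multiple of the squared velocity difference. No case distinction on the size of
`r` is needed: `|r - R| = |√r - √R| (√r + √R)`. -/
lemma abs_sub_mul_le {γ r R a : ℝ} {W ε : ℝ} (hγ : 1 < γ) (hr : 0 ≤ r) (hR : 0 < R)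
    (ha : 0 < a) (haR : a ≤ R ^ (γ - 1)) (hε : 0 < ε) :
    |r - R| * W ≤ (1 / a + R / (a * ε)) * relPot γ r R + r * W ^ 2 + ε * W ^ 2 := by
  have h1 := rpow_mul_sq_sqrt_sub_le_relPot hγ hr hR
  have hRs : √R ^ 2 = R := Real.sq_sqrt hR.le
  have hrs : √r ^ 2 = r := Real.sq_sqrt hr
  set D := |√r - √R| with hD
  have hD2 : D ^ 2 = (√r - √R) ^ 2 := sq_abs _
  have h2 : a * D ^ 2 ≤ relPot γ r R :=
    le_trans (by rw [hD2]; exact mul_le_mul_of_nonneg_right haR (sq_nonneg _)) h1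
  have h3 : D ^ 2 ≤ relPot γ r R / a := by rw [le_div_iff₀ ha]; linarith
  have h4 : |r - R| = D * (√r + √R) := by
    rw [hD, ← abs_of_nonneg (add_nonneg (Real.sqrt_nonneg r) (Real.sqrt_nonneg R)), ← abs_mul]
    congr 1
    nlinarith
  have h5 : D * √r * W ≤ D ^ 2 + r * W ^ 2 := by
    have e : r * W ^ 2 = (√r * W) ^ 2 := by rw [mul_pow, hrs]
    rw [e]
    nlinarith [sq_nonneg (D - √r * W), sq_nonneg D, sq_nonneg (√r * W)]
  have h6 : D * √R * W ≤ R * D ^ 2 / ε + ε * W ^ 2 := by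
    have e : R * D ^ 2 = (√R * D) ^ 2 := by rw [mul_pow, hRs]
    rw [e, ← sub_le_iff_le_add, le_div_iff₀ hε]
    nlinarith [sq_nonneg (√R * D - ε * W), sq_nonneg (√R * D), sq_nonneg (ε * W)]
  have h7 : R * D ^ 2 / ε ≤ R / (a * ε) * relPot γ r R := by
    have : R * D ^ 2 / ε ≤ R * (relPot γ r R / a) / ε := by gcongr
    refine this.trans (le_of_eq ?_)
    field_simp
  rw [h4]
  have h8 : (1 / a) * relPot γ r R = relPot γ r R / a := by ring
  nlinarith

/-! ### Truncation near zero -/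

/-- A smooth truncation vanishing near `0` and equal to the identity away from `0`. -/
noncomputable def trunc (s : ℝ) : ℝ := s * Real.smoothTransition (s ^ 2 - 1)

lemma contDiff_trunc {n : ℕ∞} : ContDiff ℝ n trunc :=
  contDiff_id.mul (Real.smoothTransition.contDiff.comp ((contDiff_id.pow 2).sub contDiff_const))

lemma trunc_eq_zero {s : ℝ} (h : |s| ≤ 1) : trunc s = 0 := by
  have : s ^ 2 - 1 ≤ 0 := by nlinarith [abs_nonneg s, sq_abs s]
  simp [trunc, Real.smoothTransition.zero_of_nonpos this]

lemma trunc_eq_self {s : ℝ} (h : 2 ≤ |s|) : trunc s = s := by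
  have : 1 ≤ s ^ 2 - 1 := by nlinarith [abs_nonneg s, sq_abs s]
  simp [trunc, Real.smoothTransition.one_of_one_le this]

lemma abs_trunc_le (s : ℝ) : |trunc s| ≤ |s| := by
  rw [trunc, abs_mul, abs_of_nonneg (Real.smoothTransition.nonneg _)]
  exact mul_le_of_le_one_right (abs_nonneg _) (Real.smoothTransition.le_one _)

lemma deriv_trunc_eq_one {s : ℝ} (h : 2 < |s|) : deriv trunc s = 1 := by
  have : trunc =ᶠ[𝓝 s] id := by
    filter_upwards [(isOpen_lt continuous_const continuous_abs).mem_nhds h] with y hy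
    exact trunc_eq_self (le_of_lt hy)
  rw [this.deriv_eq]; simp

lemma exists_abs_deriv_trunc_le : ∃ C, ∀ s, |deriv trunc s| ≤ C := by
  have hc : Continuous (deriv trunc) := (contDiff_trunc (n := 1)).continuous_deriv le_rfl
  obtain ⟨C, hC⟩ := (isCompact_Icc (a := (-2 : ℝ)) (b := 2)).exists_bound_of_continuousOn
    hc.continuousOn
  refine ⟨max C 1, fun s => ?_⟩
  by_cases h : 2 < |s|
  · rw [deriv_trunc_eq_one h]; simp
  · exact (hC s (abs_le.1 (not_lt.1 h))).trans (le_max_left _ _)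

/-- The truncation at height `1 / (n + 1)`. -/
noncomputable def truncAt (n : ℕ) (s : ℝ) : ℝ := ((n : ℝ) + 1)⁻¹ * trunc (((n : ℝ) + 1) * s)

lemma contDiff_truncAt (n : ℕ) {k : ℕ∞} : ContDiff ℝ k (truncAt n) :=
  contDiff_const.mul (contDiff_trunc.comp (contDiff_const.mul contDiff_id))

lemma hasDerivAt_truncAt (n : ℕ) (s : ℝ) :
    HasDerivAt (truncAt n) (deriv trunc (((n : ℝ) + 1) * s)) s := by
  have h1 : HasDerivAt trunc (deriv trunc (((n : ℝ) + 1) * s)) (((n : ℝ) + 1) * s) :=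
    ((contDiff_trunc (n := 1)).differentiable one_ne_zero _).hasDerivAt
  have h2 : HasDerivAt (fun y : ℝ => ((n : ℝ) + 1) * y) ((n : ℝ) + 1) s := by
    simpa using (hasDerivAt_id s).const_mul ((n : ℝ) + 1)
  have h3 := (h1.comp s h2).const_mul ((n : ℝ) + 1)⁻¹
  have hn : (n : ℝ) + 1 ≠ 0 := by positivity
  refine h3.congr_deriv ?_
  field_simp

lemma deriv_truncAt (n : ℕ) (s : ℝ) : deriv (truncAt n) s = deriv trunc (((n : ℝ) + 1) * s) :=
  (hasDerivAt_truncAt n s).deriv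

lemma truncAt_eq_zero {n : ℕ} {s : ℝ} (h : |s| ≤ ((n : ℝ) + 1)⁻¹) : truncAt n s = 0 := by
  have hn : 0 < (n : ℝ) + 1 := by positivity
  rw [truncAt, trunc_eq_zero, mul_zero]
  rw [abs_mul, abs_of_pos hn]
  calc ((n : ℝ) + 1) * |s| ≤ ((n : ℝ) + 1) * ((n : ℝ) + 1)⁻¹ := by gcongr
    _ = 1 := mul_inv_cancel₀ hn.ne'

lemma abs_truncAt_le (n : ℕ) (s : ℝ) : |truncAt n s| ≤ |s| := by
  have hn : 0 < (n : ℝ) + 1 := by positivity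
  rw [truncAt, abs_mul, abs_of_pos (inv_pos.2 hn), inv_mul_le_iff₀ hn]
  refine (abs_trunc_le _).trans ?_
  rw [abs_mul, abs_of_pos hn]

lemma exists_abs_deriv_truncAt_le : ∃ C, ∀ n s, |deriv (truncAt n) s| ≤ C := by
  obtain ⟨C, hC⟩ := exists_abs_deriv_trunc_le
  exact ⟨C, fun n s => by rw [deriv_truncAt]; exact hC _⟩

lemma eventually_two_lt_abs {s : ℝ} (hs : s ≠ 0) : ∀ᶠ n : ℕ in atTop, 2 < |((n : ℝ) + 1) * s| := by
  have hs' : 0 < |s| := abs_pos.2 hs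
  filter_upwards [(tendsto_natCast_atTop_atTop (R := ℝ)).eventually_gt_atTop (2 / |s|)] with n hn
  rw [div_lt_iff₀ hs'] at hn
  have hn0 : (0 : ℝ) ≤ n := Nat.cast_nonneg n
  rw [abs_mul, abs_of_nonneg (by positivity)]
  nlinarith

lemma tendsto_truncAt (s : ℝ) : Tendsto (fun n => truncAt n s) atTop (𝓝 s) := by
  rcases eq_or_ne s 0 with rfl | hs
  · simp [truncAt, trunc]
  refine tendsto_const_nhds.congr' ?_
  filter_upwards [eventually_two_lt_abs hs] with n hn
  have hn' : (n : ℝ) + 1 ≠ 0 := by positivity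
  rw [truncAt, trunc_eq_self hn.le]
  field_simp

lemma tendsto_deriv_truncAt {s : ℝ} (hs : s ≠ 0) :
    Tendsto (fun n => deriv (truncAt n) s) atTop (𝓝 1) := by
  refine tendsto_const_nhds.congr' ?_
  filter_upwards [eventually_two_lt_abs hs] with n hn
  rw [deriv_truncAt, deriv_trunc_eq_one hn]

/-- The derivative of a function vanishes at almost every zero of the function. -/
lemma ae_fderiv_eq_zero_of_eq_zero {E : Type*} [NormedAddCommGroup E] [NormedSpace ℝ E]
    [FiniteDimensional ℝ E] [MeasurableSpace E] [BorelSpace E] (μ : Measure E)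
    [μ.IsAddHaarMeasure] {G : Set E} (hG : IsOpen G) {f : E → ℝ} {f' : E → E →L[ℝ] ℝ}
    (hf : ∀ x ∈ G, HasFDerivAt f (f' x) x) :
    ∀ᵐ x ∂(μ.restrict G), f x = 0 → f' x = 0 := by
  rcases subsingleton_or_nontrivial E with hE | hE
  · exact Eventually.of_forall fun x _ => Subsingleton.elim _ _
  obtain ⟨v, hv⟩ := exists_ne (0 : E)
  set s : Set E := {x ∈ G | f x = 0} with hs
  have hsm : MeasurableSet s := by
    have hc : ContinuousOn f G := fun x hx => (hf x hx).continuousAt.continuousWithinAt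
    obtain ⟨u, hu, he⟩ := continuousOn_iff_isClosed.1 hc {0} isClosed_singleton
    have : s = u ∩ G := by
      rw [← he]; ext x; simp [hs, and_comm]
    rw [this]
    exact hu.measurableSet.inter hG.measurableSet
  have happ : ApproximatesLinearOn (fun x => f x • v) (0 : E →L[ℝ] E) s 0 := by
    intro x hx y hy
    simp [hx.2, hy.2]
  have h := happ.norm_fderiv_sub_le μ hsm (fun x => (f' x).smulRight v)
    (fun x hx => ((hf x hx.1).smul_const v).hasFDerivWithinAt)
  rw [ae_restrict_iff' hsm] at h
  rw [ae_restrict_iff' hG.measurableSet]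
  filter_upwards [h] with x hx hxG hx0
  have h1 := hx ⟨hxG, hx0⟩
  have h2 : (f' x).smulRight v = 0 := by
    rw [sub_zero] at h1
    exact nnnorm_eq_zero.1 (le_antisymm h1 bot_le)
  ext y
  have := congrArg (fun L => L y) h2
  simpa [hv] using this

/-! ### Grönwall's inequality and convergence in `L²` -/

/-- Grönwall's inequality in integral form, for an integrable function and an inequality that holds
almost everywhere. -/
lemma ae_eq_zero_of_ae_le_mul_integral {T C : ℝ} (hT : 0 < T) {E : ℝ → ℝ}
    (hE : IntegrableOn E (Ioo 0 T)) (hE0 : ∀ᵐ t ∂(volume.restrict (Ioo 0 T)), 0 ≤ E t)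
    (h : ∀ᵐ τ ∂(volume.restrict (Ioo 0 T)), E τ ≤ C * ∫ t in Ioo 0 τ, E t) :
    ∀ᵐ t ∂(volume.restrict (Ioo 0 T)), E t = 0 := by
  have hEi : IntervalIntegrable E volume 0 T := by
    rwa [intervalIntegrable_iff_integrableOn_Ioo_of_le hT.le]
  have hIoo : ∀ τ, 0 ≤ τ → ∫ t in Ioo 0 τ, E t = ∫ t in (0)..τ, E t := fun τ hτ => by
    rw [intervalIntegral.integral_of_le hτ, integral_Ioc_eq_integral_Ioo]
  set F : ℝ → ℝ := fun τ => ∫ t in (0)..τ, E t with hF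
  have hFc : ContinuousOn F (Icc 0 T) := by
    have := intervalIntegral.continuousOn_primitive_interval (μ := volume) (f := E) (a := 0) (b := T)
      (by rw [uIcc_of_le hT.le]; exact (integrableOn_Icc_iff_integrableOn_Ioo (by simp) (by simp)).2 hE)
    rwa [uIcc_of_le hT.le] at this
  have hsub : ∀ τ ∈ Icc 0 T, IntervalIntegrable E volume 0 τ := fun τ hτ =>
    hEi.mono_set (by rw [uIcc_of_le hT.le, uIcc_of_le hτ.1]; exact Icc_subset_Icc_right hτ.2)
  have hae : ∀ τ ∈ Icc 0 T, ∀ᵐ t ∂(volume.restrict (Ioc 0 τ)), 0 ≤ E t ∧ E t ≤ C * F t := by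
    intro τ hτ
    have h0 : ∀ᵐ t ∂(volume.restrict (Ioo 0 τ)), 0 ≤ E t ∧ E t ≤ C * F t := by
      refine ae_restrict_of_ae_restrict_of_subset (Ioo_subset_Ioo_right hτ.2) ?_
      filter_upwards [hE0, h, ae_restrict_mem measurableSet_Ioo] with t h1 h2 h3
      exact ⟨h1, by rw [hF]; rwa [hIoo t h3.1.le] at h2⟩
    rwa [Measure.restrict_congr_set Ioo_ae_eq_Ioc] at h0
  have hF0 : ∀ τ ∈ Icc 0 T, 0 ≤ F τ := fun τ hτ => by
    rw [hF]; simp only [intervalIntegral.integral_of_le hτ.1]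
    exact integral_nonneg_of_ae ((hae τ hτ).mono fun t ht => ht.1)
  have hFi : ∀ τ ∈ Icc 0 T, IntervalIntegrable F volume 0 τ := fun τ hτ =>
    (hFc.mono (by rw [uIcc_of_le hτ.1]; exact Icc_subset_Icc_right hτ.2)).intervalIntegrable
  set K : ℝ → ℝ := fun τ => ∫ t in (0)..τ, F t with hK
  have hK0 : ∀ τ ∈ Icc 0 T, 0 ≤ K τ := fun τ hτ =>
    intervalIntegral.integral_nonneg hτ.1 fun t ht => hF0 t ⟨ht.1, ht.2.trans hτ.2⟩
  have hFK : ∀ τ ∈ Icc 0 T, F τ ≤ C * K τ := fun τ hτ => by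
    rw [hF, hK, ← intervalIntegral.integral_const_mul]
    simp only [intervalIntegral.integral_of_le hτ.1]
    refine integral_mono_ae (hsub τ hτ).1 ((hFi τ hτ).1.const_mul C) ?_
    exact (hae τ hτ).mono fun t ht => ht.2
  have hKc : ContinuousOn K (Icc 0 T) := by
    have := intervalIntegral.continuousOn_primitive_interval (μ := volume) (f := F) (a := 0) (b := T)
      (by rw [uIcc_of_le hT.le]; exact hFc.integrableOn_compact isCompact_Icc)
    rwa [uIcc_of_le hT.le] at this
  have hKz := eq_zero_of_abs_deriv_le_mul_abs_self_of_eq_zero_right (f := K) (f' := F) (K := C)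
    (a := 0) (b := T) hKc
    (fun x hx => by
      have hm : Icc 0 T ∈ 𝓝[>] x :=
        mem_of_superset (Ioo_mem_nhdsGT hx.2) fun y hy => ⟨hx.1.trans hy.1.le, hy.2.le⟩
      have hcw : ContinuousWithinAt F (Ioi x) x :=
        (hFc x (Ico_subset_Icc_self hx)).mono_of_mem_nhdsWithin hm
      have hsm : StronglyMeasurableAtFilter F (𝓝[>] x) volume :=
        ⟨Icc 0 T, hm, hFc.aestronglyMeasurable measurableSet_Icc⟩
      exact intervalIntegral.integral_hasDerivWithinAt_right (s := Ici x) (t := Ioi x)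
        (hFi x (Ico_subset_Icc_self hx)) hsm hcw)
    (by simp [hK])
    (fun x hx => by
      have hx' := Ico_subset_Icc_self hx
      rw [Real.norm_of_nonneg (hF0 x hx'), Real.norm_of_nonneg (hK0 x hx')]
      exact hFK x hx')
  have hFT : F T = 0 := by
    have hTm : T ∈ Icc 0 T := right_mem_Icc.2 hT.le
    have h1 := hFK T hTm
    rw [hKz T hTm, mul_zero] at h1
    exact le_antisymm h1 (hF0 T hTm)
  rw [hF] at hFT
  simp only [← hIoo T hT.le] at hFT
  exact (setIntegral_eq_zero_iff_of_nonneg_ae hE0 hE).1 hFT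

lemma tendsto_integral_mul_of_tendsto_eLpNorm {α : Type*} [MeasurableSpace α] {μ : Measure α}
    {f g : ℕ → α → ℝ} {F G : α → ℝ} (hf : ∀ n, MemLp (f n) 2 μ) (hg : ∀ n, MemLp (g n) 2 μ)
    (hF : MemLp F 2 μ) (hG : MemLp G 2 μ)
    (h1 : Tendsto (fun n => eLpNorm (fun x => f n x - F x) 2 μ) atTop (𝓝 0))
    (h2 : Tendsto (fun n => eLpNorm (fun x => g n x - G x) 2 μ) atTop (𝓝 0)) :
    Tendsto (fun n => ∫ x, f n x * g n x ∂μ) atTop (𝓝 (∫ x, F x * G x ∂μ)) := by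
  have e : ∀ {a b : α → ℝ} (ha : MemLp a 2 μ) (hb : MemLp b 2 μ),
      inner ℝ (ha.toLp a) (hb.toLp b) = ∫ x, a x * b x ∂μ := by
    intro a b ha hb
    rw [L2.inner_def]
    refine integral_congr_ae ?_
    filter_upwards [ha.coeFn_toLp, hb.coeFn_toLp] with x hx hy
    rw [hx, hy]; simp [mul_comm]
  have t1 := (Lp.tendsto_Lp_iff_tendsto_eLpNorm'' f hf F hF).2 h1
  have t2 := (Lp.tendsto_Lp_iff_tendsto_eLpNorm'' g hg G hG).2 h2
  have := t1.inner (𝕜 := ℝ) t2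
  simpa only [e] using this

/-! ### Functions of class `C¹` up to the boundary -/

section C1

variable {E F : Type*} [NormedAddCommGroup E] [NormedSpace ℝ E]
  [NormedAddCommGroup F] [NormedSpace ℝ F]

/-- `f` is of class `C¹` up to the boundary of the open set `G`, and `f'` is the continuous
extension of its derivative to `closure G`. -/
structure HasC1Ext (f : E → F) (f' : E → E →L[ℝ] F) (G : Set E) : Prop where
  continuousOn : ContinuousOn f (closure G)
  continuousOn_deriv : ContinuousOn f' (closure G)
  hasFDerivAt : ∀ x ∈ G, HasFDerivAt f (f' x) x

lemma HasC1Ext.contDiffUpTo {f : E → F} {f' : E → E →L[ℝ] F} {G : Set E} (hG : IsOpen G)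
    (h : HasC1Ext f f' G) : ContDiffUpTo 1 f G := by
  refine ⟨h.continuousOn, ?_, ?_⟩
  · have : ContDiffOn ℝ (0 + 1) f G := by
      rw [contDiffOn_succ_iff_fderiv_of_isOpen hG]
      refine ⟨fun x hx => (h.hasFDerivAt x hx).differentiableAt.differentiableWithinAt, by simp, ?_⟩
      rw [contDiffOn_zero]
      exact (h.continuousOn_deriv.mono subset_closure).congr fun x hx => (h.hasFDerivAt x hx).fderiv
    simpa using this
  · intro k hk
    interval_cases k
    · refine ⟨fun x => (continuousMultilinearCurryFin0 ℝ E F).symm (f x),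
        (continuousMultilinearCurryFin0 ℝ E F).symm.continuous.comp_continuousOn h.continuousOn,
        fun x _ => ?_⟩
      rw [iteratedFDeriv_zero_eq_comp]; rfl
    · refine ⟨fun x => (continuousMultilinearCurryFin1 ℝ E F).symm (f' x),
        (continuousMultilinearCurryFin1 ℝ E F).symm.continuous.comp_continuousOn
          h.continuousOn_deriv, fun x hx => ?_⟩
      ext m
      rw [iteratedFDeriv_one_apply, (h.hasFDerivAt x hx).fderiv]
      rfl

lemma ContDiffUpTo.exists_hasC1Ext {f : E → F} {G : Set E} (hG : IsOpen G) {n : ℕ} (hn : 1 ≤ n)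
    (h : ContDiffUpTo n f G) : ∃ f', HasC1Ext f f' G := by
  obtain ⟨g, hg, hge⟩ := h.2.2 1 hn
  refine ⟨fun x => continuousMultilinearCurryFin1 ℝ E F (g x), h.1,
    (continuousMultilinearCurryFin1 ℝ E F).continuous.comp_continuousOn hg, fun x hx => ?_⟩
  have hd : DifferentiableAt ℝ f x := by
    refine ((h.2.1.differentiableOn ?_) x hx).differentiableAt (hG.mem_nhds hx)
    exact_mod_cast (Nat.one_le_iff_ne_zero.1 hn)
  convert hd.hasFDerivAt using 1
  ext v
  rw [continuousMultilinearCurryFin1_apply, hge hx, iteratedFDeriv_one_apply]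
  rfl

variable {G : Set E}

lemma HasC1Ext.congr {f g : E → F} {f' : E → E →L[ℝ] F} (hG : IsOpen G) (h : HasC1Ext f f' G)
    (he : EqOn g f (closure G)) : HasC1Ext g f' G :=
  ⟨h.continuousOn.congr he, h.continuousOn_deriv, fun x hx =>
    (h.hasFDerivAt x hx).congr_of_eventuallyEq
      (eventuallyEq_of_mem (hG.mem_nhds hx) (he.mono subset_closure))⟩

lemma HasC1Ext.add {f g : E → F} {f' g' : E → E →L[ℝ] F} (hf : HasC1Ext f f' G)
    (hg : HasC1Ext g g' G) : HasC1Ext (fun x => f x + g x) (fun x => f' x + g' x) G :=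
  ⟨hf.continuousOn.add hg.continuousOn, hf.continuousOn_deriv.add hg.continuousOn_deriv,
    fun x hx => (hf.hasFDerivAt x hx).add (hg.hasFDerivAt x hx)⟩

lemma HasC1Ext.sum {ι : Type*} (s : Finset ι) {f : ι → E → F} {f' : ι → E → E →L[ℝ] F}
    (h : ∀ i ∈ s, HasC1Ext (f i) (f' i) G) :
    HasC1Ext (fun x => ∑ i ∈ s, f i x) (fun x => ∑ i ∈ s, f' i x) G :=
  ⟨continuousOn_finsetSum _ fun i hi => (h i hi).continuousOn,
    continuousOn_finsetSum _ fun i hi => (h i hi).continuousOn_deriv,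
    fun x hx => HasFDerivAt.fun_sum fun i hi => (h i hi).hasFDerivAt x hx⟩

lemma HasC1Ext.clm_comp {H : Type*} [NormedAddCommGroup H] [NormedSpace ℝ H] (L : F →L[ℝ] H)
    {f : E → F} {f' : E → E →L[ℝ] F} (h : HasC1Ext f f' G) :
    HasC1Ext (fun x => L (f x)) (fun x => L.comp (f' x)) G :=
  ⟨L.continuous.comp_continuousOn h.continuousOn,
    continuousOn_const.clm_comp h.continuousOn_deriv,
    fun x hx => L.hasFDerivAt.comp x (h.hasFDerivAt x hx)⟩

/-- The chain rule for an outer function of one variable. -/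
lemma HasC1Ext.comp_deriv {f : E → ℝ} {f' : E → E →L[ℝ] ℝ} (h : HasC1Ext f f' G) {g g' : ℝ → ℝ}
    {s : Set ℝ} (hs : ∀ x ∈ closure G, f x ∈ s) (hg' : ContinuousOn g' s)
    (hg : ∀ y ∈ s, HasDerivAt g (g' y) y) :
    HasC1Ext (fun x => g (f x)) (fun x => g' (f x) • f' x) G :=
  ⟨ContinuousOn.comp (t := s) (fun y hy => (hg y hy).continuousAt.continuousWithinAt)
      h.continuousOn hs,
    (hg'.comp h.continuousOn hs).smul h.continuousOn_deriv,
    fun x hx => (hg _ (hs x (subset_closure hx))).comp_hasFDerivAt x (h.hasFDerivAt x hx)⟩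

end C1

/-! ### Regularity of the velocity of a strong solution -/

/-- Continuity in `x` up to the boundary, together with continuity in `t` that is uniform in the
interior, gives joint continuity up to the boundary. -/
lemma continuousOn_prod_closure {E X : Type*} [TopologicalSpace E]
    [PseudoMetricSpace X] {I : Set ℝ} {G : Set E} {g : ℝ × E → X}
    (h1 : ∀ t ∈ I, ContinuousOn (fun x => g (t, x)) (closure G))
    (h2 : ∀ t ∈ I, TendstoUniformlyOn (fun s x => g (s, x)) (fun x => g (t, x)) (𝓝[I] t) G) :
    ContinuousOn g (I ×ˢ closure G) := by
  rintro ⟨t, x⟩ ⟨ht, hx⟩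
  have ht : t ∈ I := ht
  have hx : x ∈ closure G := hx
  rw [ContinuousWithinAt, Metric.tendsto_nhds]
  intro ε hε
  rw [nhdsWithin_prod_eq]
  have e1 : ∀ᶠ s in 𝓝[I] t, ∀ y ∈ closure G, dist (g (t, y)) (g (s, y)) ≤ ε / 2 := by
    filter_upwards [Metric.tendstoUniformlyOn_iff.1 (h2 t ht) (ε / 2) (half_pos hε),
      self_mem_nhdsWithin] with s hs hsI y hy
    have : (𝓝[G] y).NeBot := mem_closure_iff_nhdsWithin_neBot.1 hy
    refine le_of_tendsto (x := 𝓝[G] y) (f := fun y' => dist (g (t, y')) (g (s, y')))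
      (Tendsto.dist ?_ ?_) ?_
    · exact (h1 t ht y hy).mono_left (nhdsWithin_mono _ subset_closure)
    · exact (h1 s hsI y hy).mono_left (nhdsWithin_mono _ subset_closure)
    · filter_upwards [self_mem_nhdsWithin] with y' hy'
      exact (hs y' hy').le
  have e2 : ∀ᶠ y in 𝓝[closure G] x, dist (g (t, y)) (g (t, x)) < ε / 2 ∧ y ∈ closure G :=
    (Metric.tendsto_nhds.1 (h1 t ht x hx) (ε / 2) (half_pos hε)).and self_mem_nhdsWithin
  filter_upwards [e1.prod_mk e2] with p hp
  have := dist_triangle (g p) (g (t, p.2)) (g (t, x))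
  have h3 := hp.1 p.2 hp.2.2
  rw [dist_comm] at h3
  linarith [hp.2.1]

lemma isOpen_stCylinder {d : ℕ} {T : ℝ} {Ω : Set (Space d)} (hΩ : IsOpen Ω) :
    IsOpen (stCylinder T Ω) := isOpen_Ioo.prod hΩ

lemma closure_stCylinder {d : ℕ} {T : ℝ} (hT : 0 < T) (Ω : Set (Space d)) :
    closure (stCylinder T Ω) = Icc 0 T ×ˢ closure Ω := by
  rw [stCylinder, closure_prod_eq, closure_Ioo hT.ne]

/-- Uniform convergence of the difference quotients to a bounded limit makes the spatial derivatives of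
`U` depend continuously on time, uniformly in space. -/
lemma IsC1C2.tendstoUniformlyOn_iteratedFDeriv {d : ℕ} {Ω : Set (Space d)} {T : ℝ}
    {U : ℝ × Space d → Space d} (hΩ : IsOpen Ω) (hb : Bornology.IsBounded Ω)
    (h : IsC1C2 Ω T U) {k : ℕ} (hk : k ≤ 2) {t : ℝ} (ht : t ∈ Icc 0 T) :
    TendstoUniformlyOn (fun s => iteratedFDeriv ℝ k (fun x => U (s, x)))
      (iteratedFDeriv ℝ k (fun x => U (t, x))) (𝓝[Icc 0 T] t) Ω := by
  obtain ⟨V, hV⟩ := h.2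
  obtain ⟨g, hg, hge⟩ := (hV t ht).1.2.2 k hk
  obtain ⟨M, hM⟩ := hb.isCompact_closure.exists_bound_of_continuousOn hg
  have hU : ∀ s ∈ Icc 0 T, ∀ x ∈ Ω, ContDiffAt ℝ k (fun y => U (s, y)) x := fun s hs x hx =>
    ((h.1 s hs).2.1.contDiffAt (hΩ.mem_nhds hx)).of_le (by exact_mod_cast hk)
  rw [Metric.tendstoUniformlyOn_iff]
  intro ε hε
  have h1 := Metric.tendstoUniformlyOn_iff.1 ((hV t ht).2.1 k hk) 1 one_pos
  rw [eventually_nhdsWithin_iff] at h1 ⊢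
  have hδ : 0 < ε / (|M| + 1) := by positivity
  filter_upwards [h1, Metric.ball_mem_nhds t hδ] with s hs1 hs2 hs x hx
  rcases eq_or_ne s t with rfl | hst
  · simpa using hε
  have h2 := hs1 ⟨hs, hst⟩ x hx
  have hst' : s - t ≠ 0 := sub_ne_zero.2 hst
  have e : iteratedFDeriv ℝ k (fun y => (s - t)⁻¹ • (U (s, y) - U (t, y))) x
      = (s - t)⁻¹ • (iteratedFDeriv ℝ k (fun y => U (s, y)) x
        - iteratedFDeriv ℝ k (fun y => U (t, y)) x) := by
    have a := iteratedFDeriv_const_smul_apply (i := k) (a := (s - t)⁻¹)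
      ((hU s hs x hx).sub (hU t ht x hx))
    have b := iteratedFDeriv_sub_apply (i := k) (hU s hs x hx) (hU t ht x hx)
    exact a.trans (congrArg _ b)
  rw [e, ← hge hx, dist_eq_norm] at h2
  set D := iteratedFDeriv ℝ k (fun y => U (s, y)) x - iteratedFDeriv ℝ k (fun y => U (t, y)) x
    with hD
  have h3 : ‖(s - t)⁻¹ • D‖ ≤ |M| + 1 := by
    have := norm_le_insert (g x) ((s - t)⁻¹ • D)
    have := (hM x (subset_closure hx)).trans (le_abs_self M)
    linarith
  rw [norm_smul, norm_inv, Real.norm_eq_abs, inv_mul_le_iff₀ (abs_pos.2 hst')] at h3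
  rw [dist_comm, dist_eq_norm, ← hD]
  rw [Metric.mem_ball, Real.dist_eq, lt_div_iff₀ (by positivity)] at hs2
  exact h3.trans_lt hs2

lemma tendstoUniformlyOn_of_iteratedFDeriv_zero {ι E F : Type*} [NormedAddCommGroup E]
    [NormedSpace ℝ E] [NormedAddCommGroup F] [NormedSpace ℝ F] {f : ι → E → F} {g : E → F}
    {l : Filter ι} {G : Set E}
    (h : TendstoUniformlyOn (fun s => iteratedFDeriv ℝ 0 (f s)) (iteratedFDeriv ℝ 0 g) l G) :
    TendstoUniformlyOn f g l G := by
  rw [Metric.tendstoUniformlyOn_iff] at h ⊢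
  intro ε hε
  filter_upwards [h ε hε] with s hs x hx
  have := hs x hx
  rwa [iteratedFDeriv_zero_eq_comp, iteratedFDeriv_zero_eq_comp, Function.comp_apply,
    Function.comp_apply, LinearIsometryEquiv.dist_map] at this

/-- A field of class `C¹([0,T]; C²)` is jointly of class `C¹` up to the boundary of the space-time
cylinder: the partial derivatives are jointly continuous because they converge uniformly in space as
time varies. -/
lemma IsC1C2.exists_hasC1Ext {d : ℕ} {Ω : Set (Space d)} {T : ℝ} {U : ℝ × Space d → Space d}
    (hΩ : IsOpen Ω) (hb : Bornology.IsBounded Ω) (hT : 0 < T) (h : IsC1C2 Ω T U) :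
    ∃ U', HasC1Ext U U' (stCylinder T Ω) := by
  obtain ⟨V, hV⟩ := id h.2
  choose! D hD using fun t ht => ContDiffUpTo.exists_hasC1Ext hΩ one_le_two (h.1 t ht)
  have hUc : ContinuousOn U (Icc 0 T ×ˢ closure Ω) :=
    continuousOn_prod_closure (fun t ht => (h.1 t ht).1) fun t ht =>
      tendstoUniformlyOn_of_iteratedFDeriv_zero
        (h.tendstoUniformlyOn_iteratedFDeriv hΩ hb (Nat.zero_le _) ht)
  have hVc : ContinuousOn V (Icc 0 T ×ˢ closure Ω) :=
    continuousOn_prod_closure (fun t ht => (hV t ht).1.1) fun t ht =>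
      tendstoUniformlyOn_of_iteratedFDeriv_zero ((hV t ht).2.2 0 (Nat.zero_le _))
  have hDe : ∀ t ∈ Icc 0 T, ∀ x ∈ Ω, D t x = continuousMultilinearCurryFin1 ℝ (Space d) (Space d)
      (iteratedFDeriv ℝ 1 (fun y => U (t, y)) x) := by
    intro t ht x hx
    rw [← ((hD t ht).hasFDerivAt x hx).fderiv]
    ext v : 1
    rw [continuousMultilinearCurryFin1_apply, iteratedFDeriv_one_apply]
    rfl
  have hDc : ContinuousOn (fun z : ℝ × Space d => D z.1 z.2) (Icc 0 T ×ˢ closure Ω) := by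
    refine continuousOn_prod_closure (fun t ht => (hD t ht).continuousOn_deriv) fun t ht => ?_
    have h1 := h.tendstoUniformlyOn_iteratedFDeriv hΩ hb one_le_two ht
    rw [Metric.tendstoUniformlyOn_iff] at h1 ⊢
    intro ε hε
    filter_upwards [h1 ε hε, self_mem_nhdsWithin] with s hs hsI x hx
    simp only [hDe t ht x hx, hDe s hsI x hx, LinearIsometryEquiv.dist_map]
    exact hs x hx
  have hVd : ∀ t ∈ Ioo 0 T, ∀ x ∈ Ω, HasDerivAt (fun s => U (s, x)) (V (t, x)) t := by
    intro t ht x hx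
    have htI := Ioo_subset_Icc_self ht
    have h1 := (tendstoUniformlyOn_of_iteratedFDeriv_zero
      ((hV t htI).2.1 0 (Nat.zero_le _))).tendsto_at hx
    have h2 : HasDerivWithinAt (fun s => U (s, x)) (V (t, x)) (Icc 0 T) t := by
      rw [hasDerivWithinAt_iff_tendsto_slope]
      exact h1
    exact h2.hasDerivAt (Icc_mem_nhds ht.1 ht.2)
  have hop := isOpen_stCylinder (T := T) hΩ
  have hsub : stCylinder T Ω ⊆ Icc 0 T ×ˢ closure Ω :=
    prod_mono Ioo_subset_Icc_self subset_closure
  refine ⟨fun z => (ContinuousLinearMap.toSpanSingleton ℝ (V z)).coprod (D z.1 z.2), ?_, ?_, ?_⟩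
  · rwa [closure_stCylinder hT]
  · rw [closure_stCylinder hT]
    have c1 : ContinuousOn (fun z => ContinuousLinearMap.toSpanSingleton ℝ (V z))
        (Icc 0 T ×ˢ closure Ω) :=
      (ContinuousLinearMap.toSpanSingletonCLE (𝕜 := ℝ) (E := Space d)).continuous.comp_continuousOn hVc
    have e : (fun z : ℝ × Space d => (ContinuousLinearMap.toSpanSingleton ℝ (V z)).coprod (D z.1 z.2))
        = fun z => (ContinuousLinearMap.toSpanSingleton ℝ (V z)).comp
            (ContinuousLinearMap.fst ℝ ℝ (Space d))
          + (D z.1 z.2).comp (ContinuousLinearMap.snd ℝ ℝ (Space d)) := by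
      funext z; ext v <;> simp
    rw [e]
    exact (c1.clm_comp continuousOn_const).add (hDc.clm_comp continuousOn_const)
  · intro z hz
    have hzn := hop.mem_nhds hz
    have cV := (hVc.mono hsub).continuousAt hzn
    have cD := (hDc.mono hsub).continuousAt hzn
    have := hasStrictFDerivAt_uncurry_coprod (𝕜 := ℝ) (u := z) (f := fun t x => U (t, x))
      (f₁ := fun t x => ContinuousLinearMap.toSpanSingleton ℝ (V (t, x))) (f₂ := fun t x => D t x)
      (by filter_upwards [hzn] with v hv using (hVd v.1 hv.1 v.2 hv.2).hasFDerivAt)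
      (by filter_upwards [hzn] with v hv using
            (hD v.1 (Ioo_subset_Icc_self hv.1)).hasFDerivAt v.2 hv.2)
      ((ContinuousLinearMap.toSpanSingletonCLE (𝕜 := ℝ) (E := Space d)).continuous.continuousAt.comp cV)
      cD
    exact this.hasFDerivAt

/-! ### The space `H¹₀` through `C²` approximations -/

section Slices

variable {d : ℕ} {Ω : Set (Space d)}

/-- `w ∈ H^1_0(Ω; ℝ^d)` with weak gradient `A`, with approximating fields that are only of class
`C²`. This is the class that contains both the slices of the weak solution and, by truncation, those
of the strong solution. -/
structure IsH10C2 (Ω : Set (Space d)) (w : Space d → Space d)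
    (A : Space d → Matrix (Fin d) (Fin d) ℝ) : Prop where
  memLp : ∀ i, MemLp (fun x => w x i) 2 (volume.restrict Ω)
  memLp_grad : ∀ i j, MemLp (fun x => A x i j) 2 (volume.restrict Ω)
  approx : ∃ φ : ℕ → Space d → Space d,
    (∀ n, ContDiff ℝ 2 (φ n) ∧ HasCompactSupport (φ n) ∧ tsupport (φ n) ⊆ Ω) ∧
    (∀ i, Tendsto (fun n => eLpNorm (fun x => φ n x i - w x i) 2 (volume.restrict Ω)) atTop
      (𝓝 0)) ∧
    ∀ i j, Tendsto (fun n => eLpNorm (fun x => grad (φ n) x i j - A x i j) 2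
      (volume.restrict Ω)) atTop (𝓝 0)

lemma IsH10.isH10C2 {w : Space d → Space d} {A : Space d → Matrix (Fin d) (Fin d) ℝ}
    (h : IsH10 Ω w A) : IsH10C2 Ω w A := by
  obtain ⟨hw, hA, φ, hφ, h1, h2⟩ := h
  refine ⟨fun i => ?_, hA, φ, fun n => ⟨(hφ n).1.of_le (WithTop.coe_le_coe.2 le_top), (hφ n).2⟩,
    fun i => ?_, h2⟩
  · exact (EuclideanSpace.proj (𝕜 := ℝ) i).comp_memLp' hw
  · refine tendsto_of_tendsto_of_tendsto_of_le_of_le tendsto_const_nhds h1 (fun _ => bot_le)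
      fun n => eLpNorm_mono fun x => ?_
    simpa using PiLp.norm_apply_le (φ n x - w x) i

lemma grad_apply (w : Space d → Space d) (x : Space d) (i j : Fin d) :
    grad w x i j = fderiv ℝ (fun y => w y i) x (EuclideanSpace.single j 1) := rfl

lemma contDiff_coord {φ : Space d → Space d} {n : ℕ∞} (h : ContDiff ℝ n φ) (i : Fin d) :
    ContDiff ℝ n (fun y => φ y i) :=
  (EuclideanSpace.proj (𝕜 := ℝ) i).contDiff.comp h

lemma tsupport_coord_subset (φ : Space d → Space d) (i : Fin d) :
    tsupport (fun y => φ y i) ⊆ tsupport φ := by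
  refine closure_mono fun x hx => ?_
  rw [Function.mem_support] at hx ⊢
  intro h0
  exact hx (by simp [h0])

lemma hasCompactSupport_coord {φ : Space d → Space d} (h : HasCompactSupport φ) (i : Fin d) :
    HasCompactSupport (fun y => φ y i) :=
  h.of_isClosed_subset (isClosed_tsupport _) (tsupport_coord_subset φ i)

lemma continuous_pd {f : Space d → ℝ} (hf : ContDiff ℝ 2 f) (j : Fin d) : Continuous (pd j f) :=
  (hf.continuous_fderiv (by norm_num)).clm_apply continuous_const

lemma hasCompactSupport_pd {f : Space d → ℝ} (hf : HasCompactSupport f) (j : Fin d) :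
    HasCompactSupport (pd j f) :=
  hf.fderiv_apply (𝕜 := ℝ) _

lemma memLp_of_compactSupport {f : Space d → ℝ} (hf : Continuous f) (hs : HasCompactSupport f) :
    MemLp f 2 (volume.restrict Ω) :=
  (hf.memLp_of_hasCompactSupport hs).restrict Ω

lemma memLp_coord {φ : Space d → Space d} (h : ContDiff ℝ 2 φ) (hs : HasCompactSupport φ)
    (i : Fin d) : MemLp (fun x => φ x i) 2 (volume.restrict Ω) :=
  memLp_of_compactSupport (contDiff_coord h i).continuous (hasCompactSupport_coord hs i)

lemma memLp_grad_coord {φ : Space d → Space d} (h : ContDiff ℝ 2 φ) (hs : HasCompactSupport φ)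
    (i j : Fin d) : MemLp (fun x => grad φ x i j) 2 (volume.restrict Ω) :=
  memLp_of_compactSupport (continuous_pd (contDiff_coord h i) j)
    (hasCompactSupport_pd (hasCompactSupport_coord hs i) j)

lemma tendsto_eLpNorm_sub_sub {α : Type*} [MeasurableSpace α] {μ : Measure α}
    {f g : ℕ → α → ℝ} {F G : α → ℝ} (hf : ∀ n, MemLp (f n) 2 μ) (hg : ∀ n, MemLp (g n) 2 μ)
    (hF : MemLp F 2 μ) (hG : MemLp G 2 μ)
    (h1 : Tendsto (fun n => eLpNorm (fun x => f n x - F x) 2 μ) atTop (𝓝 0))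
    (h2 : Tendsto (fun n => eLpNorm (fun x => g n x - G x) 2 μ) atTop (𝓝 0)) :
    Tendsto (fun n => eLpNorm (fun x => (f n x - g n x) - (F x - G x)) 2 μ) atTop (𝓝 0) := by
  have h3 := h1.add h2
  rw [add_zero] at h3
  refine tendsto_of_tendsto_of_tendsto_of_le_of_le tendsto_const_nhds h3 (fun _ => bot_le)
    fun n => ?_
  have e : (fun x => (f n x - g n x) - (F x - G x))
      = (fun x => f n x - F x) - (fun x => g n x - G x) := by
    funext x; simp only [Pi.sub_apply]; ring
  simp only
  rw [e]
  exact eLpNorm_sub_le ((hf n).sub hF).1 ((hg n).sub hG).1 one_le_two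

lemma IsH10C2.sub {w w' : Space d → Space d} {A A' : Space d → Matrix (Fin d) (Fin d) ℝ}
    (h : IsH10C2 Ω w A) (h' : IsH10C2 Ω w' A') :
    IsH10C2 Ω (fun x => w x - w' x) (fun x => A x - A' x) := by
  obtain ⟨φ, hφ, h1, h2⟩ := h.approx
  obtain ⟨φ', hφ', h1', h2'⟩ := h'.approx
  refine ⟨fun i => (h.memLp i).sub (h'.memLp i), fun i j => (h.memLp_grad i j).sub
    (h'.memLp_grad i j), fun n x => φ n x - φ' n x, fun n => ⟨(hφ n).1.sub (hφ' n).1,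
      (hφ n).2.1.sub (hφ' n).2.1,
      (tsupport_sub _ _).trans (union_subset (hφ n).2.2 (hφ' n).2.2)⟩, fun i => ?_, fun i j => ?_⟩
  · exact tendsto_eLpNorm_sub_sub (fun n => memLp_coord (hφ n).1 (hφ n).2.1 i)
      (fun n => memLp_coord (hφ' n).1 (hφ' n).2.1 i) (h.memLp i) (h'.memLp i) (h1 i) (h1' i)
  · have := tendsto_eLpNorm_sub_sub (fun n => memLp_grad_coord (hφ n).1 (hφ n).2.1 i j)
      (fun n => memLp_grad_coord (hφ' n).1 (hφ' n).2.1 i j) (h.memLp_grad i j)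
      (h'.memLp_grad i j) (h2 i j) (h2' i j)
    refine this.congr fun n => ?_
    congr 1
    funext x
    have e : grad (fun y => φ n y - φ' n y) x i j = grad (φ n) x i j - grad (φ' n) x i j := by
      simp only [grad_apply, PiLp.sub_apply]
      rw [fderiv_fun_sub ((contDiff_coord (hφ n).1 i).differentiable two_ne_zero x)
        ((contDiff_coord (hφ' n).1 i).differentiable two_ne_zero x)]
      rfl
    rw [e]; rfl

/-- Integration by parts against a function that is `C¹` up to the boundary. -/
lemma IsH10C2.integral_mul_deriv {w : Space d → Space d} {A : Space d → Matrix (Fin d) (Fin d) ℝ}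
    (hΩ : IsOpen Ω) (hb : Bornology.IsBounded Ω) (h : IsH10C2 Ω w A)
    {σ : Space d → ℝ} {σ' : Space d → Space d →L[ℝ] ℝ} (hσ : HasC1Ext σ σ' Ω) (i j : Fin d) :
    ∫ x in Ω, w x i * σ' x (EuclideanSpace.single j 1) = -∫ x in Ω, A x i j * σ x := by
  obtain ⟨φ, hφ, h1, h2⟩ := h.approx
  have hfin : volume Ω < ⊤ := hb.measure_lt_top
  have : IsFiniteMeasure (volume.restrict Ω) := ⟨by simpa using hfin⟩
  have hmem : ∀ {f : Space d → ℝ}, ContinuousOn f (closure Ω) → MemLp f 2 (volume.restrict Ω) := by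
    intro f hf
    obtain ⟨C, hC⟩ := hb.isCompact_closure.exists_bound_of_continuousOn hf
    refine MemLp.of_bound ((hf.mono subset_closure).aestronglyMeasurable hΩ.measurableSet) C ?_
    filter_upwards [ae_restrict_mem hΩ.measurableSet] with x hx using hC x (subset_closure hx)
  have hm1 : MemLp σ 2 (volume.restrict Ω) := hmem hσ.continuousOn
  have hm2 : MemLp (fun x => σ' x (EuclideanSpace.single j 1)) 2 (volume.restrict Ω) :=
    hmem (hσ.continuousOn_deriv.clm_apply continuousOn_const)
  have key : ∀ n, ∫ x in Ω, φ n x i * σ' x (EuclideanSpace.single j 1)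
      = -∫ x in Ω, grad (φ n) x i j * σ x := by
    intro n
    have hφi := contDiff_coord (hφ n).1 i
    have hsub : tsupport (fun y => φ n y i) ⊆ Ω := (tsupport_coord_subset _ i).trans (hφ n).2.2
    have z1 : ∀ x, x ∉ Ω → φ n x i = 0 := fun x hx =>
      image_eq_zero_of_notMem_tsupport (f := fun y => φ n y i) fun h => hx (hsub h)
    have z2 : ∀ x, x ∉ Ω → grad (φ n) x i j = 0 := fun x hx => by
      have : x ∉ tsupport (fun y => φ n y i) := fun h => hx (hsub h)
      rw [grad_apply, fderiv_of_notMem_tsupport ℝ this]; rfl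
    have i1 := (memLp_coord (hφ n).1 (hφ n).2.1 i).integrable_mul hm2
    have i2 := (memLp_grad_coord (hφ n).1 (hφ n).2.1 i j).integrable_mul hm1
    have i3 := (memLp_coord (hφ n).1 (hφ n).2.1 i).integrable_mul hm1
    have ext : ∀ {f : Space d → ℝ}, (∀ x, x ∉ Ω → f x = 0) → Integrable f (volume.restrict Ω) →
        Integrable f := fun hz hi => by
      refine (integrableOn_iff_integrable_of_support_subset fun x hx => ?_).1 hi
      by_contra hxΩ
      exact hx (hz x hxΩ)
    have z3 : ∀ x, x ∉ Ω → φ n x i * σ' x (EuclideanSpace.single j 1) = 0 := fun x hx => by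
      rw [z1 x hx, zero_mul]
    have z4 : ∀ x, x ∉ Ω → grad (φ n) x i j * σ x = 0 := fun x hx => by
      rw [z2 x hx, zero_mul]
    have z5 : ∀ x, x ∉ Ω → φ n x i * σ x = 0 := fun x hx => by
      rw [z1 x hx, zero_mul]
    rw [setIntegral_eq_integral_of_forall_compl_eq_zero z3,
      setIntegral_eq_integral_of_forall_compl_eq_zero z4]
    exact integral_bilinear_hasFDerivAt_right_eq_neg_left_of_integrable
      (μ := (volume : Measure (Space d)))
      (B := ContinuousLinearMap.mul ℝ ℝ) (f := fun y => φ n y i)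
      (f' := fun x => fderiv ℝ (fun y => φ n y i) x) (g := σ) (g' := σ')
      (v := EuclideanSpace.single j 1) (ext z4 i2) (ext z3 i1) (ext z5 i3)
      (fun x _ => (hφi.differentiable two_ne_zero x).hasFDerivAt)
      (fun x hx => hσ.hasFDerivAt x (hsub hx))
  have zero : Tendsto (fun _ : ℕ => eLpNorm (fun x => σ x - σ x) 2 (volume.restrict Ω)) atTop
      (𝓝 0) := by simp
  have zero' : Tendsto (fun _ : ℕ => eLpNorm (fun x => σ' x (EuclideanSpace.single j 1)
      - σ' x (EuclideanSpace.single j 1)) 2 (volume.restrict Ω)) atTop (𝓝 0) := by simp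
  have l1 := tendsto_integral_mul_of_tendsto_eLpNorm
    (fun n => memLp_coord (hφ n).1 (hφ n).2.1 i) (fun _ => hm2) (h.memLp i) hm2 (h1 i) zero'
  have l2 := tendsto_integral_mul_of_tendsto_eLpNorm
    (fun n => memLp_grad_coord (hφ n).1 (hφ n).2.1 i j) (fun _ => hm1) (h.memLp_grad i j) hm1
    (h2 i j) zero
  refine tendsto_nhds_unique l1 ?_
  simp only [key]
  exact l2.neg

lemma integral_pd_mul_pd_comm {f g : Space d → ℝ} (hf : ContDiff ℝ 2 f) (hg : ContDiff ℝ 2 g)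
    (hfs : HasCompactSupport f) (i j : Fin d) :
    ∫ x, pd j f x * pd i g x = ∫ x, pd i f x * pd j g x := by
  have hg' : ContDiff ℝ 1 (fderiv ℝ g) := hg.fderiv_right (by norm_num)
  have hd : ∀ k, ContDiff ℝ 1 (pd k g) := fun k => hg'.clm_apply contDiff_const
  have hdf := hf.differentiable two_ne_zero
  have hcont : ∀ k l, Continuous (fun x => fderiv ℝ (pd k g) x (EuclideanSpace.single l 1)) :=
    fun k l => ((hd k).continuous_fderiv one_ne_zero).clm_apply continuous_const
  have hsymm : ∀ x, fderiv ℝ (pd i g) x (EuclideanSpace.single j 1)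
      = fderiv ℝ (pd j g) x (EuclideanSpace.single i 1) := by
    intro x
    have e : ∀ k l : Fin d, fderiv ℝ (pd k g) x (EuclideanSpace.single l 1)
        = fderiv ℝ (fderiv ℝ g) x (EuclideanSpace.single l 1) (EuclideanSpace.single k 1) := by
      intro k l
      have := ((hg'.differentiable one_ne_zero x).hasFDerivAt.clm_apply
        (hasFDerivAt_const (EuclideanSpace.single k (1 : ℝ)) x)).fderiv
      have h2 : fderiv ℝ (pd k g) x = _ := this
      rw [h2]; simp
    rw [e, e]
    exact (hg.contDiffAt.isSymmSndFDerivAt (by simp)).eq _ _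
  have ibp : ∀ k l, ∫ x, f x * fderiv ℝ (pd k g) x (EuclideanSpace.single l 1)
      = -∫ x, pd l f x * pd k g x := by
    intro k l
    refine integral_mul_fderiv_eq_neg_fderiv_mul_of_integrable ?_ ?_ ?_ (fun x _ => hdf x)
      (fun x _ => (hd k).differentiable one_ne_zero x)
    · exact ((continuous_pd hf l).mul (hd k).continuous).integrable_of_hasCompactSupport
        (hasCompactSupport_pd hfs l).mul_right
    · exact (hf.continuous.mul (hcont k l)).integrable_of_hasCompactSupport hfs.mul_right
    · exact (hf.continuous.mul (hd k).continuous).integrable_of_hasCompactSupport hfs.mul_right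
  have h1 := ibp i j
  have h2 := ibp j i
  simp only [hsymm] at h1
  linarith

lemma pd_eq_zero_of_notMem {f : Space d → ℝ} (hf : tsupport f ⊆ Ω) {x : Space d} (hx : x ∉ Ω)
    (j : Fin d) : pd j f x = 0 := by
  have : x ∉ tsupport f := fun h => hx (hf h)
  rw [pd, fderiv_of_notMem_tsupport ℝ this]; rfl

/-- In `H¹₀`, the integrals of `∂_j w_i ∂_i w_j` and of `∂_i w_i ∂_j w_j` agree. -/
lemma IsH10C2.integral_grad_mul_comm {w : Space d → Space d}
    {A : Space d → Matrix (Fin d) (Fin d) ℝ} (h : IsH10C2 Ω w A) (i j : Fin d) :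
    ∫ x in Ω, A x i j * A x j i = ∫ x in Ω, A x i i * A x j j := by
  obtain ⟨φ, hφ, h1, h2⟩ := h.approx
  have lim : ∀ i j k l, Tendsto (fun n => ∫ x in Ω, grad (φ n) x i j * grad (φ n) x k l) atTop
      (𝓝 (∫ x in Ω, A x i j * A x k l)) := fun i j k l =>
    tendsto_integral_mul_of_tendsto_eLpNorm
      (fun n => memLp_grad_coord (hφ n).1 (hφ n).2.1 i j)
      (fun n => memLp_grad_coord (hφ n).1 (hφ n).2.1 k l) (h.memLp_grad i j) (h.memLp_grad k l)
      (h2 i j) (h2 k l)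
  refine tendsto_nhds_unique (lim i j j i) ((lim i i j j).congr fun n => ?_)
  have hs : tsupport (fun y => φ n y i) ⊆ Ω := (tsupport_coord_subset _ i).trans (hφ n).2.2
  rw [setIntegral_eq_integral_of_forall_compl_eq_zero fun x hx => ?_,
    setIntegral_eq_integral_of_forall_compl_eq_zero fun x hx => ?_]
  · exact (integral_pd_mul_pd_comm (contDiff_coord (hφ n).1 i) (contDiff_coord (hφ n).1 j)
      (hasCompactSupport_coord (hφ n).2.1 i) i j).symm
  · have : grad (φ n) x i j = 0 := pd_eq_zero_of_notMem hs hx j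
    rw [this, zero_mul]
  · have : grad (φ n) x i i = 0 := pd_eq_zero_of_notMem hs hx i
    rw [this, zero_mul]

/-- **Korn's inequality in `H¹₀`.** The viscous dissipation controls the full gradient. In dimension
`d ≥ 4` this is not a pointwise inequality; it relies on `∫ ∇w : ∇ᵗw = ∫ (div w)²`. -/
lemma IsH10C2.le_integral_stress {w : Space d → Space d}
    {A : Space d → Matrix (Fin d) (Fin d) ℝ} (h : IsH10C2 Ω w A) {μ η : ℝ} (hμ : 0 < μ)
    (hη : 0 ≤ η) :
    μ * ∑ i, ∑ j, ∫ x in Ω, A x i j ^ 2 ≤ ∫ x in Ω, contract (stress μ η (A x)) (A x) := by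
  have hint : ∀ i j k l, Integrable (fun x => A x i j * A x k l) (volume.restrict Ω) :=
    fun i j k l => (h.memLp_grad i j).integrable_mul (h.memLp_grad k l)
  have hcon : ∀ B : Matrix (Fin d) (Fin d) ℝ, contract (stress μ η B) B
      = μ * (∑ i, ∑ j, B i j * B i j) + μ * (∑ i, ∑ j, B i j * B j i)
        + (η - 2 / 3 * μ) * (∑ i, ∑ j, B i i * B j j) := by
    intro B
    have hd : ∑ i, ∑ j, (1 : Matrix (Fin d) (Fin d) ℝ) i j * B i j = B.trace := by
      simp [Matrix.one_apply, Matrix.trace]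
    have e : ∀ i j, stress μ η B i j * B i j = μ * (B i j * B i j) + μ * (B i j * B j i)
        + (η - 2 / 3 * μ) * B.trace * ((1 : Matrix (Fin d) (Fin d) ℝ) i j * B i j) := by
      intro i j
      simp only [stress, Matrix.add_apply, Matrix.smul_apply, Matrix.sub_apply,
        Matrix.transpose_apply, smul_eq_mul]
      ring
    simp only [contract, e, Finset.sum_add_distrib, ← Finset.mul_sum, hd]
    rw [← Finset.sum_mul, Matrix.trace]
    simp only [Matrix.diag]
    ring
  have hs : ∀ f : Fin d → Fin d → Space d → ℝ,
      (∀ i j, Integrable (f i j) (volume.restrict Ω)) →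
      Integrable (fun x => ∑ i, ∑ j, f i j x) (volume.restrict Ω) ∧
      ∫ x in Ω, ∑ i, ∑ j, f i j x = ∑ i, ∑ j, ∫ x in Ω, f i j x := by
    intro f hf
    have h1 : ∀ i, Integrable (fun x => ∑ j, f i j x) (volume.restrict Ω) := fun i =>
      integrable_finsetSum _ fun j _ => hf i j
    refine ⟨integrable_finsetSum _ fun i _ => h1 i, ?_⟩
    rw [integral_finsetSum _ fun i _ => h1 i]
    exact Finset.sum_congr rfl fun i _ => integral_finsetSum _ fun j _ => hf i j
  obtain ⟨i1, e1⟩ := hs (fun i j x => A x i j * A x i j) fun i j => hint i j i j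
  obtain ⟨i2, e2⟩ := hs (fun i j x => A x i j * A x j i) fun i j => hint i j j i
  obtain ⟨i3, e3⟩ := hs (fun i j x => A x i i * A x j j) fun i j => hint i i j j
  have e23 : ∫ x in Ω, ∑ i, ∑ j, A x i j * A x j i = ∫ x in Ω, ∑ i, ∑ j, A x i i * A x j j := by
    rw [e2, e3]
    exact Finset.sum_congr rfl fun i _ => Finset.sum_congr rfl fun j _ =>
      h.integral_grad_mul_comm i j
  have hpos : 0 ≤ ∫ x in Ω, ∑ i, ∑ j, A x i i * A x j j := by
    refine integral_nonneg fun x => ?_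
    simp only [Pi.zero_apply, ← Finset.sum_mul_sum]
    exact mul_self_nonneg _
  have i12 : Integrable (fun x => μ * (∑ i, ∑ j, A x i j * A x i j)
      + μ * (∑ i, ∑ j, A x i j * A x j i)) (volume.restrict Ω) :=
    (i1.const_mul _).add (i2.const_mul _)
  simp only [hcon]
  rw [integral_add i12 (i3.const_mul _),
    integral_add (i1.const_mul _) (i2.const_mul _), integral_const_mul, integral_const_mul,
    integral_const_mul, e23, e1]
  simp only [sq]
  have : 0 ≤ (η + 1 / 3 * μ) * ∫ x in Ω, ∑ i, ∑ j, A x i i * A x j j :=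
    mul_nonneg (by positivity) hpos
  linarith

/-- **Poincaré's inequality in `H¹₀`** on a domain of radius at most `M`. -/
lemma IsH10C2.integral_sq_le {w : Space d → Space d}
    {A : Space d → Matrix (Fin d) (Fin d) ℝ} (h : IsH10C2 Ω w A) {M : ℝ}
    (hM : ∀ x ∈ Ω, ‖x‖ ≤ M) (i : Fin d) :
    ∫ x in Ω, w x i ^ 2 ≤ 4 * M ^ 2 * ∫ x in Ω, A x i i ^ 2 := by
  obtain ⟨φ, hφ, h1, h2⟩ := h.approx
  have l1 := tendsto_integral_mul_of_tendsto_eLpNorm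
    (fun n => memLp_coord (hφ n).1 (hφ n).2.1 i) (fun n => memLp_coord (hφ n).1 (hφ n).2.1 i)
    (h.memLp i) (h.memLp i) (h1 i) (h1 i)
  have l2 := tendsto_integral_mul_of_tendsto_eLpNorm
    (fun n => memLp_grad_coord (hφ n).1 (hφ n).2.1 i i)
    (fun n => memLp_grad_coord (hφ n).1 (hφ n).2.1 i i) (h.memLp_grad i i) (h.memLp_grad i i)
    (h2 i i) (h2 i i)
  simp only [sq (w _ _), sq (A _ _ _)]
  refine le_of_tendsto_of_tendsto' l1 (l2.const_mul _) fun n => ?_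
  set f : Space d → ℝ := fun y => φ n y i with hf
  have hfc : ContDiff ℝ 2 f := contDiff_coord (hφ n).1 i
  have hfs : HasCompactSupport f := hasCompactSupport_coord (hφ n).2.1 i
  have hsub : tsupport f ⊆ Ω := (tsupport_coord_subset _ i).trans (hφ n).2.2
  have z1 : ∀ x, x ∉ Ω → f x = 0 := fun x hx =>
    image_eq_zero_of_notMem_tsupport (f := f) fun h => hx (hsub h)
  have z2 : ∀ x, x ∉ Ω → pd i f x = 0 := fun x hx => pd_eq_zero_of_notMem hsub hx i
  have g2 : ∀ x, grad (φ n) x i i = pd i f x := fun x => rfl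
  simp only [g2]
  change ∫ x in Ω, f x * f x ≤ 4 * M ^ 2 * ∫ x in Ω, pd i f x * pd i f x
  rw [setIntegral_eq_integral_of_forall_compl_eq_zero fun x hx => by rw [z1 x hx, zero_mul],
    setIntegral_eq_integral_of_forall_compl_eq_zero fun x hx => by rw [z2 x hx, zero_mul]]
  have hd := hfc.differentiable two_ne_zero
  have hff : ∀ x, HasFDerivAt (fun y => f y * f y) (f x • fderiv ℝ f x + f x • fderiv ℝ f x) x :=
    fun x => (hd x).hasFDerivAt.mul (hd x).hasFDerivAt
  have hx' : ∀ x, HasFDerivAt (fun y : Space d => y i) (EuclideanSpace.proj (𝕜 := ℝ) i) x :=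
    fun x => (EuclideanSpace.proj (𝕜 := ℝ) i).hasFDerivAt
  have cpd := continuous_pd hfc i
  have cx : Continuous (fun x : Space d => x i) := (EuclideanSpace.proj (𝕜 := ℝ) i).continuous
  have I1 : Integrable (fun x => f x * f x) :=
    (hfc.continuous.mul hfc.continuous).integrable_of_hasCompactSupport hfs.mul_right
  have I2 : Integrable (fun x => pd i f x * pd i f x) :=
    (cpd.mul cpd).integrable_of_hasCompactSupport (hasCompactSupport_pd hfs i).mul_right
  have I3 : Integrable (fun x => f x * (2 * x i * pd i f x)) :=
    (hfc.continuous.mul ((continuous_const.mul cx).mul cpd)).integrable_of_hasCompactSupport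
      hfs.mul_right
  have I4 : Integrable (fun x : Space d => (f x * f x) * x i) :=
    ((hfc.continuous.mul hfc.continuous).mul cx).integrable_of_hasCompactSupport
      hfs.mul_right.mul_right
  -- Integrate `f² = f² ∂_i x_i` by parts, then absorb half of the left-hand side.
  have ibp := integral_bilinear_hasFDerivAt_right_eq_neg_left_of_integrable
      (μ := (volume : Measure (Space d)))
      (B := ContinuousLinearMap.mul ℝ ℝ) (f := fun y => f y * f y)
      (f' := fun x => f x • fderiv ℝ f x + f x • fderiv ℝ f x) (g := fun y : Space d => y i)
      (g' := fun _ => EuclideanSpace.proj (𝕜 := ℝ) i)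
      (v := EuclideanSpace.single i 1) (by
        refine I3.congr (Eventually.of_forall fun x => ?_)
        simp [pd]; ring) (by simpa using I1) (by simpa using I4)
      (fun x _ => hff x) (fun x _ => hx' x)
  have e1 : ∫ x, f x * f x = -∫ x, f x * (2 * x i * pd i f x) := by
    calc ∫ x, f x * f x = _ := by
          refine integral_congr_ae (Eventually.of_forall fun x => ?_)
          simp
      _ = _ := ibp
      _ = _ := by
          congr 1
          refine integral_congr_ae (Eventually.of_forall fun x => ?_)
          simp [pd]; ring
  have e2 : -∫ x, f x * (2 * x i * pd i f x)
      ≤ ∫ x, (1 / 2 * (f x * f x) + 2 * M ^ 2 * (pd i f x * pd i f x)) := by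
    rw [← integral_neg]
    refine integral_mono I3.neg ((I1.const_mul _).add (I2.const_mul _)) fun x => ?_
    by_cases hx : x ∈ Ω
    · have hxi : |x i| ≤ M := by
        have := PiLp.norm_apply_le x i
        rw [Real.norm_eq_abs] at this
        exact this.trans (hM x hx)
      have : x i ^ 2 ≤ M ^ 2 := sq_le_sq' (abs_le.1 hxi).1 (abs_le.1 hxi).2
      have h3 : x i ^ 2 * pd i f x ^ 2 ≤ M ^ 2 * pd i f x ^ 2 :=
        mul_le_mul_of_nonneg_right this (sq_nonneg _)
      simp only
      nlinarith [sq_nonneg (f x + 2 * (x i * pd i f x))]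
    · simp [z1 x hx, z2 x hx]
  rw [integral_add (I1.const_mul _) (I2.const_mul _), integral_const_mul, integral_const_mul] at e2
  linarith

end Slices

/-! ### Slices of functions on space-time -/

section Slicing

variable {d : ℕ} {Ω : Set (Space d)} {T : ℝ}

lemma hasDerivAt_time {F : Type*} [NormedAddCommGroup F] [NormedSpace ℝ F]
    {f : ℝ × Space d → F} {L : ℝ × Space d →L[ℝ] F} {z : ℝ × Space d}
    (h : HasFDerivAt f L z) : HasDerivAt (fun s => f (s, z.2)) (L (1, 0)) z.1 :=
  HasFDerivAt.comp_hasDerivAt (f := fun s : ℝ => (s, z.2)) z.1 h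
    ((hasDerivAt_id z.1).prodMk (hasDerivAt_const z.1 z.2))

lemma hasFDerivAt_space {F : Type*} [NormedAddCommGroup F] [NormedSpace ℝ F]
    {f : ℝ × Space d → F} {L : ℝ × Space d →L[ℝ] F} {z : ℝ × Space d}
    (h : HasFDerivAt f L z) : HasFDerivAt (fun y => f (z.1, y))
      (L.comp (ContinuousLinearMap.inr ℝ ℝ (Space d))) z.2 :=
  HasFDerivAt.comp (f := fun y : Space d => (z.1, y)) z.2 h (hasFDerivAt_prodMk_right z.1 z.2)

lemma pd_space {f : ℝ × Space d → ℝ} {L : ℝ × Space d →L[ℝ] ℝ} {z : ℝ × Space d}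
    (h : HasFDerivAt f L z) (j : Fin d) :
    pd j (fun y => f (z.1, y)) z.2 = L (0, EuclideanSpace.single j 1) := by
  rw [pd, (hasFDerivAt_space h).fderiv]; rfl

lemma HasC1Ext.slice {F : Type*} [NormedAddCommGroup F] [NormedSpace ℝ F]
    {f : ℝ × Space d → F} {f' : ℝ × Space d → ℝ × Space d →L[ℝ] F} (hT : 0 < T)
    (h : HasC1Ext f f' (stCylinder T Ω)) {t : ℝ} (ht : t ∈ Ioo 0 T) :
    HasC1Ext (fun x => f (t, x))
      (fun x => (f' (t, x)).comp (ContinuousLinearMap.inr ℝ ℝ (Space d))) Ω := by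
  have hm : MapsTo (fun x : Space d => (t, x)) (closure Ω) (closure (stCylinder T Ω)) := by
    intro x hx
    rw [closure_stCylinder hT]
    exact ⟨Ioo_subset_Icc_self ht, hx⟩
  have hc : ContinuousOn (fun x : Space d => (t, x)) (closure Ω) := by fun_prop
  exact ⟨h.continuousOn.comp hc hm, (h.continuousOn_deriv.comp hc hm).clm_comp continuousOn_const,
    fun x hx => hasFDerivAt_space (z := (t, x)) (h.hasFDerivAt (t, x) ⟨ht, hx⟩)⟩

lemma HasC1Ext.coord {E : Type*} [NormedAddCommGroup E] [NormedSpace ℝ E]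
    {f : E → Space d} {f' : E → E →L[ℝ] Space d} {G : Set E}
    (h : HasC1Ext f f' G) (i : Fin d) :
    HasC1Ext (fun z => f z i) (fun z => (EuclideanSpace.proj (𝕜 := ℝ) i).comp (f' z)) G :=
  h.clm_comp (EuclideanSpace.proj (𝕜 := ℝ) i)

lemma isCompact_closure_stCylinder (hb : Bornology.IsBounded Ω) (hT : 0 < T) :
    IsCompact (closure (stCylinder T Ω)) := by
  rw [closure_stCylinder hT]
  exact isCompact_Icc.prod hb.isCompact_closure

lemma isCompact_setOf_le_norm {X E : Type*} [TopologicalSpace X] [NormedAddCommGroup E]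
    {S : Set X} (hS : IsCompact S) {f : X → E} (hf : ContinuousOn f S) (δ : ℝ) :
    IsCompact {x | x ∈ S ∧ δ ≤ ‖f x‖} := by
  obtain ⟨u, hu, he⟩ := continuousOn_iff_isClosed.1 hf.norm (Ici δ) isClosed_Ici
  have : {x | x ∈ S ∧ δ ≤ ‖f x‖} = u ∩ S := by
    rw [← he]; ext x; simp [and_comm]
  rw [this]
  exact hS.inter_left hu

end Slicing

/-! ### Truncation of fields vanishing on the boundary -/

section Truncation

variable {d : ℕ} {Ω : Set (Space d)}

lemma tendsto_eLpNorm_two_of_bounded {α : Type*} [MeasurableSpace α] {μ : Measure α}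
    [IsFiniteMeasure μ] {f : ℕ → α → ℝ} {C : ℝ} (hf : ∀ n, AEStronglyMeasurable (f n) μ)
    (hC : ∀ n, ∀ᵐ x ∂μ, |f n x| ≤ C) (h : ∀ᵐ x ∂μ, Tendsto (fun n => f n x) atTop (𝓝 0)) :
    Tendsto (fun n => eLpNorm (f n) 2 μ) atTop (𝓝 0) := by
  have e : ∀ n, eLpNorm (f n) 2 μ = (∫⁻ x, ‖f n x‖ₑ ^ (2 : ℝ) ∂μ) ^ (1 / (2 : ℝ)) := fun n => by
    rw [eLpNorm_eq_lintegral_rpow_enorm_toReal two_ne_zero ENNReal.ofNat_ne_top]; simp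
  simp only [e]
  have l : Tendsto (fun n => ∫⁻ x, ‖f n x‖ₑ ^ (2 : ℝ) ∂μ) atTop (𝓝 (∫⁻ _, 0 ∂μ)) := by
    refine tendsto_lintegral_of_dominated_convergence' (fun _ => ENNReal.ofReal C ^ (2 : ℝ))
      (fun n => (hf n).enorm.pow_const _) (fun n => ?_) ?_ ?_
    · filter_upwards [hC n] with x hx
      have : ‖f n x‖ₑ ≤ ENNReal.ofReal C := by
        rw [← ofReal_norm]; exact ENNReal.ofReal_le_ofReal hx
      gcongr
    · rw [lintegral_const]
      exact ENNReal.mul_ne_top (ENNReal.rpow_ne_top_of_nonneg (by norm_num) ENNReal.ofReal_ne_top)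
        (measure_ne_top _ _)
    · filter_upwards [h] with x hx
      have h1 : Tendsto (fun n => ‖f n x‖ₑ) atTop (𝓝 0) := by
        simpa [Function.comp_def] using (continuous_enorm.tendsto (0 : ℝ)).comp hx
      have h2 := (ENNReal.continuous_rpow_const (y := 2)).tendsto 0 |>.comp h1
      simpa [Function.comp_def] using h2
  have h2 := (ENNReal.continuous_rpow_const (y := 1 / (2 : ℝ))).tendsto _ |>.comp l
  simpa [Function.comp_def] using h2

/-- A `C²` field that is `C¹` up to the boundary and vanishes there belongs to `H¹₀`. No regularity
of the domain is needed: the componentwise truncations of the field near its zero set have compact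
support, and their gradients converge because the gradient of a component vanishes almost everywhere
on the zero set of the component. -/
lemma isH10C2_of_eq_zero_frontier (hΩ : IsOpen Ω) (hb : Bornology.IsBounded Ω)
    {v : Space d → Space d} {v' : Space d → Space d →L[ℝ] Space d} (hv : ContDiffOn ℝ 2 v Ω)
    (hv' : HasC1Ext v v' Ω) (h0 : ∀ x ∈ frontier Ω, v x = 0) :
    IsH10C2 Ω v (fun x => Matrix.of fun i j => v' x (EuclideanSpace.single j 1) i) := by
  have : IsFiniteMeasure (volume.restrict Ω) := ⟨by simpa using hb.measure_lt_top⟩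
  have hae : ∀ᵐ x ∂(volume.restrict Ω), x ∈ Ω := ae_restrict_mem hΩ.measurableSet
  have hcoord := fun i => hv'.coord i
  have hbd : ∀ {f : Space d → ℝ}, ContinuousOn f (closure Ω) → ∃ C, ∀ x ∈ Ω, |f x| ≤ C := by
    intro f hf
    obtain ⟨C, hC⟩ := hb.isCompact_closure.exists_bound_of_continuousOn hf
    exact ⟨C, fun x hx => hC x (subset_closure hx)⟩
  have hms : ∀ {f : Space d → ℝ}, ContinuousOn f (closure Ω) →
      AEStronglyMeasurable f (volume.restrict Ω) := fun hf =>
    (hf.mono subset_closure).aestronglyMeasurable hΩ.measurableSet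
  have hmem : ∀ {f : Space d → ℝ}, ContinuousOn f (closure Ω) → MemLp f 2 (volume.restrict Ω) := by
    intro f hf
    obtain ⟨C, hC⟩ := hbd hf
    refine MemLp.of_bound (hms hf) C ?_
    filter_upwards [hae] with x hx using hC x hx
  have hgc : ∀ i j, ContinuousOn (fun x => v' x (EuclideanSpace.single j 1) i) (closure Ω) :=
    fun i j => (hcoord i).continuousOn_deriv.clm_apply continuousOn_const
  -- The indicator removes the unspecified values of `v` outside `Ω`.
  set φ : ℕ → Space d → Space d := fun n x =>
    WithLp.toLp 2 fun i => Ω.indicator (fun y => truncAt n (v y i)) x with hφ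
  have hφi : ∀ n x i, φ n x i = Ω.indicator (fun y => truncAt n (v y i)) x := fun n x i => rfl
  set K : ℕ → Set (Space d) := fun n => {x | x ∈ closure Ω ∧ ((n : ℝ) + 1)⁻¹ ≤ ‖v x‖} with hK
  have hKc : ∀ n, IsCompact (K n) := fun n =>
    isCompact_setOf_le_norm hb.isCompact_closure hv'.continuousOn _
  have hKΩ : ∀ n, K n ⊆ Ω := by
    rintro n x ⟨hx, hx'⟩
    by_contra hxΩ
    have hfr : x ∈ frontier Ω := by rw [hΩ.frontier_eq]; exact ⟨hx, hxΩ⟩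
    rw [h0 x hfr, norm_zero] at hx'
    have : 0 < ((n : ℝ) + 1)⁻¹ := by positivity
    linarith
  have hφz : ∀ n, ∀ x ∉ K n, φ n x = 0 := by
    intro n x hx
    ext i
    rw [hφi]
    by_cases hxΩ : x ∈ Ω
    · rw [indicator_of_mem hxΩ]
      have h1 : ‖v x‖ < ((n : ℝ) + 1)⁻¹ := by
        by_contra hlt
        exact hx ⟨subset_closure hxΩ, not_lt.1 hlt⟩
      exact truncAt_eq_zero ((PiLp.norm_apply_le (v x) i).trans h1.le)
    · rw [indicator_of_notMem hxΩ]; rfl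
  have hsupp : ∀ n, tsupport (φ n) ⊆ K n := fun n =>
    closure_minimal (fun x hx => by by_contra h; exact hx (hφz n x h)) (hKc n).isClosed
  have hev : ∀ n, ∀ x ∈ Ω, ∀ i, (fun y => φ n y i) =ᶠ[𝓝 x] fun y => truncAt n (v y i) :=
    fun n x hx i => eventuallyEq_of_mem (hΩ.mem_nhds hx) fun y hy => by
      rw [hφi, indicator_of_mem hy]
  have hgrad : ∀ n, ∀ x ∈ Ω, ∀ i j, grad (φ n) x i j
      = deriv (truncAt n) (v x i) * v' x (EuclideanSpace.single j 1) i := by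
    intro n x hx i j
    have h1 : HasFDerivAt (fun y => truncAt n (v y i)) (deriv (truncAt n) (v x i) •
        (EuclideanSpace.proj (𝕜 := ℝ) i).comp (v' x)) x :=
      ((contDiff_truncAt n (k := 1)).differentiable one_ne_zero _).hasDerivAt.comp_hasFDerivAt x
        ((hcoord i).hasFDerivAt x hx)
    rw [grad_apply, (hev n x hx i).fderiv_eq, h1.fderiv]
    rfl
  obtain ⟨Ct, hCt⟩ := exists_abs_deriv_truncAt_le
  refine ⟨fun i => hmem (hcoord i).continuousOn, fun i j => hmem (hgc i j), φ, fun n => ⟨?_,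
    (hKc n).of_isClosed_subset (isClosed_tsupport _) (hsupp n), (hsupp n).trans (hKΩ n)⟩,
    fun i => ?_, fun i j => ?_⟩
  · rw [contDiff_iff_contDiffAt]
    intro x
    by_cases hx : x ∈ Ω
    · rw [contDiffAt_euclidean]
      intro i
      refine ContDiffAt.congr_of_eventuallyEq ?_ (hev n x hx i)
      have h1 : ContDiffAt ℝ 2 (fun y => v y i) x :=
        contDiffAt_euclidean.1 (hv.contDiffAt (hΩ.mem_nhds hx)) i
      exact (contDiff_truncAt n (k := 2)).contDiffAt.comp x h1
    · have hxK : x ∈ (K n)ᶜ := fun h => hx (hKΩ n h)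
      refine (contDiffAt_const (c := (0 : Space d))).congr_of_eventuallyEq
        (eventuallyEq_of_mem ((hKc n).isClosed.isOpen_compl.mem_nhds hxK) fun y hy => hφz n y hy)
  · obtain ⟨C, hC⟩ := hbd (hcoord i).continuousOn
    have hm : ∀ n, AEStronglyMeasurable (fun x => φ n x i) (volume.restrict Ω) := by
      intro n
      have : ContinuousOn (fun x => truncAt n (v x i)) (closure Ω) :=
        (contDiff_truncAt n (k := 0)).continuous.comp_continuousOn (hcoord i).continuousOn
      refine (hms this).congr ?_
      filter_upwards [hae] with x hx
      rw [hφi, indicator_of_mem hx]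
    refine tendsto_eLpNorm_two_of_bounded (C := C + C)
      (fun n => (hm n).sub (hms (hcoord i).continuousOn)) (fun n => ?_) ?_
    · filter_upwards [hae] with x hx
      rw [hφi, indicator_of_mem hx]
      refine (abs_sub _ _).trans (add_le_add ((abs_truncAt_le _ _).trans (hC x hx)) (hC x hx))
    · filter_upwards [hae] with x hx
      have := (tendsto_truncAt (v x i)).sub_const (v x i)
      rw [sub_self] at this
      refine this.congr fun n => ?_
      rw [hφi, indicator_of_mem hx]
  · obtain ⟨C, hC⟩ := hbd (hgc i j)
    have hz := ae_fderiv_eq_zero_of_eq_zero volume hΩ (hcoord i).hasFDerivAt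
    have e : ∀ n, ∀ x ∈ Ω, grad (φ n) x i j - v' x (EuclideanSpace.single j 1) i
        = (deriv (truncAt n) (v x i) - 1) * v' x (EuclideanSpace.single j 1) i := by
      intro n x hx; rw [hgrad n x hx]; ring
    refine tendsto_eLpNorm_two_of_bounded (C := (Ct + 1) * C) (fun n => ?_) (fun n => ?_) ?_
    · have : ContinuousOn (fun x => (deriv (truncAt n) (v x i) - 1)
          * v' x (EuclideanSpace.single j 1) i) (closure Ω) :=
        ((((contDiff_truncAt n (k := 1)).continuous_deriv le_rfl).comp_continuousOn
          (hcoord i).continuousOn).sub continuousOn_const).mul (hgc i j)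
      refine (hms this).congr ?_
      filter_upwards [hae] with x hx using (e n x hx).symm
    · filter_upwards [hae] with x hx
      have h1 := hCt n (v x i)
      have h2 : |deriv (truncAt n) (v x i) - 1| ≤ Ct + 1 :=
        (abs_sub _ _).trans (by simpa using h1)
      simp only [Matrix.of_apply]
      rw [e n x hx, abs_mul]
      exact mul_le_mul h2 (hC x hx) (abs_nonneg _) ((abs_nonneg _).trans h2)
    · filter_upwards [hae, hz] with x hx hzx
      have : Tendsto (fun n => (deriv (truncAt n) (v x i) - 1)
          * v' x (EuclideanSpace.single j 1) i) atTop (𝓝 0) := by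
        by_cases hvx : v x i = 0
        · have h1 := congrArg (fun L => L (EuclideanSpace.single j 1)) (hzx hvx)
          have h2 : v' x (EuclideanSpace.single j 1) i = 0 := h1
          simp [h2]
        · have := ((tendsto_deriv_truncAt hvx).sub_const 1).mul_const
            (v' x (EuclideanSpace.single j 1) i)
          simpa using this
      exact this.congr fun n => (e n x hx).symm

end Truncation

/-! ### The weak formulation tested with a strong solution -/

section Weak

variable {d : ℕ} {Ω : Set (Space d)} {T : ℝ}

lemma volume_restrict_stCylinder (T : ℝ) (Ω : Set (Space d)) :
    volume.restrict (stCylinder T Ω)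
      = (volume.restrict (Ioo 0 T)).prod (volume.restrict Ω) := by
  rw [stCylinder, Measure.volume_eq_prod, Measure.prod_restrict]

lemma stCylinder_subset {τ : ℝ} (h : τ ≤ T) : stCylinder τ Ω ⊆ stCylinder T Ω :=
  prod_mono (Ioo_subset_Ioo_right h) subset_rfl

lemma isFiniteMeasure_restrict (hb : Bornology.IsBounded Ω) :
    IsFiniteMeasure (volume.restrict Ω) := ⟨by simpa using hb.measure_lt_top⟩

lemma isFiniteMeasure_restrict_stCylinder (hb : Bornology.IsBounded Ω) :
    IsFiniteMeasure (volume.restrict (stCylinder T Ω)) := by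
  have := isFiniteMeasure_restrict hb
  have : IsFiniteMeasure (volume.restrict (Ioo 0 T)) := ⟨by simp⟩
  rw [volume_restrict_stCylinder]
  infer_instance

instance isAddHaarMeasure_volume_prod : (volume : Measure (ℝ × Space d)).IsAddHaarMeasure := by
  rw [Measure.volume_eq_prod]; infer_instance

lemma integrableOn_slice {f : ℝ × Space d → ℝ} (h : IntegrableOn f (stCylinder T Ω)) :
    ∀ᵐ t ∂(volume.restrict (Ioo 0 T)), IntegrableOn (fun x => f (t, x)) Ω := by
  rw [IntegrableOn, volume_restrict_stCylinder] at h
  exact h.prod_right_ae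

lemma setIntegral_stCylinder {τ : ℝ} {f : ℝ × Space d → ℝ} (h : IntegrableOn f (stCylinder τ Ω)) :
    ∫ z in stCylinder τ Ω, f z = ∫ t in Ioo 0 τ, ∫ x in Ω, f (t, x) := by
  rw [IntegrableOn] at h
  rw [volume_restrict_stCylinder] at h ⊢
  exact integral_prod _ h

lemma integrableOn_mul_of_continuousOn_closure {X : Type*} [TopologicalSpace X] [MeasurableSpace X]
    [OpensMeasurableSpace X] {ν : Measure X} {G : Set X} (hG : IsOpen G)
    (hc : IsCompact (closure G)) {f g : X → ℝ} (hf : ContinuousOn f (closure G))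
    (hg : IntegrableOn g G ν) : IntegrableOn (fun x => f x * g x) G ν := by
  obtain ⟨C, hC⟩ := hc.exists_bound_of_continuousOn hf
  refine Integrable.bdd_mul (c := C) hg ?_ ?_
  · exact (hf.mono subset_closure).aestronglyMeasurable hG.measurableSet
  · filter_upwards [ae_restrict_mem hG.measurableSet] with x hx using hC x (subset_closure hx)

/-- The weak mass balance in terms of the derivative of the test function. -/
lemma WeakMass.test {ρ₀ : Space d → ℝ} {ρ : ℝ × Space d → ℝ} {u : ℝ × Space d → Space d}
    (hΩ : IsOpen Ω) (h : WeakMass Ω T ρ₀ ρ u) {ψ : ℝ × Space d → ℝ}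
    {ψ' : ℝ × Space d → ℝ × Space d →L[ℝ] ℝ} (hψ : HasC1Ext ψ ψ' (stCylinder T Ω)) :
    ∀ᵐ τ ∂(volume.restrict (Ioo 0 T)),
      (∫ z in stCylinder τ Ω, (ψ' z (1, 0) * ρ z
          + ∑ j, ψ' z (0, EuclideanSpace.single j 1) * (ρ z * u z j)))
      + (∫ x in Ω, (ψ (0, x) * ρ₀ x - ψ (τ, x) * ρ (τ, x))) = 0 := by
  filter_upwards [h ψ (hψ.contDiffUpTo (isOpen_stCylinder hΩ)), ae_restrict_mem measurableSet_Ioo]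
    with τ hτ hτT
  refine Eq.trans ?_ hτ
  congr 1
  refine setIntegral_congr_fun (isOpen_stCylinder hΩ).measurableSet fun z hz => ?_
  have hd := hψ.hasFDerivAt z (stCylinder_subset hτT.2.le hz)
  simp only [(hasDerivAt_time hd).deriv, pd_space hd]

/-- The weak momentum balance in terms of the derivatives of the components of the test field. -/
lemma WeakMomentum.test {γ μ η : ℝ} {ρ₀ : Space d → ℝ} {u₀ : Space d → Space d}
    {ρ : ℝ × Space d → ℝ} {u : ℝ × Space d → Space d}
    {G : ℝ × Space d → Matrix (Fin d) (Fin d) ℝ}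
    (hΩ : IsOpen Ω) (h : WeakMomentum Ω T γ μ η ρ₀ u₀ ρ u G)
    {f : Fin d → ℝ × Space d → ℝ} {f' : Fin d → ℝ × Space d → ℝ × Space d →L[ℝ] ℝ}
    (hf : ∀ i, HasC1Ext (f i) (f' i) (stCylinder T Ω))
    (hK : ∃ K : Set (Space d), IsCompact K ∧ K ⊆ Ω ∧
      ∀ i, ∀ t ∈ Icc 0 T, ∀ x ∉ K, f i (t, x) = 0) :
    ∀ᵐ τ ∂(volume.restrict (Ioo 0 T)),
      (∫ z in stCylinder τ Ω, ∑ i, (f' i z (1, 0) * (ρ z * u z i)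
          + (∑ j, f' i z (0, EuclideanSpace.single j 1) * (ρ z * u z i * u z j))
          + f' i z (0, EuclideanSpace.single i 1) * ρ z ^ γ
          - ∑ j, f' i z (0, EuclideanSpace.single j 1) * stress μ η (G z) i j))
      + (∫ x in Ω, ((∑ i, f i (0, x) * (ρ₀ x * u₀ x i))
          - (∑ i, f i (τ, x) * (ρ (τ, x) * u (τ, x) i)))) = 0 := by
  set φ : ℝ × Space d → Space d := fun z => ∑ i, f i z • EuclideanSpace.single i (1 : ℝ) with hφ
  have hφi : ∀ z i, φ z i = f i z := by
    intro z i
    simp [hφ, Finset.sum_apply, Pi.single_apply]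
  have hφ' : ContDiffUpTo 1 φ (stCylinder T Ω) :=
    (HasC1Ext.sum Finset.univ fun i _ => (hf i).clm_comp
      (ContinuousLinearMap.toSpanSingleton ℝ (EuclideanSpace.single i (1 : ℝ)))).contDiffUpTo
      (isOpen_stCylinder hΩ)
  obtain ⟨K, hKc, hKΩ, hK0⟩ := hK
  have hφK : ∃ K : Set (Space d), IsCompact K ∧ K ⊆ Ω ∧ ∀ t ∈ Icc 0 T, ∀ x ∉ K, φ (t, x) = 0 :=
    ⟨K, hKc, hKΩ, fun t ht x hx => by ext i; rw [hφi, hK0 i t ht x hx]; rfl⟩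
  filter_upwards [h φ hφ' hφK, ae_restrict_mem measurableSet_Ioo] with τ hτ hτT
  simp only [hφi] at hτ
  refine Eq.trans ?_ hτ
  congr 1
  refine setIntegral_congr_fun (isOpen_stCylinder hΩ).measurableSet fun z hz => ?_
  have hd := fun i => (hf i).hasFDerivAt z (stCylinder_subset hτT.2.le hz)
  have hg : ∀ i j, grad (fun y => φ (z.1, y)) z.2 i j
      = f' i z (0, EuclideanSpace.single j 1) := fun i j => by
    rw [← pd_space (hd i) j]
    simp only [grad, Matrix.of_apply, hφi]
  simp only [contract, Matrix.trace, Matrix.diag, hg, Matrix.of_apply,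
    (hasDerivAt_time (hd _)).deriv, Finset.sum_add_distrib, Finset.sum_sub_distrib,
    Finset.sum_mul]
  congr 1
  exact Finset.sum_congr rfl fun i _ => Finset.sum_congr rfl fun j _ => mul_comm _ (stress μ η (G z) i j)

/-- A velocity that is `C¹` up to the boundary and vanishes on the boundary is admissible in the weak
momentum balance, although it is not compactly supported: its truncations near zero are, and the
integrand is a linear combination of the derivatives of the truncation, with coefficients that vanish
almost everywhere on the zero sets of the components. -/
lemma WeakMomentum.test_of_eq_zero_frontier {γ μ η : ℝ} {ρ₀ : Space d → ℝ}
    {u₀ : Space d → Space d} {ρ : ℝ × Space d → ℝ} {u : ℝ × Space d → Space d}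
    {G : ℝ × Space d → Matrix (Fin d) (Fin d) ℝ} {U : ℝ × Space d → Space d}
    {U' : Fin d → ℝ × Space d → ℝ × Space d →L[ℝ] ℝ}
    (hΩ : IsOpen Ω) (hb : Bornology.IsBounded Ω) (hT : 0 < T)
    (h : WeakMomentum Ω T γ μ η ρ₀ u₀ ρ u G)
    (hUc : ContinuousOn U (closure (stCylinder T Ω)))
    (hU : ∀ i, HasC1Ext (fun z => U z i) (U' i) (stCylinder T Ω))
    (h0 : ∀ t ∈ Icc 0 T, ∀ x ∈ frontier Ω, U (t, x) = 0)
    (Iu : ∀ i, IntegrableOn (fun z => ρ z * u z i) (stCylinder T Ω))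
    (Iuu : ∀ i j, IntegrableOn (fun z => ρ z * u z i * u z j) (stCylinder T Ω))
    (Ip : IntegrableOn (fun z => ρ z ^ γ) (stCylinder T Ω))
    (IS : ∀ i j, IntegrableOn (fun z => stress μ η (G z) i j) (stCylinder T Ω))
    (I0 : ∀ i, IntegrableOn (fun x => ρ₀ x * u₀ x i) Ω) :
    ∀ᵐ τ ∂(volume.restrict (Ioo 0 T)),
      (∫ z in stCylinder τ Ω, ∑ i, (U' i z (1, 0) * (ρ z * u z i)
          + (∑ j, U' i z (0, EuclideanSpace.single j 1) * (ρ z * u z i * u z j))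
          + U' i z (0, EuclideanSpace.single i 1) * ρ z ^ γ
          - ∑ j, U' i z (0, EuclideanSpace.single j 1) * stress μ η (G z) i j))
      + (∫ x in Ω, ((∑ i, U (0, x) i * (ρ₀ x * u₀ x i))
          - (∑ i, U (τ, x) i * (ρ (τ, x) * u (τ, x) i)))) = 0 := by
  have hop := isOpen_stCylinder (T := T) hΩ
  have hcl := closure_stCylinder hT Ω
  have hcomp := isCompact_closure_stCylinder hb hT
  set S := closure (stCylinder T Ω) with hS
  set F : Fin d → ℝ × Space d → ℝ := fun i z => U' i z (1, 0) * (ρ z * u z i)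
          + (∑ j, U' i z (0, EuclideanSpace.single j 1) * (ρ z * u z i * u z j))
          + U' i z (0, EuclideanSpace.single i 1) * ρ z ^ γ
          - ∑ j, U' i z (0, EuclideanSpace.single j 1) * stress μ η (G z) i j with hF
  have cU' : ∀ i v, ContinuousOn (fun z => U' i z v) S := fun i v =>
    (hU i).continuousOn_deriv.clm_apply continuousOn_const
  have IF : ∀ i, IntegrableOn (F i) (stCylinder T Ω) := fun i =>
    (((integrableOn_mul_of_continuousOn_closure hop hcomp (cU' i _) (Iu i)).add
      (integrable_finsetSum _ fun j _ =>
        integrableOn_mul_of_continuousOn_closure hop hcomp (cU' i _) (Iuu i j))).add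
      (integrableOn_mul_of_continuousOn_closure hop hcomp (cU' i _) Ip)).sub
      (integrable_finsetSum _ fun j _ =>
        integrableOn_mul_of_continuousOn_closure hop hcomp (cU' i _) (IS i j))
  have hz0 : ∀ i, ∀ᵐ z ∂(volume.restrict (stCylinder T Ω)), U z i = 0 → F i z = 0 := by
    intro i
    filter_upwards [ae_fderiv_eq_zero_of_eq_zero volume hop (hU i).hasFDerivAt] with z hz hUz
    simp [hF, hz hUz]
  obtain ⟨Ct, hCt⟩ := exists_abs_deriv_truncAt_le
  obtain ⟨CU, hCU⟩ := hcomp.exists_bound_of_continuousOn hUc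
  -- The indicator is needed because nothing is known about `U` outside the closed cylinder, while
  -- test fields have to vanish outside a compact subset of `Ω`.
  set f : ℕ → Fin d → ℝ × Space d → ℝ := fun n i => S.indicator fun z => truncAt n (U z i) with hf
  have hfe : ∀ n i, ∀ z ∈ S, f n i z = truncAt n (U z i) := fun n i z hz => indicator_of_mem hz _
  have hfC : ∀ n i, HasC1Ext (f n i) (fun z => deriv (truncAt n) (U z i) • U' i z)
      (stCylinder T Ω) := fun n i => by
    refine HasC1Ext.congr hop ((hU i).comp_deriv (s := univ) (fun _ _ => mem_univ _)
      ((contDiff_truncAt n (k := 1)).continuous_deriv le_rfl).continuousOn fun y _ =>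
      ((contDiff_truncAt n (k := 1)).differentiable one_ne_zero y).hasDerivAt) (hfe n i)
  have hfK : ∀ n, ∃ K : Set (Space d), IsCompact K ∧ K ⊆ Ω ∧
      ∀ i, ∀ t ∈ Icc 0 T, ∀ x ∉ K, f n i (t, x) = 0 := by
    intro n
    refine ⟨Prod.snd '' {z | z ∈ S ∧ ((n : ℝ) + 1)⁻¹ ≤ ‖U z‖},
      (isCompact_setOf_le_norm hcomp hUc _).image continuous_snd, ?_, ?_⟩
    · rintro _ ⟨⟨t, x⟩, ⟨hz, hz'⟩, rfl⟩
      rw [hcl] at hz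
      by_contra hxΩ
      have hfr : x ∈ frontier Ω := by rw [hΩ.frontier_eq]; exact ⟨hz.2, hxΩ⟩
      rw [h0 t hz.1 x hfr, norm_zero] at hz'
      have : 0 < ((n : ℝ) + 1)⁻¹ := by positivity
      linarith
    · intro i t ht x hx
      by_cases hz : (t, x) ∈ S
      · rw [hfe n i _ hz]
        have h1 : ‖U (t, x)‖ < ((n : ℝ) + 1)⁻¹ := by
          by_contra hlt
          exact hx ⟨(t, x), ⟨hz, not_lt.1 hlt⟩, rfl⟩
        exact truncAt_eq_zero ((PiLp.norm_apply_le (U (t, x)) i).trans h1.le)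
      · exact indicator_of_notMem hz _
  have htest := ae_all_iff.2 fun n => h.test hΩ (hfC n) (hfK n)
  have hIs := ae_all_iff.2 fun i => integrableOn_slice (Iu i)
  filter_upwards [htest, hIs, ae_restrict_mem measurableSet_Ioo] with τ hτ hIτ hτT
  have hsub : stCylinder τ Ω ⊆ stCylinder T Ω := stCylinder_subset hτT.2.le
  have hmem : ∀ t ∈ Icc 0 T, ∀ x ∈ Ω, (t, x) ∈ S := fun t ht x hx => by
    rw [hcl]; exact ⟨ht, subset_closure hx⟩
  have haeΩ : ∀ᵐ x ∂(volume.restrict Ω), x ∈ Ω := ae_restrict_mem hΩ.measurableSet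
  have hτI : τ ∈ Icc 0 T := Ioo_subset_Icc_self hτT
  have h0I : (0 : ℝ) ∈ Icc 0 T := left_mem_Icc.2 hT.le
  -- The integrands are dominated since the derivatives of the truncations are uniformly bounded.
  have lim1 : Tendsto (fun n => ∫ z in stCylinder τ Ω,
      ∑ i, deriv (truncAt n) (U z i) * F i z) atTop
      (𝓝 (∫ z in stCylinder τ Ω, ∑ i, F i z)) := by
    refine tendsto_integral_of_dominated_convergence (fun z => ∑ i, Ct * |F i z|) (fun n => ?_)
      ?_ (fun n => Eventually.of_forall fun z => ?_) ?_
    · refine (integrable_finsetSum _ fun i _ => ?_ :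
        IntegrableOn _ (stCylinder τ Ω) volume).aestronglyMeasurable
      refine IntegrableOn.mono_set ?_ hsub
      exact integrableOn_mul_of_continuousOn_closure hop hcomp
        (((contDiff_truncAt n (k := 1)).continuous_deriv le_rfl).comp_continuousOn
          (hU i).continuousOn) (IF i)
    · exact integrable_finsetSum _ fun i _ => (((IF i).mono_set hsub).abs).const_mul Ct
    · refine (norm_sum_le _ _).trans (Finset.sum_le_sum fun i _ => ?_)
      rw [norm_mul]
      exact mul_le_mul_of_nonneg_right (hCt n _) (norm_nonneg _)
    · have hz := ae_restrict_of_ae_restrict_of_subset hsub (ae_all_iff.2 hz0)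
      filter_upwards [hz] with z hz
      refine tendsto_finsetSum _ fun i _ => ?_
      by_cases hUz : U z i = 0
      · simp [hz i hUz]
      · simpa using (tendsto_deriv_truncAt hUz).mul_const (F i z)
  have lim2 : Tendsto (fun n => ∫ x in Ω, ((∑ i, f n i (0, x) * (ρ₀ x * u₀ x i))
      - (∑ i, f n i (τ, x) * (ρ (τ, x) * u (τ, x) i)))) atTop
      (𝓝 (∫ x in Ω, ((∑ i, U (0, x) i * (ρ₀ x * u₀ x i))
          - (∑ i, U (τ, x) i * (ρ (τ, x) * u (τ, x) i))))) := by
    have hcs : ∀ n i, ∀ t ∈ Icc 0 T, ContinuousOn (fun x => f n i (t, x)) (closure Ω) := by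
      intro n i t ht
      refine (hfC n i).continuousOn.comp (by fun_prop) fun x hx => ?_
      change (t, x) ∈ S
      rw [hcl]; exact ⟨ht, hx⟩
    have hbd : ∀ n i, ∀ t ∈ Icc 0 T, ∀ x ∈ Ω, |f n i (t, x)| ≤ CU := fun n i t ht x hx => by
      rw [hfe n i _ (hmem t ht x hx)]
      exact (abs_truncAt_le _ _).trans
        ((PiLp.norm_apply_le (U (t, x)) i).trans (hCU _ (hmem t ht x hx)))
    refine tendsto_integral_of_dominated_convergence
      (fun x => (∑ i, CU * |ρ₀ x * u₀ x i|) + ∑ i, CU * |ρ (τ, x) * u (τ, x) i|)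
      (fun n => ?_) ?_ (fun n => ?_) ?_
    · refine ((integrable_finsetSum _ fun i _ => ?_ : IntegrableOn _ Ω volume).sub
        (integrable_finsetSum _ fun i _ => ?_ : IntegrableOn _ Ω volume)).aestronglyMeasurable
      · exact integrableOn_mul_of_continuousOn_closure hΩ hb.isCompact_closure (hcs n i 0 h0I) (I0 i)
      · exact integrableOn_mul_of_continuousOn_closure hΩ hb.isCompact_closure (hcs n i τ hτI) (hIτ i)
    · exact (integrable_finsetSum _ fun i _ => (I0 i).abs.const_mul CU).add
        (integrable_finsetSum _ fun i _ => (hIτ i).abs.const_mul CU)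
    · filter_upwards [haeΩ] with x hx
      refine (norm_sub_le _ _).trans (add_le_add ?_ ?_)
      · refine (norm_sum_le _ _).trans (Finset.sum_le_sum fun i _ => ?_)
        rw [norm_mul]
        exact mul_le_mul_of_nonneg_right (hbd n i 0 h0I x hx) (norm_nonneg _)
      · refine (norm_sum_le _ _).trans (Finset.sum_le_sum fun i _ => ?_)
        rw [norm_mul]
        exact mul_le_mul_of_nonneg_right (hbd n i τ hτI x hx) (norm_nonneg _)
    · filter_upwards [haeΩ] with x hx
      simp only [hfe _ _ _ (hmem 0 h0I x hx), hfe _ _ _ (hmem τ hτI x hx)]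
      exact (tendsto_finsetSum _ fun i _ => (tendsto_truncAt _).mul_const _).sub
        (tendsto_finsetSum _ fun i _ => (tendsto_truncAt _).mul_const _)
  refine tendsto_nhds_unique (lim1.add lim2) (tendsto_const_nhds.congr fun n => ?_)
  refine (Eq.trans ?_ (hτ n)).symm
  congr 1
  refine integral_congr_ae (Eventually.of_forall fun z => Finset.sum_congr rfl fun i _ => ?_)
  simp only [hF, smul_apply, smul_eq_mul, mul_sub, mul_add, Finset.mul_sum,
    mul_assoc]

/-- The fundamental theorem of calculus in time, integrated over the domain. -/
lemma HasC1Ext.integral_sub_eq (hΩ : IsOpen Ω) (hb : Bornology.IsBounded Ω) (hT : 0 < T)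
    {f : ℝ × Space d → ℝ} {f' : ℝ × Space d → ℝ × Space d →L[ℝ] ℝ}
    (hf : HasC1Ext f f' (stCylinder T Ω)) {τ : ℝ} (hτ : τ ∈ Ioo 0 T) :
    ∫ x in Ω, (f (τ, x) - f (0, x)) = ∫ z in stCylinder τ Ω, f' z (1, 0) := by
  have hop := isOpen_stCylinder (T := T) hΩ
  have hcl := closure_stCylinder hT Ω
  have hcomp := isCompact_closure_stCylinder hb hT
  have hfin := isFiniteMeasure_restrict_stCylinder (T := T) hb
  have hc1 : ContinuousOn (fun z => f' z (1, 0)) (Icc 0 T ×ˢ closure Ω) := by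
    rw [← hcl]; exact hf.continuousOn_deriv.clm_apply continuousOn_const
  have hi : IntegrableOn (fun z => f' z (1, 0)) (stCylinder τ Ω) :=
    (hc1.integrableOn_compact (hcl ▸ hcomp)).mono_set
      (prod_mono (fun t ht => ⟨ht.1.le, ht.2.le.trans hτ.2.le⟩) subset_closure)
  rw [IntegrableOn, volume_restrict_stCylinder] at hi
  rw [volume_restrict_stCylinder, integral_prod_symm _ hi]
  refine setIntegral_congr_fun hΩ.measurableSet fun x hx => ?_
  have hsubI : Icc 0 τ ⊆ Icc 0 T := Icc_subset_Icc_right hτ.2.le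
  have cmap : ∀ {g : ℝ × Space d → ℝ}, ContinuousOn g (Icc 0 T ×ˢ closure Ω) →
      ContinuousOn (fun t => g (t, x)) (Icc 0 τ) := fun hg =>
    hg.comp (by fun_prop) fun t ht => ⟨hsubI ht, subset_closure hx⟩
  have hc0 : ContinuousOn f (Icc 0 T ×ˢ closure Ω) := by rw [← hcl]; exact hf.continuousOn
  have := intervalIntegral.integral_eq_sub_of_hasDerivAt_of_le hτ.1.le (cmap hc0)
    (fun t ht => hasDerivAt_time (z := (t, x)) (hf.hasFDerivAt (t, x)
      ⟨⟨ht.1, ht.2.trans hτ.2⟩, hx⟩))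
    ((cmap hc1).intervalIntegrable_of_Icc hτ.1.le)
  rw [← integral_Ioc_eq_integral_Ioo, ← intervalIntegral.integral_of_le hτ.1.le, this]

end Weak

/-! ### The relative energy -/

section Algebra

variable {d : ℕ}

/-- The density of the relative energy of the state `(r, v)` with respect to `(R, V)`. -/
noncomputable def relEnergy (γ r : ℝ) (v : Space d) (R : ℝ) (V : Space d) : ℝ :=
  1 / 2 * (r * ‖v - V‖ ^ 2) + relPot γ r R

/-- The function `½ |V|² - H'(R)`: the test function for the mass balance, whose product with the
density of the weak solution enters the relative energy. -/
noncomputable def massMultiplier (γ R : ℝ) (V : Space d) : ℝ :=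
  1 / 2 * (∑ i, V i ^ 2) - γ / (γ - 1) * R ^ (γ - 1)

lemma norm_sub_sq_eq_sum (v V : Space d) : ‖v - V‖ ^ 2 = ∑ i, (v i - V i) ^ 2 := by
  rw [EuclideanSpace.real_norm_sq_eq]; rfl

lemma relEnergy_eq {γ R : ℝ} (hγ : 1 < γ) (hR : 0 < R) (r : ℝ) (v V : Space d) :
    relEnergy γ r v R V = (1 / 2 * (r * ‖v‖ ^ 2) + 1 / (γ - 1) * r ^ γ)
      - (∑ i, V i * (r * v i)) + massMultiplier γ R V * r + R ^ γ := by
  have hg : γ - 1 ≠ 0 := by linarith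
  have hRγ : R ^ γ = R ^ (γ - 1) * R := by
    rw [← Real.rpow_add_one hR.ne']; congr 1; ring
  have e1 : ∑ i, (v i - V i) ^ 2 = ∑ i, v i ^ 2 - 2 * ∑ i, V i * v i + ∑ i, V i ^ 2 := by
    rw [Finset.mul_sum, ← Finset.sum_sub_distrib, ← Finset.sum_add_distrib]
    exact Finset.sum_congr rfl fun i _ => by ring
  have e2 : ∑ i, V i * (r * v i) = r * ∑ i, V i * v i := by
    rw [Finset.mul_sum]
    exact Finset.sum_congr rfl fun i _ => by ring
  rw [relEnergy, relPot, massMultiplier, norm_sub_sq_eq_sum, EuclideanSpace.real_norm_sq_eq, e1, e2,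
    hRγ]
  field_simp
  ring

lemma relEnergy_self {γ : ℝ} (R : ℝ) (V : Space d) : relEnergy γ R V R V = 0 := by
  simp [relEnergy, relPot]

lemma stress_sub (μ η : ℝ) (A B : Matrix (Fin d) (Fin d) ℝ) :
    stress μ η (A - B) = stress μ η A - stress μ η B := by
  ext i j
  simp only [stress, Matrix.add_apply, Matrix.smul_apply, Matrix.sub_apply,
    Matrix.transpose_apply, smul_eq_mul, Matrix.trace_sub]
  ring

lemma contract_sub_left (A B C : Matrix (Fin d) (Fin d) ℝ) :
    contract (A - B) C = contract A C - contract B C := by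
  simp only [contract, Matrix.sub_apply, sub_mul, Finset.sum_sub_distrib]

lemma contract_sub_right (A B C : Matrix (Fin d) (Fin d) ℝ) :
    contract A (B - C) = contract A B - contract A C := by
  simp only [contract, Matrix.sub_apply, mul_sub, Finset.sum_sub_distrib]

/-- The algebra behind the relative energy inequality. The left-hand side collects the integrands
produced by the energy inequality, by the momentum balance tested with `U`, by the mass balance tested
with `massMultiplier` and by the time derivative of `R ^ γ`. On the right, the first terms are
dissipation and quadratic errors, and the bracket integrates to zero. -/
lemma relEnergy_production_eq {γ μ η r R Rt p q q₂ : ℝ} {u U Ut Rx b : Fin d → ℝ}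
    {G A : Matrix (Fin d) (Fin d) ℝ} (hR : R ≠ 0) (hq : q = q₂ * R)
    (hmass : Rt + ∑ j, (Rx j * U j + R * A j j) = 0)
    (hb : ∀ i, b i = R * Ut i + R * (∑ j, A i j * U j) + γ * q * Rx i) :
    -contract (stress μ η G) G
      - (∑ i, (Ut i * (r * u i) + (∑ j, A i j * (r * u i * u j)) + A i i * p
          - ∑ j, A i j * stress μ η G i j))
      + (((∑ i, U i * Ut i) - γ * q₂ * Rt) * r
          + ∑ j, ((∑ i, U i * A i j) - γ * q₂ * Rx j) * (r * u j))
      + γ * q * Rt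
    = -contract (stress μ η (G - A)) (G - A)
      - r * (∑ i, ∑ j, A i j * ((u i - U i) * (u j - U j)))
      - A.trace * (p - q * R - γ * q * (r - R))
      - (r - R) / R * (∑ i, (u i - U i) * b i)
      - ((∑ i, (u i - U i) * b i) + contract (stress μ η A) (G - A)
          + ∑ j, (U j * (γ * q * Rx j) + A j j * (q * R))) := by
  have t1 : ∑ i, ∑ j, A i j * stress μ η G i j = contract (stress μ η G) A := by
    simp only [contract]
    exact Finset.sum_congr rfl fun i _ => Finset.sum_congr rfl fun j _ => mul_comm _ _
  have t2 : ∑ i, A i i = A.trace := rfl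
  set s3 := ∑ i, ∑ j, A i j * (u i * u j) with hs3
  set s4 := ∑ i, ∑ j, A i j * (U i * u j) with hs4
  set s5 := ∑ i, ∑ j, A i j * (u i * U j) with hs5
  set s6 := ∑ i, ∑ j, A i j * (U i * U j) with hs6
  set s1 := ∑ i, Ut i * u i with hs1
  set s2 := ∑ i, U i * Ut i with hs2
  set c1 := ∑ j, Rx j * u j with hc1
  set c2 := ∑ j, Rx j * U j with hc2
  have e1 : ∑ i, (Ut i * (r * u i) + (∑ j, A i j * (r * u i * u j)) + A i i * p
      - ∑ j, A i j * stress μ η G i j)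
      = r * s1 + r * s3 + A.trace * p - contract (stress μ η G) A := by
    rw [← t1, ← t2, hs1, hs3]
    simp only [Finset.sum_sub_distrib, Finset.sum_add_distrib, Finset.mul_sum, Finset.sum_mul]
    congr 3
    · exact Finset.sum_congr rfl fun i _ => by ring
    · exact Finset.sum_congr rfl fun i _ => Finset.sum_congr rfl fun j _ => by ring
  have e2 : ∑ j, ((∑ i, U i * A i j) - γ * q₂ * Rx j) * (r * u j) = r * s4 - γ * q₂ * r * c1 := by
    rw [hs4, hc1, Finset.sum_comm]
    simp only [sub_mul, Finset.sum_sub_distrib, Finset.mul_sum, Finset.sum_mul]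
    congr 1
    · exact Finset.sum_congr rfl fun i _ => Finset.sum_congr rfl fun j _ => by ring
    · exact Finset.sum_congr rfl fun i _ => by ring
  have e3 : ∑ i, ∑ j, A i j * ((u i - U i) * (u j - U j)) = s3 - s5 - s4 + s6 := by
    rw [hs3, hs4, hs5, hs6]
    simp only [← Finset.sum_sub_distrib, ← Finset.sum_add_distrib]
    exact Finset.sum_congr rfl fun i _ => Finset.sum_congr rfl fun j _ => by ring
  have e4 : ∑ i, (u i - U i) * b i = R * (s1 - s2 + s5 - s6) + γ * q * (c1 - c2) := by
    have : ∀ i, (u i - U i) * b i = R * (Ut i * u i) - R * (U i * Ut i)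
        + R * (∑ j, A i j * (u i * U j)) - R * (∑ j, A i j * (U i * U j))
        + γ * q * (Rx i * u i) - γ * q * (Rx i * U i) := by
      intro i
      have f1 : ∑ j, A i j * (u i * U j) = u i * ∑ j, A i j * U j := by
        rw [Finset.mul_sum]; exact Finset.sum_congr rfl fun j _ => by ring
      have f2 : ∑ j, A i j * (U i * U j) = U i * ∑ j, A i j * U j := by
        rw [Finset.mul_sum]; exact Finset.sum_congr rfl fun j _ => by ring
      rw [hb, f1, f2]; ring
    simp only [this, Finset.sum_add_distrib, Finset.sum_sub_distrib, ← Finset.mul_sum]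
    rw [← hs1, ← hs2, ← hs5, ← hs6, ← hc1, ← hc2]
    ring
  have e5 : ∑ j, (U j * (γ * q * Rx j) + A j j * (q * R)) = γ * q * c2 + A.trace * (q * R) := by
    rw [← t2, hc2, Finset.sum_add_distrib, Finset.mul_sum, Finset.sum_mul]
    congr 1
    exact Finset.sum_congr rfl fun i _ => by ring
  have e6 : Rt = -c2 - R * A.trace := by
    rw [Finset.sum_add_distrib, ← Finset.mul_sum, t2] at hmass
    linarith
  have e7 : contract (stress μ η (G - A)) (G - A) + contract (stress μ η A) (G - A)
      = contract (stress μ η G) G - contract (stress μ η G) A := by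
    rw [stress_sub, contract_sub_left, ← contract_sub_right]; ring
  rw [e1, e2, e3, e4, e5, e6]
  have e8 : contract (stress μ η (G - A)) (G - A) = contract (stress μ η G) G
      - contract (stress μ η G) A - contract (stress μ η A) (G - A) := by linarith
  rw [e8, hq]
  field_simp
  ring

/-- The error terms are controlled by the relative energy and an arbitrarily small multiple of the
squared velocity difference. -/
lemma exists_error_le {γ : ℝ} (hγ : 1 < γ) {a Rmin Rmax CA Cb : ℝ} (ha : 0 < a) (hmin : 0 < Rmin)
    {ε : ℝ} (hε : 0 < ε) :
    ∃ C : ℝ, 0 ≤ C ∧ ∀ (r R : ℝ) (u U : Space d) (A : Matrix (Fin d) (Fin d) ℝ) (b : Fin d → ℝ),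
      0 ≤ r → Rmin ≤ R → R ≤ Rmax → a ≤ R ^ (γ - 1) → (∀ i j, |A i j| ≤ CA) → (∀ i, |b i| ≤ Cb) →
      -(r * (∑ i, ∑ j, A i j * ((u i - U i) * (u j - U j))))
        - A.trace * ((γ - 1) * relPot γ r R) - (r - R) / R * (∑ i, (u i - U i) * b i)
      ≤ C * relEnergy γ r u R U + ε * ‖u - U‖ ^ 2 := by
  set K : ℝ := d * |Cb| / Rmin + 1 with hK
  have hK0 : 0 < K := by positivity
  set c₁ : ℝ := d * d * |CA| with hc₁
  set c₂ : ℝ := d * |CA| * (γ - 1) with hc₂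
  set c₃ : ℝ := 1 / a + |Rmax| / (a * (ε / K)) with hc₃
  have hg : 0 < γ - 1 := by linarith
  have h1 : 0 ≤ c₁ := by positivity
  have h2 : 0 ≤ c₂ := by positivity
  have h3 : 0 ≤ c₃ := by positivity
  refine ⟨2 * (c₁ + K) + (c₂ + K * c₃), by positivity, ?_⟩
  intro r R u U A b hr hRmin hRmax haR hA hb
  have hR : 0 < R := hmin.trans_le hRmin
  have hP := relPot_nonneg hγ hr hR
  set W := ‖u - U‖ with hW
  have hW0 : 0 ≤ W := norm_nonneg _
  have hwi : ∀ i, |u i - U i| ≤ W := fun i => by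
    have := PiLp.norm_apply_le (u - U) i
    simpa using this
  have b1 : -(r * (∑ i, ∑ j, A i j * ((u i - U i) * (u j - U j)))) ≤ c₁ * (r * W ^ 2) := by
    have : |∑ i, ∑ j, A i j * ((u i - U i) * (u j - U j))| ≤ c₁ * W ^ 2 := by
      calc _ ≤ ∑ i : Fin d, ∑ j : Fin d, |CA| * W ^ 2 := by
            refine (Finset.abs_sum_le_sum_abs _ _).trans (Finset.sum_le_sum fun i _ =>
              (Finset.abs_sum_le_sum_abs _ _).trans (Finset.sum_le_sum fun j _ => ?_))
            rw [abs_mul, abs_mul, sq]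
            exact mul_le_mul ((hA i j).trans (le_abs_self _))
              (mul_le_mul (hwi i) (hwi j) (abs_nonneg _) hW0) (by positivity) (abs_nonneg _)
        _ = c₁ * W ^ 2 := by simp [hc₁]; ring
    have h4 := neg_le_of_abs_le this
    nlinarith
  have b2 : -(A.trace * ((γ - 1) * relPot γ r R)) ≤ c₂ * relPot γ r R := by
    have : |A.trace| ≤ d * |CA| := by
      calc |A.trace| ≤ ∑ i : Fin d, |CA| :=
            (Finset.abs_sum_le_sum_abs _ _).trans (Finset.sum_le_sum fun i _ =>
              (hA i i).trans (le_abs_self _))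
        _ = d * |CA| := by simp
    have h4 := neg_le_of_abs_le this
    have h5 : 0 ≤ (γ - 1) * relPot γ r R := mul_nonneg hg.le hP
    rw [hc₂]
    nlinarith
  have b3 : -((r - R) / R * (∑ i, (u i - U i) * b i)) ≤ K * (|r - R| * W) := by
    have h4 : |∑ i, (u i - U i) * b i| ≤ d * |Cb| * W := by
      calc _ ≤ ∑ i : Fin d, |Cb| * W := by
            refine (Finset.abs_sum_le_sum_abs _ _).trans (Finset.sum_le_sum fun i _ => ?_)
            rw [abs_mul, mul_comm]
            exact mul_le_mul ((hb i).trans (le_abs_self _)) (hwi i) (abs_nonneg _) (abs_nonneg _)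
        _ = d * |Cb| * W := by simp; ring
    have h5 : |r - R| / R ≤ |r - R| / Rmin := by gcongr
    calc _ ≤ |(r - R) / R * (∑ i, (u i - U i) * b i)| := neg_le_abs _
      _ ≤ |r - R| / Rmin * (d * |Cb| * W) := by
          rw [abs_mul, abs_div, abs_of_pos hR]
          exact mul_le_mul h5 h4 (abs_nonneg _) (by positivity)
      _ = d * |Cb| / Rmin * (|r - R| * W) := by ring
      _ ≤ K * (|r - R| * W) := by
          refine mul_le_mul_of_nonneg_right ?_ (by positivity)
          rw [hK]; linarith
  have b4 := abs_sub_mul_le (W := W) hγ hr hR ha haR (div_pos hε hK0)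
  have b5 : (1 / a + R / (a * (ε / K))) * relPot γ r R ≤ c₃ * relPot γ r R := by
    refine mul_le_mul_of_nonneg_right ?_ hP
    rw [hc₃]
    have : R ≤ |Rmax| := hRmax.trans (le_abs_self _)
    gcongr
  have b6 : K * (|r - R| * W) ≤ K * (c₃ * relPot γ r R + r * W ^ 2 + ε / K * W ^ 2) :=
    mul_le_mul_of_nonneg_left (by linarith) hK0.le
  have b7 : K * (ε / K * W ^ 2) = ε * W ^ 2 := by field_simp
  have hrW : 0 ≤ r * W ^ 2 := by positivity
  -- The factor `2` in the constant undoes the `1 / 2` in front of the kinetic part of `relEnergy`.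
  rw [relEnergy, ← hW]
  nlinarith [mul_nonneg h1 hP, mul_nonneg hK0.le hP, mul_nonneg h2 hrW,
    mul_nonneg (mul_nonneg hK0.le h3) hrW]

end Algebra

/-! ### The strong equations and the estimate on a time slice -/

section Strong

variable {d : ℕ} {Ω : Set (Space d)} {T : ℝ}

/-- The spatial gradient matrix read off from a space-time derivative. -/
noncomputable def velGrad (U' : ℝ × Space d → ℝ × Space d →L[ℝ] Space d) (z : ℝ × Space d) :
    Matrix (Fin d) (Fin d) ℝ :=
  Matrix.of fun i j => U' z (0, EuclideanSpace.single j 1) i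

/-- The components of `R (∂_t U + U · ∇U) + ∇R^γ`, which equals the viscous force `div 𝕊(∇U)` of the
strong solution. -/
noncomputable def inertialForce (γ : ℝ) (R : ℝ × Space d → ℝ)
    (R' : ℝ × Space d → ℝ × Space d →L[ℝ] ℝ) (U : ℝ × Space d → Space d)
    (U' : ℝ × Space d → ℝ × Space d →L[ℝ] Space d) (z : ℝ × Space d) (i : Fin d) : ℝ :=
  R z * U' z (1, 0) i + R z * (∑ j, velGrad U' z i j * U z j)
    + γ * R z ^ (γ - 1) * R' z (0, EuclideanSpace.single i 1)

/-- The density whose space-time integral bounds the relative energy. -/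
noncomputable def production (γ μ η : ℝ) (ρ : ℝ × Space d → ℝ) (u : ℝ × Space d → Space d)
    (G : ℝ × Space d → Matrix (Fin d) (Fin d) ℝ) (R : ℝ × Space d → ℝ)
    (R' : ℝ × Space d → ℝ × Space d →L[ℝ] ℝ) (U : ℝ × Space d → Space d)
    (U' : ℝ × Space d → ℝ × Space d →L[ℝ] Space d) (z : ℝ × Space d) : ℝ :=
  -contract (stress μ η (G z)) (G z)
    - (∑ i, (U' z (1, 0) i * (ρ z * u z i)
        + (∑ j, velGrad U' z i j * (ρ z * u z i * u z j)) + velGrad U' z i i * ρ z ^ γ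
        - ∑ j, velGrad U' z i j * stress μ η (G z) i j))
    + (((∑ i, U z i * U' z (1, 0) i) - γ * R z ^ (γ - 2) * R' z (1, 0)) * ρ z
        + ∑ j, ((∑ i, U z i * velGrad U' z i j)
            - γ * R z ^ (γ - 2) * R' z (0, EuclideanSpace.single j 1)) * (ρ z * u z j))
    + γ * R z ^ (γ - 1) * R' z (1, 0)

/-- The strong mass balance in terms of the derivatives of `R` and `U`. -/
lemma IsStrongSolution.mass_eq {γ μ η : ℝ} {ρ₀ : Space d → ℝ} {u₀ : Space d → Space d}
    {R : ℝ × Space d → ℝ} {U : ℝ × Space d → Space d}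
    (h : IsStrongSolution Ω T γ μ η ρ₀ u₀ R U)
    {R' : ℝ × Space d → ℝ × Space d →L[ℝ] ℝ} (hR : HasC1Ext R R' (stCylinder T Ω))
    {U' : ℝ × Space d → ℝ × Space d →L[ℝ] Space d} (hU : HasC1Ext U U' (stCylinder T Ω))
    {z : ℝ × Space d} (hz : z ∈ stCylinder T Ω) :
    R' z (1, 0) + ∑ j, (R' z (0, EuclideanSpace.single j 1) * U z j + R z * velGrad U' z j j)
      = 0 := by
  have h1 := h.mass z.1 hz.1 z.2 hz.2
  rw [(hasDerivAt_time (hR.hasFDerivAt z hz)).deriv] at h1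
  refine Eq.trans ?_ h1
  congr 1
  refine Finset.sum_congr rfl fun j _ => ?_
  have h2 := pd_space ((hR.hasFDerivAt z hz).mul ((hU.coord j).hasFDerivAt z hz)) j
  refine Eq.trans ?_ h2.symm
  simp [velGrad]
  ring

/-- The stress of a field that is `C²` up to the boundary is `C¹` up to the boundary. -/
lemma exists_hasC1Ext_stress (hΩ : IsOpen Ω) (μ η : ℝ) {v : Space d → Space d}
    {v' : Space d → Space d →L[ℝ] Space d} (hv : ContDiffUpTo 2 v Ω) (hv' : HasC1Ext v v' Ω)
    (i j : Fin d) :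
    ∃ σ', HasC1Ext (fun x => stress μ η
      (Matrix.of fun i j => v' x (EuclideanSpace.single j 1) i) i j) σ' Ω := by
  -- the entry `(i, j)` of the stress as a linear functional of the gradient
  let L₀ : (Space d →L[ℝ] Space d) →ₗ[ℝ] ℝ :=
    { toFun := fun M => stress μ η (Matrix.of fun i j => M (EuclideanSpace.single j 1) i) i j
      map_add' := fun M N => by
        simp only [stress, Matrix.add_apply, Matrix.smul_apply, Matrix.sub_apply,
          Matrix.transpose_apply, smul_eq_mul, Matrix.trace, Matrix.diag, Matrix.of_apply,
          add_apply, PiLp.add_apply, Finset.sum_add_distrib]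
        ring
      map_smul' := fun c M => by
        simp only [stress, Matrix.add_apply, Matrix.smul_apply, Matrix.sub_apply,
          Matrix.transpose_apply, smul_eq_mul, Matrix.trace, Matrix.diag, Matrix.of_apply,
          smul_apply, PiLp.smul_apply, ← Finset.mul_sum, RingHom.id_apply]
        ring }
  obtain ⟨g, hg, hge⟩ := hv.2.2 2 le_rfl
  have hc2 : ContDiffOn ℝ 1 (fderiv ℝ v) Ω := hv.2.1.fderiv_of_isOpen hΩ (by norm_num)
  have hv'' : HasC1Ext v' (fun x => ((continuousMultilinearCurryFin1 ℝ (Space d)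
      (Space d)).toContinuousLinearEquiv : _ →L[ℝ] _).comp
      (continuousMultilinearCurryLeftEquiv ℝ (fun _ : Fin 2 => Space d) (Space d) (g x))) Ω := by
    refine ⟨hv'.continuousOn_deriv, continuousOn_const.clm_comp
      ((continuousMultilinearCurryLeftEquiv ℝ (fun _ : Fin 2 => Space d)
        (Space d)).continuous.comp_continuousOn hg), fun x hx => ?_⟩
    have h1 : HasFDerivAt (fderiv ℝ v) (fderiv ℝ (fderiv ℝ v) x) x :=
      ((hc2.differentiableOn one_ne_zero) x hx).differentiableAt (hΩ.mem_nhds hx) |>.hasFDerivAt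
    have h2 : v' =ᶠ[𝓝 x] fderiv ℝ v :=
      eventuallyEq_of_mem (hΩ.mem_nhds hx) fun y hy => ((hv'.hasFDerivAt y hy).fderiv).symm
    refine (h1.congr_of_eventuallyEq h2).congr_fderiv ?_
    ext y w : 2
    have h3 : g x ![y, w] = fderiv ℝ (fderiv ℝ v) x y w := by
      rw [hge hx, iteratedFDeriv_two_apply]; rfl
    rw [← h3]
    change _ = g x _
    congr 1
    ext k
    fin_cases k <;> rfl
  exact ⟨_, hv''.clm_comp (LinearMap.toContinuousLinearMap L₀)⟩

/-- The strong momentum balance, with the mass balance inserted: `div 𝕊(∇U)` is the inertial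
force. -/
lemma IsStrongSolution.sum_deriv_stress_eq {γ μ η : ℝ} {ρ₀ : Space d → ℝ} {u₀ : Space d → Space d}
    {R : ℝ × Space d → ℝ} {U : ℝ × Space d → Space d} (hΩ : IsOpen Ω)
    (h : IsStrongSolution Ω T γ μ η ρ₀ u₀ R U)
    {R' : ℝ × Space d → ℝ × Space d →L[ℝ] ℝ} (hR : HasC1Ext R R' (stCylinder T Ω))
    {U' : ℝ × Space d → ℝ × Space d →L[ℝ] Space d} (hU : HasC1Ext U U' (stCylinder T Ω))
    {t : ℝ} (ht : t ∈ Ioo 0 T) {i : Fin d} {σ' : Fin d → Space d → Space d →L[ℝ] ℝ}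
    (hσ : ∀ j, HasC1Ext (fun x => stress μ η (velGrad U' (t, x)) i j) (σ' j) Ω)
    {x : Space d} (hx : x ∈ Ω) :
    ∑ j, σ' j x (EuclideanSpace.single j 1) = inertialForce γ R R' U U' (t, x) i := by
  have hz : (t, x) ∈ stCylinder T Ω := ⟨ht, hx⟩
  have hRpos : 0 < R (t, x) :=
    h.density_pos t (Ioo_subset_Icc_self ht) x (subset_closure hx)
  have hm := h.mass_eq hR hU hz
  have dR := hR.hasFDerivAt _ hz
  have dU := fun k => (hU.coord k).hasFDerivAt _ hz
  have e1 : deriv (fun s => R (s, x) * U (s, x) i) t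
      = R (t, x) * U' (t, x) (1, 0) i + R' (t, x) (1, 0) * U (t, x) i := by
    refine (hasDerivAt_time (dR.mul (dU i))).deriv.trans ?_
    simp; ring
  have e2 : ∀ j, pd j (fun y => R (t, y) * U (t, y) i * U (t, y) j) x
      = R (t, x) * (velGrad U' (t, x) i j * U (t, x) j) + U (t, x) i *
        (R' (t, x) (0, EuclideanSpace.single j 1) * U (t, x) j
          + R (t, x) * velGrad U' (t, x) j j) := by
    intro j
    refine (pd_space ((dR.mul (dU i)).mul (dU j)) j).trans ?_
    simp [velGrad]; ring
  have e3 : pd i (fun y => R (t, y) ^ γ) x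
      = γ * R (t, x) ^ (γ - 1) * R' (t, x) (0, EuclideanSpace.single i 1) := by
    refine (pd_space (dR.rpow_const (Or.inl hRpos.ne')) i).trans ?_
    simp
  have e4 : ∀ j, pd j (fun y => stress μ η (grad (fun y' => U (t, y')) y) i j) x
      = σ' j x (EuclideanSpace.single j 1) := by
    intro j
    have : (fun y => stress μ η (grad (fun y' => U (t, y')) y) i j)
        =ᶠ[𝓝 x] fun y => stress μ η (velGrad U' (t, y)) i j := by
      refine eventuallyEq_of_mem (hΩ.mem_nhds hx) fun y hy => ?_
      have hg : grad (fun y' => U (t, y')) y = velGrad U' (t, y) := by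
        ext k l
        exact pd_space (z := (t, y)) ((hU.coord k).hasFDerivAt (t, y) ⟨ht, hy⟩) l
      simp only [hg]
    rw [pd, this.fderiv_eq, ((hσ j).hasFDerivAt x hx).fderiv]
  have hmom := h.momentum t ht x hx i
  rw [e1, e3] at hmom
  simp only [e2, e4, Finset.sum_add_distrib, ← Finset.mul_sum] at hmom
  rw [Finset.sum_add_distrib, ← Finset.mul_sum] at hm
  rw [← hmom, inertialForce]
  linear_combination U (t, x) i * hm

lemma memLp_stress {α : Type*} [MeasurableSpace α] {ν : Measure α} (μ η : ℝ)
    {A : α → Matrix (Fin d) (Fin d) ℝ} (hA : ∀ i j, MemLp (fun x => A x i j) 2 ν) (i j : Fin d) :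
    MemLp (fun x => stress μ η (A x) i j) 2 ν := by
  have htr : MemLp (fun x => (A x).trace) 2 ν := by
    simp only [Matrix.trace, Matrix.diag]
    exact memLp_finsetSum _ fun k _ => hA k k
  have e : (fun x => stress μ η (A x) i j) = fun x => μ * A x i j + μ * A x j i
      + ((η - 2 / 3 * μ) * (1 : Matrix (Fin d) (Fin d) ℝ) i j) * (A x).trace := by
    funext x
    simp only [stress, Matrix.add_apply, Matrix.smul_apply, Matrix.sub_apply,
      Matrix.transpose_apply, smul_eq_mul]
    ring
  rw [e]
  exact (((hA i j).const_mul μ).add ((hA j i).const_mul μ)).add (htr.const_mul _)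

lemma integrable_contract_stress {α : Type*} [MeasurableSpace α] {ν : Measure α} (μ η : ℝ)
    {A : α → Matrix (Fin d) (Fin d) ℝ} (hA : ∀ i j, MemLp (fun x => A x i j) 2 ν) :
    Integrable (fun x => contract (stress μ η (A x)) (A x)) ν :=
  integrable_finsetSum _ fun i _ => integrable_finsetSum _ fun j _ =>
    (memLp_stress μ η hA i j).integrable_mul (hA i j)

/-- The total derivative `∂_j (w_i σ)` is integrable and has integral zero. -/
lemma IsH10C2.integrable_and_integral_eq_zero {w : Space d → Space d}
    {A : Space d → Matrix (Fin d) (Fin d) ℝ} (hΩ : IsOpen Ω) (hb : Bornology.IsBounded Ω)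
    (h : IsH10C2 Ω w A) {σ : Space d → ℝ} {σ' : Space d → Space d →L[ℝ] ℝ}
    (hσ : HasC1Ext σ σ' Ω) (i j : Fin d) :
    IntegrableOn (fun x => w x i * σ' x (EuclideanSpace.single j 1) + A x i j * σ x) Ω ∧
      ∫ x in Ω, (w x i * σ' x (EuclideanSpace.single j 1) + A x i j * σ x) = 0 := by
  have := isFiniteMeasure_restrict hb
  have i1 : IntegrableOn (fun x => w x i * σ' x (EuclideanSpace.single j 1)) Ω := by
    simp only [mul_comm (w _ i)]
    exact integrableOn_mul_of_continuousOn_closure hΩ hb.isCompact_closure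
      (hσ.continuousOn_deriv.clm_apply continuousOn_const) ((h.memLp i).integrable one_le_two)
  have i2 : IntegrableOn (fun x => A x i j * σ x) Ω := by
    simp only [mul_comm (A _ i j)]
    exact integrableOn_mul_of_continuousOn_closure hΩ hb.isCompact_closure
      hσ.continuousOn ((h.memLp_grad i j).integrable one_le_two)
  refine ⟨i1.add i2, ?_⟩
  rw [integral_add i1 i2, h.integral_mul_deriv hΩ hb hσ i j]
  simp

/-- On almost every time slice the production of relative energy is bounded by the relative energy:
the dissipation of the velocity difference absorbs, by the inequalities of Korn and Poincaré, the part
of the error that the relative energy does not control. -/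
lemma integral_production_le {γ μ η : ℝ} (hγ : 1 < γ) (hμ : 0 < μ) (hη : 0 ≤ η)
    {ρ₀ : Space d → ℝ} {u₀ : Space d → Space d} {ρ : ℝ × Space d → ℝ} {u : ℝ × Space d → Space d}
    {G : ℝ × Space d → Matrix (Fin d) (Fin d) ℝ}
    {R : ℝ × Space d → ℝ} {U : ℝ × Space d → Space d} (hΩ : IsOpen Ω)
    (hb : Bornology.IsBounded Ω) (hT : 0 < T)
    (h : IsStrongSolution Ω T γ μ η ρ₀ u₀ R U)
    {R' : ℝ × Space d → ℝ × Space d →L[ℝ] ℝ} (hR : HasC1Ext R R' (stCylinder T Ω))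
    {U' : ℝ × Space d → ℝ × Space d →L[ℝ] Space d} (hU : HasC1Ext U U' (stCylinder T Ω))
    {t : ℝ} (ht : t ∈ Ioo 0 T)
    (hu : IsH10 Ω (fun x => u (t, x)) (fun x => G (t, x)))
    (hρ : ∀ᵐ x ∂(volume.restrict Ω), 0 ≤ ρ (t, x))
    (hIe : IntegrableOn (fun x => relEnergy γ (ρ (t, x)) (u (t, x)) (R (t, x)) (U (t, x))) Ω)
    (hIp : IntegrableOn (fun x => production γ μ η ρ u G R R' U U' (t, x)) Ω)
    {C M : ℝ} (hM : ∀ x ∈ Ω, ‖x‖ ≤ M) {ε : ℝ} (hε : 0 ≤ ε) (hεM : ε * (4 * M ^ 2) ≤ μ)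
    (hC : ∀ x ∈ Ω, 0 ≤ ρ (t, x) →
      -(ρ (t, x) * (∑ i, ∑ j, velGrad U' (t, x) i j
          * ((u (t, x) i - U (t, x) i) * (u (t, x) j - U (t, x) j))))
        - (velGrad U' (t, x)).trace * ((γ - 1) * relPot γ (ρ (t, x)) (R (t, x)))
        - (ρ (t, x) - R (t, x)) / R (t, x)
          * (∑ i, (u (t, x) i - U (t, x) i) * inertialForce γ R R' U U' (t, x) i)
      ≤ C * relEnergy γ (ρ (t, x)) (u (t, x)) (R (t, x)) (U (t, x))
        + ε * ‖u (t, x) - U (t, x)‖ ^ 2) :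
    ∫ x in Ω, production γ μ η ρ u G R R' U U' (t, x)
      ≤ C * ∫ x in Ω, relEnergy γ (ρ (t, x)) (u (t, x)) (R (t, x)) (U (t, x)) := by
  have htI := Ioo_subset_Icc_self ht
  have hUt := hU.slice hT ht
  have hUH : IsH10C2 Ω (fun x => U (t, x)) (fun x => velGrad U' (t, x)) :=
    isH10C2_of_eq_zero_frontier hΩ hb (h.velocity_C1C2.1 t htI).2.1 hUt (h.no_slip t htI)
  have hw := hu.isH10C2.sub hUH
  choose σ' hσ using fun i j => exists_hasC1Ext_stress hΩ μ η (h.velocity_C1C2.1 t htI) hUt i j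
  have hσ : ∀ i j, HasC1Ext (fun x => stress μ η (velGrad U' (t, x)) i j) (σ' i j) Ω := hσ
  have hRt := hR.slice hT ht
  have hP : HasC1Ext (fun x => R (t, x) ^ γ) (fun x => (γ * R (t, x) ^ (γ - 1)) •
      (R' (t, x)).comp (ContinuousLinearMap.inr ℝ ℝ (Space d))) Ω :=
    hRt.comp_deriv (g := fun s => s ^ γ) (g' := fun s => γ * s ^ (γ - 1)) (s := Ioi 0)
      (fun x hx => h.density_pos t htI x hx)
      (continuousOn_const.mul (continuousOn_id.rpow_const fun s hs => Or.inl (ne_of_gt hs)))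
      (fun s hs => Real.hasDerivAt_rpow_const (Or.inl (ne_of_gt hs)))
  -- The bracket of `relEnergy_production_eq`, grouped into pairs that cancel by parts: `w` against the
  -- stress of `U`, and `U` against `R ^ γ`.
  set J : Space d → ℝ := fun x =>
    (∑ i, ∑ j, ((u (t, x) - U (t, x)) i * σ' i j x (EuclideanSpace.single j 1)
      + (G (t, x) - velGrad U' (t, x)) i j * stress μ η (velGrad U' (t, x)) i j))
    + ∑ j, (U (t, x) j * ((γ * R (t, x) ^ (γ - 1)) •
        (R' (t, x)).comp (ContinuousLinearMap.inr ℝ ℝ (Space d))) (EuclideanSpace.single j 1)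
      + velGrad U' (t, x) j j * R (t, x) ^ γ) with hJ
  have j1 := fun i j => hw.integrable_and_integral_eq_zero hΩ hb (hσ i j) i j
  have j2 := fun j => hUH.integrable_and_integral_eq_zero hΩ hb hP j j
  have hJi1 : IntegrableOn (fun x => ∑ i, ∑ j, ((u (t, x) - U (t, x)) i
      * σ' i j x (EuclideanSpace.single j 1)
      + (G (t, x) - velGrad U' (t, x)) i j * stress μ η (velGrad U' (t, x)) i j)) Ω :=
    integrable_finsetSum _ fun i _ => integrable_finsetSum _ fun j _ => (j1 i j).1
  have hJi2 := integrable_finsetSum (μ := volume.restrict Ω) Finset.univ fun j _ => (j2 j).1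
  have hJi : IntegrableOn J Ω := hJi1.add hJi2
  have hJ0 : ∫ x in Ω, J x = 0 := by
    rw [hJ, integral_add hJi1 hJi2, integral_finsetSum _ fun j _ => (j2 j).1,
      integral_finsetSum _ fun i _ => integrable_finsetSum _ fun j _ => (j1 i j).1]
    simp only [integral_finsetSum _ fun j _ => (j1 _ j).1, (j1 _ _).2, (j2 _).2]
    simp
  set D : Space d → ℝ := fun x => contract (stress μ η (G (t, x) - velGrad U' (t, x)))
    (G (t, x) - velGrad U' (t, x)) with hD
  have hBm := hw.memLp_grad
  have hDi : IntegrableOn D Ω := integrable_contract_stress μ η hBm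
  have hKorn := hw.le_integral_stress hμ hη
  have hsq : ∀ i, Integrable (fun x => (u (t, x) - U (t, x)) i ^ 2) (volume.restrict Ω) := fun i =>
    (hw.memLp i).integrable_sq
  have hwi : IntegrableOn (fun x => ‖u (t, x) - U (t, x)‖ ^ 2) Ω := by
    simp only [EuclideanSpace.real_norm_sq_eq]
    exact integrable_finsetSum _ fun i _ => hsq i
  have hPoin : ε * ∫ x in Ω, ‖u (t, x) - U (t, x)‖ ^ 2
      ≤ μ * ∑ i, ∑ j, ∫ x in Ω, (G (t, x) - velGrad U' (t, x)) i j ^ 2 := by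
    simp only [EuclideanSpace.real_norm_sq_eq]
    rw [integral_finsetSum _ fun i _ => hsq i]
    have hnn : ∀ i j, 0 ≤ ∫ x in Ω, (G (t, x) - velGrad U' (t, x)) i j ^ 2 := fun i j =>
      integral_nonneg fun x => sq_nonneg _
    have h1 : ∑ i, ∫ x in Ω, (u (t, x) - U (t, x)) i ^ 2
        ≤ 4 * M ^ 2 * ∑ i, ∑ j, ∫ x in Ω, (G (t, x) - velGrad U' (t, x)) i j ^ 2 := by
      rw [Finset.mul_sum]
      refine Finset.sum_le_sum fun i _ => (hw.integral_sq_le hM i).trans ?_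
      exact mul_le_mul_of_nonneg_left
        (Finset.single_le_sum (f := fun j => ∫ x in Ω, (G (t, x) - velGrad U' (t, x)) i j ^ 2)
          (fun j _ => hnn i j) (Finset.mem_univ i)) (by positivity)
    have h2 : 0 ≤ ∑ i, ∑ j, ∫ x in Ω, (G (t, x) - velGrad U' (t, x)) i j ^ 2 :=
      Finset.sum_nonneg fun i _ => Finset.sum_nonneg fun j _ => hnn i j
    calc _ ≤ ε * (4 * M ^ 2 * ∑ i, ∑ j, ∫ x in Ω, (G (t, x) - velGrad U' (t, x)) i j ^ 2) :=
          mul_le_mul_of_nonneg_left h1 hε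
      _ = ε * (4 * M ^ 2) * ∑ i, ∑ j, ∫ x in Ω, (G (t, x) - velGrad U' (t, x)) i j ^ 2 := by ring
      _ ≤ _ := mul_le_mul_of_nonneg_right hεM h2
  have hDn : Integrable (fun x => -D x) (volume.restrict Ω) := hDi.neg
  have hi1 : Integrable (fun x => -D x - J x) (volume.restrict Ω) := hDn.sub hJi
  have hi2 : Integrable (fun x => C * relEnergy γ (ρ (t, x)) (u (t, x)) (R (t, x)) (U (t, x))
      + ε * ‖u (t, x) - U (t, x)‖ ^ 2) (volume.restrict Ω) := (hIe.const_mul C).add (hwi.const_mul ε)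
  have hle : ∫ x in Ω, production γ μ η ρ u G R R' U U' (t, x)
      ≤ ∫ x in Ω, ((-D x - J x)
        + (C * relEnergy γ (ρ (t, x)) (u (t, x)) (R (t, x)) (U (t, x))
          + ε * ‖u (t, x) - U (t, x)‖ ^ 2)) := by
    refine integral_mono_ae hIp (hi1.add hi2) ?_
    filter_upwards [hρ, ae_restrict_mem hΩ.measurableSet] with x hx hxΩ
    have hz : (t, x) ∈ stCylinder T Ω := ⟨ht, hxΩ⟩
    have hRpos : 0 < R (t, x) := h.density_pos t htI x (subset_closure hxΩ)
    have hq : R (t, x) ^ (γ - 1) = R (t, x) ^ (γ - 2) * R (t, x) := by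
      rw [← Real.rpow_add_one hRpos.ne']; congr 1; ring
    have hq' : R (t, x) ^ γ = R (t, x) ^ (γ - 1) * R (t, x) := by
      rw [← Real.rpow_add_one hRpos.ne']; congr 1; ring
    have key := relEnergy_production_eq (γ := γ) (μ := μ) (η := η) (r := ρ (t, x))
      (p := ρ (t, x) ^ γ) (u := fun i => u (t, x) i) (G := G (t, x)) (Ut := fun i => U' (t, x) (1, 0) i)
      (U := fun i => U (t, x) i) (b := inertialForce γ R R' U U' (t, x)) hRpos.ne' hq
      (h.mass_eq hR hU hz) (fun i => rfl)
    have hbx : ∀ i, ∑ j, σ' i j x (EuclideanSpace.single j 1)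
        = inertialForce γ R R' U U' (t, x) i := fun i =>
      h.sum_deriv_stress_eq hΩ hR hU ht (hσ i) hxΩ
    have hJx : J x = (∑ i, (u (t, x) i - U (t, x) i) * inertialForce γ R R' U U' (t, x) i)
        + contract (stress μ η (velGrad U' (t, x))) (G (t, x) - velGrad U' (t, x))
        + ∑ j, (U (t, x) j * (γ * R (t, x) ^ (γ - 1) * R' (t, x) (0, EuclideanSpace.single j 1))
          + velGrad U' (t, x) j j * (R (t, x) ^ (γ - 1) * R (t, x))) := by
      simp only [hJ, Finset.sum_add_distrib, ← Finset.mul_sum, hbx, hq']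
      congr 2
      simp only [contract]
      exact Finset.sum_congr rfl fun i _ => Finset.sum_congr rfl fun j _ =>
        mul_comm _ (stress μ η (velGrad U' (t, x)) i j)
    have hpot : (γ - 1) * relPot γ (ρ (t, x)) (R (t, x)) = ρ (t, x) ^ γ
        - R (t, x) ^ (γ - 1) * R (t, x) - γ * R (t, x) ^ (γ - 1) * (ρ (t, x) - R (t, x)) := by
      have hg : γ - 1 ≠ 0 := by linarith
      rw [relPot, hq']
      field_simp
    have herr := hC x hxΩ hx
    rw [hpot] at herr
    have : production γ μ η ρ u G R R' U U' (t, x) = _ := key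
    rw [this, ← hJx]
    simp only [hD]
    linarith
  rw [integral_add hi1 hi2, integral_sub hDn hJi, hJ0, integral_add (hIe.const_mul C)
    (hwi.const_mul ε), integral_const_mul, integral_const_mul] at hle
  have : ∫ x in Ω, -D x = -∫ x in Ω, D x := integral_neg _
  have hDdef : ∫ x in Ω, D x = ∫ x in Ω, contract (stress μ η (G (t, x) - velGrad U' (t, x)))
    (G (t, x) - velGrad U' (t, x)) := rfl
  linarith

end Strong

/-! ### The relative energy inequality -/

section RelativeEnergy

variable {d : ℕ} {Ω : Set (Space d)} {T : ℝ}

lemma hasC1Ext_massMultiplier {γ : ℝ} (hγ : 1 < γ) {R : ℝ × Space d → ℝ}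
    {U : ℝ × Space d → Space d} {S : Set (ℝ × Space d)} (hRpos : ∀ z ∈ closure S, 0 < R z)
    {R' : ℝ × Space d → ℝ × Space d →L[ℝ] ℝ} (hR : HasC1Ext R R' S)
    {U' : ℝ × Space d → ℝ × Space d →L[ℝ] Space d} (hU : HasC1Ext U U' S)
    (hS : IsOpen S) :
    HasC1Ext (fun z => massMultiplier γ (R z) (U z))
      (fun z => (∑ i, U z i • (EuclideanSpace.proj (𝕜 := ℝ) i).comp (U' z))
        + (-(γ * R z ^ (γ - 2))) • R' z) S := by
  have hg : γ - 1 ≠ 0 := by linarith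
  have h1 : HasC1Ext (fun z => ∑ i, 1 / 2 * U z i ^ 2)
      (fun z => ∑ i, U z i • (EuclideanSpace.proj (𝕜 := ℝ) i).comp (U' z)) S :=
    HasC1Ext.sum _ fun i _ => (hU.coord i).comp_deriv (g := fun s => 1 / 2 * s ^ 2)
      (g' := fun s => s) (s := univ) (fun _ _ => mem_univ _) continuousOn_id fun y _ => by
        simpa using (hasDerivAt_pow 2 y).const_mul (1 / 2 : ℝ)
  have h2 := hR.comp_deriv (g := fun s => -(γ / (γ - 1) * s ^ (γ - 1)))
    (g' := fun s => -(γ * s ^ (γ - 2))) (s := Ioi 0) hRpos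
    (continuousOn_const.mul (continuousOn_id.rpow_const fun s hs => Or.inl (ne_of_gt hs))).neg
    (fun s hs => by
      refine (((Real.hasDerivAt_rpow_const (p := γ - 1) (Or.inl (ne_of_gt hs))).const_mul
        (γ / (γ - 1))).neg).congr_deriv ?_
      have : γ - 1 - 1 = γ - 2 := by ring
      rw [this]
      field_simp)
  refine (h1.add h2).congr hS fun z _ => ?_
  simp only [massMultiplier, Finset.mul_sum]
  ring

/-- The integrability properties of a weak solution that give sense to the weak formulation. -/
lemma integrableOn_of_weak {γ : ℝ} (hγ : 1 < γ) (hb : Bornology.IsBounded Ω)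
    {ρ : ℝ × Space d → ℝ} {u : ℝ × Space d → Space d}
    (h0 : ∀ᵐ z ∂(volume.restrict (stCylinder T Ω)), 0 ≤ ρ z)
    (hρ : MemLp ρ (ENNReal.ofReal γ) (volume.restrict (stCylinder T Ω)))
    (hE : Integrable (fun z => ρ z * ‖u z‖ ^ 2) (volume.restrict (stCylinder T Ω)))
    (hu : AEStronglyMeasurable u (volume.restrict (stCylinder T Ω))) :
    IntegrableOn ρ (stCylinder T Ω) ∧ IntegrableOn (fun z => ρ z ^ γ) (stCylinder T Ω) ∧
      (∀ i, IntegrableOn (fun z => ρ z * u z i) (stCylinder T Ω)) ∧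
      ∀ i j, IntegrableOn (fun z => ρ z * u z i * u z j) (stCylinder T Ω) := by
  have hfin := isFiniteMeasure_restrict_stCylinder (T := T) hb
  have hρ1 : IntegrableOn ρ (stCylinder T Ω) :=
    hρ.integrable (by rw [← ENNReal.ofReal_one]; exact ENNReal.ofReal_le_ofReal hγ.le)
  have hui : ∀ i, AEStronglyMeasurable (fun z => u z i) (volume.restrict (stCylinder T Ω)) :=
    fun i => (EuclideanSpace.proj (𝕜 := ℝ) i).continuous.comp_aestronglyMeasurable hu
  have hle : ∀ z i, |u z i| ≤ ‖u z‖ := fun z i => by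
    simpa using PiLp.norm_apply_le (u z) i
  refine ⟨hρ1, ?_, fun i => ?_, fun i j => ?_⟩
  · have := hρ.integrable_norm_rpow (by simp; linarith) ENNReal.ofReal_ne_top
    rw [ENNReal.toReal_ofReal (by linarith)] at this
    refine this.congr ?_
    filter_upwards [h0] with z hz
    rw [Real.norm_of_nonneg hz]
  · refine (hρ1.norm.add hE.norm).mono (hρ1.aestronglyMeasurable.mul (hui i))
      (Eventually.of_forall fun z => ?_)
    have h1 := hle z i
    have h2 : |u z i| ≤ 1 + ‖u z‖ ^ 2 := by nlinarith [sq_nonneg (‖u z‖ - 1)]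
    simp only [Pi.add_apply, norm_mul, Real.norm_eq_abs, norm_pow, abs_norm]
    refine le_trans ?_ (le_abs_self _)
    nlinarith [abs_nonneg (ρ z)]
  · refine hE.mono ((hρ1.aestronglyMeasurable.mul (hui i)).mul (hui j))
      (Eventually.of_forall fun z => ?_)
    simp only [norm_mul, Real.norm_eq_abs, abs_norm, mul_assoc, sq]
    exact mul_le_mul_of_nonneg_left (mul_le_mul (hle z i) (hle z j) (abs_nonneg _) (norm_nonneg _))
      (abs_nonneg _)

lemma integral_sub_add_add {α : Type*} [MeasurableSpace α] {ν : Measure α} {f g p q : α → ℝ}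
    (hf : Integrable f ν) (hg : Integrable g ν) (hp : Integrable p ν) (hq : Integrable q ν) :
    ∫ x, (f x - g x + p x + q x) ∂ν
      = (∫ x, f x ∂ν) - (∫ x, g x ∂ν) + (∫ x, p x ∂ν) + ∫ x, q x ∂ν := by
  have h1 : Integrable (fun x => f x - g x) ν := hf.sub hg
  have h2 : Integrable (fun x => f x - g x + p x) ν := h1.add hp
  rw [integral_add h2 hq, integral_add h1 hp, integral_sub hf hg]

/-- The relative energy inequality. It is the sum of the energy inequality, of the momentum balance
tested with `U`, of the mass balance tested with `massMultiplier` and of the balance of `∫ R ^ γ`; the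
initial terms cancel because both solutions start from the same data. -/
lemma relEnergy_inequality {γ μ η : ℝ} (hγ : 1 < γ)
    {ρ₀ : Space d → ℝ} {u₀ : Space d → Space d} {ρ : ℝ × Space d → ℝ} {u : ℝ × Space d → Space d}
    {G : ℝ × Space d → Matrix (Fin d) (Fin d) ℝ}
    {R : ℝ × Space d → ℝ} {U : ℝ × Space d → Space d} (hΩ : IsOpen Ω)
    (hb : Bornology.IsBounded Ω) (hT : 0 < T)
    (h0 : ∀ᵐ z ∂(volume.restrict (stCylinder T Ω)), 0 ≤ ρ z)
    (hρ : MemLp ρ (ENNReal.ofReal γ) (volume.restrict (stCylinder T Ω)))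
    (hE : Integrable (fun z => ρ z * ‖u z‖ ^ 2) (volume.restrict (stCylinder T Ω)))
    (hu : IsL2H10 Ω T u G) (hmass : WeakMass Ω T ρ₀ ρ u)
    (hmom : WeakMomentum Ω T γ μ η ρ₀ u₀ ρ u G)
    (hen : ∀ᵐ τ ∂(volume.restrict (Ioo 0 T)),
      energy Ω γ (fun x => ρ (τ, x)) (fun x => u (τ, x))
        + (∫ z in stCylinder τ Ω, contract (stress μ η (G z)) (G z)) ≤ energy Ω γ ρ₀ u₀)
    (h : IsStrongSolution Ω T γ μ η ρ₀ u₀ R U)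
    {R' : ℝ × Space d → ℝ × Space d →L[ℝ] ℝ} (hR : HasC1Ext R R' (stCylinder T Ω))
    {U' : ℝ × Space d → ℝ × Space d →L[ℝ] Space d} (hU : HasC1Ext U U' (stCylinder T Ω)) :
    IntegrableOn (fun z => relEnergy γ (ρ z) (u z) (R z) (U z)) (stCylinder T Ω) ∧
    IntegrableOn (production γ μ η ρ u G R R' U U') (stCylinder T Ω) ∧
    ∀ᵐ τ ∂(volume.restrict (Ioo 0 T)),
      ∫ x in Ω, relEnergy γ (ρ (τ, x)) (u (τ, x)) (R (τ, x)) (U (τ, x))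
        ≤ ∫ z in stCylinder τ Ω, production γ μ η ρ u G R R' U U' z := by
  have hop := isOpen_stCylinder (T := T) hΩ
  have hcl := closure_stCylinder hT Ω
  have hcomp := isCompact_closure_stCylinder hb hT
  have hfin := isFiniteMeasure_restrict_stCylinder (T := T) hb
  have hfinΩ := isFiniteMeasure_restrict hb
  have hRpos : ∀ z ∈ closure (stCylinder T Ω), 0 < R z := fun z hz => by
    rw [hcl] at hz
    exact h.density_pos z.1 hz.1 z.2 hz.2
  have hψ := hasC1Ext_massMultiplier hγ hRpos hR hU hop
  have hP : HasC1Ext (fun z => R z ^ γ) (fun z => (γ * R z ^ (γ - 1)) • R' z) (stCylinder T Ω) :=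
    hR.comp_deriv (g := fun s => s ^ γ) (g' := fun s => γ * s ^ (γ - 1)) (s := Ioi 0) hRpos
      (continuousOn_const.mul (continuousOn_id.rpow_const fun s hs => Or.inl (ne_of_gt hs)))
      (fun s hs => Real.hasDerivAt_rpow_const (Or.inl (ne_of_gt hs)))
  obtain ⟨Iρ, Ip, Iu, Iuu⟩ := integrableOn_of_weak hγ hb h0 hρ hE hu.memLp.1
  have IS : ∀ i j, IntegrableOn (fun z => stress μ η (G z) i j) (stCylinder T Ω) := fun i j =>
    (memLp_stress μ η hu.memLp_grad i j).integrable one_le_two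
  have ISG := integrable_contract_stress μ η hu.memLp_grad
  have hmulc : ∀ {f g : ℝ × Space d → ℝ}, ContinuousOn f (closure (stCylinder T Ω)) →
      IntegrableOn g (stCylinder T Ω) → IntegrableOn (fun z => f z * g z) (stCylinder T Ω) :=
    fun hf hg => integrableOn_mul_of_continuousOn_closure hop hcomp hf hg
  have hcont : ∀ {f : ℝ × Space d → ℝ}, ContinuousOn f (closure (stCylinder T Ω)) →
      IntegrableOn f (stCylinder T Ω) := fun hf =>
    (hf.integrableOn_compact hcomp).mono_set subset_closure
  have cU : ∀ i, ContinuousOn (fun z => U z i) (closure (stCylinder T Ω)) := fun i =>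
    (hU.coord i).continuousOn
  have cU' : ∀ v i, ContinuousOn (fun z => U' z v i) (closure (stCylinder T Ω)) := fun v i =>
    (hU.coord i).continuousOn_deriv.clm_apply continuousOn_const
  have cψ' : ∀ v, ContinuousOn (fun z => ((∑ i, U z i • (EuclideanSpace.proj (𝕜 := ℝ) i).comp (U' z))
        + (-(γ * R z ^ (γ - 2))) • R' z) v) (closure (stCylinder T Ω)) := fun v =>
    hψ.continuousOn_deriv.clm_apply continuousOn_const
  have cP' : ContinuousOn (fun z => ((γ * R z ^ (γ - 1)) • R' z) (1, 0))
      (closure (stCylinder T Ω)) := hP.continuousOn_deriv.clm_apply continuousOn_const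
  have hae : ∀ᵐ z ∂(volume.restrict (stCylinder T Ω)), z ∈ stCylinder T Ω :=
    ae_restrict_mem hop.measurableSet
  -- By `relEnergy_eq` the relative energy density is `k - a + m + q`, with one term for each balance;
  -- `pm`, `pc` and `pq` below are the space-time integrands of the last three balances.
  set k : ℝ × Space d → ℝ := fun z => 1 / 2 * (ρ z * ‖u z‖ ^ 2) + 1 / (γ - 1) * ρ z ^ γ with hk
  set a : ℝ × Space d → ℝ := fun z => ∑ i, U z i * (ρ z * u z i) with ha
  set m : ℝ × Space d → ℝ := fun z => massMultiplier γ (R z) (U z) * ρ z with hm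
  set q : ℝ × Space d → ℝ := fun z => R z ^ γ with hq
  have Ik : IntegrableOn k (stCylinder T Ω) := (hE.const_mul _).add (Ip.const_mul _)
  have Ia : IntegrableOn a (stCylinder T Ω) :=
    integrable_finsetSum _ fun i _ => hmulc (cU i) (Iu i)
  have Im : IntegrableOn m (stCylinder T Ω) := hmulc hψ.continuousOn Iρ
  have Iq : IntegrableOn q (stCylinder T Ω) := hcont hP.continuousOn
  have hrel : ∀ z ∈ closure (stCylinder T Ω),
      relEnergy γ (ρ z) (u z) (R z) (U z) = k z - a z + m z + q z := fun z hz =>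
    relEnergy_eq hγ (hRpos z hz) _ _ _
  have Ie : IntegrableOn (fun z => relEnergy γ (ρ z) (u z) (R z) (U z)) (stCylinder T Ω) := by
    refine (((Ik.sub Ia).add Im).add Iq).congr ?_
    filter_upwards [hae] with z hz
    exact (hrel z (subset_closure hz)).symm
  set pm : ℝ × Space d → ℝ := fun z => ∑ i, (U' z (1, 0) i * (ρ z * u z i)
        + (∑ j, velGrad U' z i j * (ρ z * u z i * u z j)) + velGrad U' z i i * ρ z ^ γ
        - ∑ j, velGrad U' z i j * stress μ η (G z) i j) with hpm
  have Ipm : IntegrableOn pm (stCylinder T Ω) := integrable_finsetSum _ fun i _ =>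
    (((hmulc (cU' _ i) (Iu i)).add (integrable_finsetSum _ fun j _ =>
      hmulc (cU' _ i) (Iuu i j))).add (hmulc (cU' _ i) Ip)).sub
      (integrable_finsetSum _ fun j _ => hmulc (cU' _ i) (IS i j))
  set ψ' : ℝ × Space d → ℝ × Space d →L[ℝ] ℝ := fun z =>
    (∑ i, U z i • (EuclideanSpace.proj (𝕜 := ℝ) i).comp (U' z)) + (-(γ * R z ^ (γ - 2))) • R' z
    with hψ'
  set pc : ℝ × Space d → ℝ := fun z => ψ' z (1, 0) * ρ z
    + ∑ j, ψ' z (0, EuclideanSpace.single j 1) * (ρ z * u z j) with hpc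
  have Ipc : IntegrableOn pc (stCylinder T Ω) :=
    (hmulc (cψ' _) Iρ).add (integrable_finsetSum _ fun j _ => hmulc (cψ' _) (Iu j))
  set pq : ℝ × Space d → ℝ := fun z => ((γ * R z ^ (γ - 1)) • R' z) (1, 0) with hpq
  have Ipq : IntegrableOn pq (stCylinder T Ω) := hcont cP'
  have hψ'v : ∀ z v, ψ' z v = (∑ i, U z i * U' z v i) - γ * R z ^ (γ - 2) * R' z v := by
    intro z v
    simp [hψ', sum_apply]
    ring
  have hprod : production γ μ η ρ u G R R' U U' = fun z =>
      -contract (stress μ η (G z)) (G z) - pm z + pc z + pq z := by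
    funext z
    simp only [production, hpm, hpc, hpq, hψ'v]
    rfl
  refine ⟨Ie, ?_, ?_⟩
  · rw [hprod]
    exact ((ISG.neg.sub Ipm).add Ipc).add Ipq
  -- At time zero the four terms add up to the relative energy of equal states, which is zero.
  have hinit := h.initial
  have haeΩ : ∀ᵐ x ∂(volume.restrict Ω), x ∈ Ω := ae_restrict_mem hΩ.measurableSet
  have h0S : ∀ x ∈ closure Ω, ((0 : ℝ), x) ∈ closure (stCylinder T Ω) := fun x hx => by
    rw [hcl]; exact ⟨left_mem_Icc.2 hT.le, hx⟩
  have hc0 : ∀ {f : ℝ × Space d → ℝ}, ContinuousOn f (closure (stCylinder T Ω)) →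
      IntegrableOn (fun x => f (0, x)) Ω := fun {f} hf => by
    have : ContinuousOn (fun x => f (0, x)) (closure Ω) := hf.comp (by fun_prop) h0S
    exact (this.integrableOn_compact hb.isCompact_closure).mono_set subset_closure
  have I0u : ∀ i, IntegrableOn (fun x => ρ₀ x * u₀ x i) Ω := fun i => by
    refine (hc0 (f := fun z => R z * U z i) (hR.continuousOn.mul (cU i))).congr ?_
    filter_upwards [hinit] with x hx
    simp only [hx.1, hx.2]
  set k₀ : Space d → ℝ := fun x => 1 / 2 * (ρ₀ x * ‖u₀ x‖ ^ 2) + 1 / (γ - 1) * ρ₀ x ^ γ with hk₀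
  set a₀ : Space d → ℝ := fun x => ∑ i, U (0, x) i * (ρ₀ x * u₀ x i) with ha₀
  set m₀ : Space d → ℝ := fun x => massMultiplier γ (R (0, x)) (U (0, x)) * ρ₀ x with hm₀
  have Ik₀ : IntegrableOn k₀ Ω := by
    refine (hc0 (f := fun z => 1 / 2 * (R z * ‖U z‖ ^ 2) + 1 / (γ - 1) * R z ^ γ)
      ((continuousOn_const.mul (hR.continuousOn.mul (hU.continuousOn.norm.pow 2))).add
        (continuousOn_const.mul hP.continuousOn))).congr ?_
    filter_upwards [hinit] with x hx
    simp only [hk₀, hx.1, hx.2]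
  have Ia₀ : IntegrableOn a₀ Ω := by
    refine (hc0 (f := fun z => ∑ i, U z i * (R z * U z i))
      (continuousOn_finsetSum _ fun i _ => (cU i).mul (hR.continuousOn.mul (cU i)))).congr ?_
    filter_upwards [hinit] with x hx
    simp only [ha₀, hx.1, hx.2]
  have Im₀ : IntegrableOn m₀ Ω := by
    refine (hc0 (f := fun z => massMultiplier γ (R z) (U z) * R z)
      (hψ.continuousOn.mul hR.continuousOn)).congr ?_
    filter_upwards [hinit] with x hx
    simp only [hm₀, hx.1]
  have Iq₀ : IntegrableOn (fun x => q (0, x)) Ω := hc0 hP.continuousOn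
  have hzero : (∫ x in Ω, k₀ x) - (∫ x in Ω, a₀ x) + (∫ x in Ω, m₀ x) + ∫ x in Ω, q (0, x) = 0 := by
    rw [← integral_sub_add_add Ik₀ Ia₀ Im₀ Iq₀]
    refine integral_eq_zero_of_ae ?_
    filter_upwards [hinit, haeΩ] with x hx hxΩ
    have h1 := relEnergy_eq hγ (hRpos _ (h0S x (subset_closure hxΩ))) (ρ₀ x) (u₀ x) (U (0, x))
    have h2 : relEnergy γ (ρ₀ x) (u₀ x) (R (0, x)) (U (0, x)) = 0 := by
      rw [hx.1, hx.2, relEnergy_self]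
    rw [h2] at h1
    exact h1.symm
  have T1 := hmom.test_of_eq_zero_frontier hΩ hb hT hU.continuousOn
    (U' := fun i z => (EuclideanSpace.proj (𝕜 := ℝ) i).comp (U' z)) (fun i => hU.coord i)
    h.no_slip Iu Iuu Ip IS I0u
  have T2 := hmass.test hΩ hψ
  filter_upwards [T1, T2, hen, integrableOn_slice Ik, integrableOn_slice Ia, integrableOn_slice Im,
    integrableOn_slice Iq, ae_restrict_mem measurableSet_Ioo]
    with τ h1 h2 h3 Jk Ja Jm Jq hτ
  have hsub := stCylinder_subset (Ω := Ω) hτ.2.le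
  have h4 := hP.integral_sub_eq hΩ hb hT hτ
  have h1' : (∫ z in stCylinder τ Ω, pm z) + ∫ x in Ω, (a₀ x - a (τ, x)) = 0 := h1
  have h2' : (∫ z in stCylinder τ Ω, pc z) + ∫ x in Ω, (m₀ x - m (τ, x)) = 0 := h2
  have h3' : (∫ x in Ω, k (τ, x)) + (∫ z in stCylinder τ Ω, contract (stress μ η (G z)) (G z))
      ≤ ∫ x in Ω, k₀ x := h3
  have h4' : ∫ x in Ω, (q (τ, x) - q (0, x)) = ∫ z in stCylinder τ Ω, pq z := h4
  rw [integral_sub Ia₀ Ja] at h1'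
  rw [integral_sub Im₀ Jm] at h2'
  rw [integral_sub Jq Iq₀] at h4'
  have e1 : ∫ x in Ω, relEnergy γ (ρ (τ, x)) (u (τ, x)) (R (τ, x)) (U (τ, x))
      = (∫ x in Ω, k (τ, x)) - (∫ x in Ω, a (τ, x)) + (∫ x in Ω, m (τ, x))
        + ∫ x in Ω, q (τ, x) := by
    rw [← integral_sub_add_add Jk Ja Jm Jq]
    refine setIntegral_congr_fun hΩ.measurableSet fun x hx => ?_
    exact hrel (τ, x) (subset_closure ⟨hτ, hx⟩)
  have e2 : ∫ z in stCylinder τ Ω, production γ μ η ρ u G R R' U U' z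
      = -(∫ z in stCylinder τ Ω, contract (stress μ η (G z)) (G z))
        - (∫ z in stCylinder τ Ω, pm z) + (∫ z in stCylinder τ Ω, pc z)
        + ∫ z in stCylinder τ Ω, pq z := by
    have n1 : IntegrableOn (fun z => -contract (stress μ η (G z)) (G z)) (stCylinder τ Ω) :=
      (IntegrableOn.mono_set ISG hsub).neg
    have n2 := Ipm.mono_set hsub
    have n3 := Ipc.mono_set hsub
    have n4 := Ipq.mono_set hsub
    rw [hprod, ← integral_neg, ← integral_sub_add_add n1 n2 n3 n4]
  rw [e1, e2]
  linarith

end RelativeEnergy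

end CompressibleNS

/-! ### Weak-strong uniqueness -/

open CompressibleNS in
theorem mainTheorem4 {d : ℕ} (Ω : Set (CompressibleNS.Space d))
    (hΩ : CompressibleNS.IsBoundedLipschitzDomain Ω)
    (T : ℝ) (hT : 0 < T) (γ : ℝ) (hγ : 1 < γ) (μ η : ℝ) (hμ : 0 < μ) (hη : 0 ≤ η)
    (ρ₀ : CompressibleNS.Space d → ℝ) (u₀ : CompressibleNS.Space d → CompressibleNS.Space d)
    (ρ : ℝ × CompressibleNS.Space d → ℝ) (u : ℝ × CompressibleNS.Space d → CompressibleNS.Space d)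
    (R : ℝ × CompressibleNS.Space d → ℝ) (U : ℝ × CompressibleNS.Space d → CompressibleNS.Space d)
    (hweak : CompressibleNS.IsAdmissibleWeakSolution Ω T γ μ η ρ₀ u₀ ρ u)
    (hstrong : CompressibleNS.IsStrongSolution Ω T γ μ η ρ₀ u₀ R U) :
    ∀ᵐ z ∂(volume.restrict (Ioo 0 T ×ˢ Ω)), ρ z = R z ∧ u z = U z := by
  change ∀ᵐ z ∂(volume.restrict (stCylinder T Ω)), ρ z = R z ∧ u z = U z
  obtain ⟨h0, hρ, hE, G, hu, hmass, hmom, hen⟩ := hweak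
  have hop := isOpen_stCylinder (T := T) hΩ.isOpen
  have hcl := closure_stCylinder hT Ω
  have hcomp := isCompact_closure_stCylinder hΩ.isBounded hT
  obtain ⟨R', hR⟩ := hstrong.density_C1.exists_hasC1Ext hop le_rfl
  obtain ⟨U', hU⟩ := hstrong.velocity_C1C2.exists_hasC1Ext hΩ.isOpen hΩ.isBounded hT
  obtain ⟨Ie, Ip, hrel⟩ := relEnergy_inequality hγ hΩ.isOpen hΩ.isBounded hT h0 hρ hE hu hmass hmom
    hen hstrong hR hU
  have hRpos : ∀ z ∈ closure (stCylinder T Ω), 0 < R z := fun z hz => by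
    rw [hcl] at hz
    exact hstrong.density_pos z.1 hz.1 z.2 hz.2
  obtain ⟨M, hM⟩ := hΩ.isBounded.exists_norm_le
  have hne : (closure (stCylinder T Ω)).Nonempty := by
    rw [hcl]
    exact (nonempty_Icc.2 hT.le).prod hΩ.isConnected.nonempty.closure
  obtain ⟨zm, hzm, hmin⟩ := hcomp.exists_isMinOn hne hR.continuousOn
  obtain ⟨Rmax, hmax⟩ := hcomp.exists_bound_of_continuousOn hR.continuousOn
  have cA : ∀ i j, ContinuousOn (fun z => velGrad U' z i j) (closure (stCylinder T Ω)) := fun i j =>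
    (hU.coord i).continuousOn_deriv.clm_apply continuousOn_const
  have cb : ∀ i, ContinuousOn (fun z => inertialForce γ R R' U U' z i)
      (closure (stCylinder T Ω)) := fun i =>
    ((hR.continuousOn.mul ((hU.coord i).continuousOn_deriv.clm_apply continuousOn_const)).add
      (hR.continuousOn.mul (continuousOn_finsetSum _ fun j _ =>
        (cA i j).mul (hU.coord j).continuousOn))).add
      ((continuousOn_const.mul (hR.continuousOn.rpow_const fun z hz =>
        Or.inl (hRpos z hz).ne')).mul (hR.continuousOn_deriv.clm_apply continuousOn_const))
  choose CA hCA using fun i j => hcomp.exists_bound_of_continuousOn (cA i j)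
  choose Cb hCb using fun i => hcomp.exists_bound_of_continuousOn (cb i)
  -- `4 * M ^ 2` is the Poincaré constant of `Ω`; the summand `1` keeps the quotient meaningful if
  -- `M = 0`.
  have hε : 0 < μ / (4 * M ^ 2 + 1) := by positivity
  have hεM : μ / (4 * M ^ 2 + 1) * (4 * M ^ 2) ≤ μ := by
    rw [div_mul_eq_mul_div, div_le_iff₀ (by positivity)]
    nlinarith
  have hRm := hRpos zm hzm
  obtain ⟨C, -, hC⟩ := exists_error_le (d := d) hγ (a := R zm ^ (γ - 1)) (Rmin := R zm)
    (Rmax := Rmax) (CA := ∑ i, ∑ j, |CA i j|) (Cb := ∑ i, |Cb i|) (Real.rpow_pos_of_pos hRm _) hRm hε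
  have hCA' : ∀ z ∈ closure (stCylinder T Ω), ∀ i j, |velGrad U' z i j| ≤ ∑ i, ∑ j, |CA i j| := by
    intro z hz i j
    refine ((hCA i j z hz).trans (le_abs_self _)).trans ?_
    refine (Finset.single_le_sum (f := fun j => |CA i j|) (fun j _ => abs_nonneg _)
      (Finset.mem_univ j)).trans ?_
    exact Finset.single_le_sum (f := fun i => ∑ j, |CA i j|)
      (fun i _ => Finset.sum_nonneg fun j _ => abs_nonneg _) (Finset.mem_univ i)
  have hCb' : ∀ z ∈ closure (stCylinder T Ω), ∀ i, |inertialForce γ R R' U U' z i| ≤ ∑ i, |Cb i| := by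
    intro z hz i
    refine ((hCb i z hz).trans (le_abs_self _)).trans ?_
    exact Finset.single_le_sum (f := fun i => |Cb i|) (fun i _ => abs_nonneg _) (Finset.mem_univ i)
  set E : ℝ → ℝ := fun t => ∫ x in Ω, relEnergy γ (ρ (t, x)) (u (t, x)) (R (t, x)) (U (t, x))
    with hEdef
  have hprodE : Integrable (fun z => relEnergy γ (ρ z) (u z) (R z) (U z))
      ((volume.restrict (Ioo 0 T)).prod (volume.restrict Ω)) := by
    rw [← volume_restrict_stCylinder]; exact Ie
  have hprodP : Integrable (production γ μ η ρ u G R R' U U')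
      ((volume.restrict (Ioo 0 T)).prod (volume.restrict Ω)) := by
    rw [← volume_restrict_stCylinder]; exact Ip
  have hEi : IntegrableOn E (Ioo 0 T) := hprodE.integral_prod_left
  have hae0 : ∀ᵐ t ∂(volume.restrict (Ioo 0 T)), ∀ᵐ x ∂(volume.restrict Ω), 0 ≤ ρ (t, x) := by
    have := h0
    rw [volume_restrict_stCylinder] at this
    exact Measure.ae_ae_of_ae_prod this
  have hnn : ∀ z ∈ closure (stCylinder T Ω), 0 ≤ ρ z →
      0 ≤ relEnergy γ (ρ z) (u z) (R z) (U z) := fun z hz hρz =>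
    add_nonneg (by positivity) (relPot_nonneg hγ hρz (hRpos z hz))
  have hE0 : ∀ᵐ t ∂(volume.restrict (Ioo 0 T)), 0 ≤ E t := by
    filter_upwards [hae0, ae_restrict_mem measurableSet_Ioo] with t ht htT
    refine integral_nonneg_of_ae ?_
    filter_upwards [ht, ae_restrict_mem hΩ.isOpen.measurableSet] with x hx hxΩ
    exact hnn (t, x) (subset_closure ⟨htT, hxΩ⟩) hx
  have hslice : ∀ᵐ t ∂(volume.restrict (Ioo 0 T)),
      ∫ x in Ω, production γ μ η ρ u G R R' U U' (t, x) ≤ C * E t := by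
    filter_upwards [hae0, hu.slice, integrableOn_slice Ie, integrableOn_slice Ip,
      ae_restrict_mem measurableSet_Ioo] with t ht htu hte htp htT
    refine integral_production_le hγ hμ hη hΩ.isOpen hΩ.isBounded hT hstrong hR hU htT htu ht hte htp
      hM hε.le hεM fun x hx hρx => ?_
    have hz : (t, x) ∈ closure (stCylinder T Ω) := subset_closure ⟨htT, hx⟩
    exact hC (ρ (t, x)) (R (t, x)) (u (t, x)) (U (t, x)) _ _ hρx (hmin hz)
      ((le_abs_self _).trans (hmax _ hz))
      (Real.rpow_le_rpow hRm.le (hmin hz) (by linarith)) (hCA' _ hz) (hCb' _ hz)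
  have hgron : ∀ᵐ τ ∂(volume.restrict (Ioo 0 T)), E τ ≤ C * ∫ t in Ioo 0 τ, E t := by
    filter_upwards [hrel, ae_restrict_mem measurableSet_Ioo] with τ hτ hτT
    refine hτ.trans ?_
    have hsubI : Ioo 0 τ ⊆ Ioo 0 T := Ioo_subset_Ioo_right hτT.2.le
    rw [setIntegral_stCylinder (Ip.mono_set (stCylinder_subset hτT.2.le)), ← integral_const_mul]
    refine integral_mono_ae ?_ ((hEi.mono_set hsubI).const_mul C)
      (ae_restrict_of_ae_restrict_of_subset hsubI hslice)
    exact IntegrableOn.mono_set (s := Ioo 0 τ) (t := Ioo 0 T) hprodP.integral_prod_left hsubI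
  have hEz := ae_eq_zero_of_ae_le_mul_integral hT hEi hE0 hgron
  have hint : ∫ z in stCylinder T Ω, relEnergy γ (ρ z) (u z) (R z) (U z) = 0 := by
    rw [setIntegral_stCylinder Ie]
    exact integral_eq_zero_of_ae hEz
  have hae : ∀ᵐ z ∂(volume.restrict (stCylinder T Ω)), z ∈ stCylinder T Ω :=
    ae_restrict_mem hop.measurableSet
  have hz := (setIntegral_eq_zero_iff_of_nonneg_ae (by
    filter_upwards [h0, hae] with z hz1 hz2 using hnn z (subset_closure hz2) hz1) Ie).1 hint
  filter_upwards [hz, h0, hae] with z hz hρz hzS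
  have hRz := hRpos z (subset_closure hzS)
  have hp := relPot_nonneg hγ hρz hRz
  have hk : 0 ≤ 1 / 2 * (ρ z * ‖u z - U z‖ ^ 2) := by positivity
  have hsum : 1 / 2 * (ρ z * ‖u z - U z‖ ^ 2) + relPot γ (ρ z) (R z) = 0 := hz
  have hρR : ρ z = R z := eq_of_relPot_eq_zero hγ hρz hRz (by linarith)
  refine ⟨hρR, ?_⟩
  have h1 : R z * ‖u z - U z‖ ^ 2 = 0 := by rw [← hρR]; linarith
  have h2 : ‖u z - U z‖ = 0 := by
    rcases mul_eq_zero.1 h1 with h | h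
    · exact absurd h hRz.ne'
    · exact pow_eq_zero_iff two_ne_zero |>.1 h
  exact sub_eq_zero.1 (norm_eq_zero.1 h2)
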